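/- Let $G$ be a connected finite-dimensional real Lie group with semisimple Lie algebra $\mathfrak g$ of dimension $n$ and Killing form $k$, and let $\pi\colon P\to M$ be a smooth principal $G$-bundle (right action) over a smooth manifold $M$ (Hausdorff, second countable, without boundary). Let $A=\Gamma_G(TP)$ be its Atiyah Lie algebroid, i.e. the Lie algebra and $C^\infty(M)$-module of $G$-invariant vector fields on $P$, with anchor $\pi_*\colon A\to\Gamma(TM)$ and kernel $$L=\Gamma_G(P,\mathfrak g)=\{v\colon P\to\mathfrak g \text{ smooth}\mid v(p\cdot g)=\mathrm{Ad}_{g^{-1}}v(p)\},\qquad \iota(v)(p)=\tfrac{d}{dt}\big|_{t=0}\,p\cdot e^{-tv(p)}.$$ Thus $L$ is the space of sections of the adjoint bundle $\mathcal L=P\times_{\mathrm{Ad}}\mathfrak g$. Let $h$ be the metric on $\mathcal L$ given by the Killing form, $h(v,w)(\pi(p))=k(v(p),w(p))$. Let $E_1,\dots,E_n$ be a basis of $\mathfrak g$ and $\theta^1,\dots,\theta^n$ its dual basis. For a local trivialization $\Psi\colon U\times\mathfrak g\to\mathcal L|_U$ of $\mathcal L$ as a bundle of Lie algebras over an open set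 $U\subseteq M$, put $h_{\mathrm{loc}}(\gamma,\eta)=h(\Psi(\gamma),\Psi(\eta))$, $h_{ab}=h_{\mathrm{loc}}(E_a,E_b)$ and $|h_{\mathrm{loc}}|=|\det(h_{ab})|$. Let $\Omega^q_{\mathrm{Lie}}(P)$ be the space of alternating $C^\infty(M)$-multilinear maps $A^q\to C^\infty(M)$ with complex-valued functions as values, let $\Omega_{\mathrm{Lie}}(P)=\bigoplus_q\Omega^q_{\mathrm{Lie}}(P)$, and let $\widehat{\mathrm d}_{\mathrm{Lie}}$ be the differential given by the Koszul formula, where $A$ acts on functions through $\pi_*$. Let $\mathrm d$ be the de Rham differential on $\Omega(M)$. The inner integral $\int_{\mathrm{inner}}\colon\Omega^{r+n}_{\mathrm{Lie}}(P)\to\Omega^r(M)$ sends $\omega$ to the factor (written on the left) of $\sqrt{|h_{\mathrm{loc}}|}\,\theta^1\wedge\dots\wedge\theta^n$ in the local expressions of $\omega$ in the trivializations of $A$ given by local sections of $P$. Explicitly, $\int_{\mathrm{inner}}\omega=\eta$ is the form on $M$ such that for all $X_1,\dots,X_r\in A$, $\gamma_1,\dots,\gamma_n\in L$ and $p\in P$,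 with $x=\pi(p)$, $$\omega(X_1,\dots,X_r,\iota\gamma_1,\dots,\iota\gamma_n)(x)=\eta(\pi_*X_1,\dots,\pi_*X_r)(x)\cdot\sqrt{|\det h_x(E_a^p,E_b^p)|}\cdot\det\big(\theta^a(\gamma_b(p))\big)_{a,b},$$ where $E^p_a=[p,E_a]\in\mathcal L_x$ is the element whose value at $p$ is $E_a$. Forms of degree less than $n$ have inner integral $0$. Then: 1. In every local trivialization $(U,\Psi)$ as above, the matrix $(h_{ab})$ is constant on $U$, so that $\sqrt{|h_{\mathrm{loc}}|}$ is locally constant. 2. The inner integral is well defined: for every $\omega\in\Omega^{r+n}_{\mathrm{Lie}}(P)$ there is exactly one form $\eta$ on $M$ as above. 3. If $\mathfrak g$ is unimodular, i.e. $\mathrm{tr}(\mathrm{ad}_x)=0$ for all $x\in\mathfrak g$, then for every $\omega\in\Omega_{\mathrm{Lie}}(P)$ $$\int_{\mathrm{inner}}\widehat{\mathrm d}_{\mathrm{Lie}}\,\omega=\mathrm d\int_{\mathrm{inner}}\omega.$$ -/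

import Mathlib

section AlgebraicForms

/-- A module `V` over the functions `R` on which the Lie-Rinehart ring `A` acts by derivations. -/
class LieRinehartModule (R A V : Type*) [CommRing R] [LieRing A] [Module R A] [LieRingModule A R]
    [AddCommGroup V] [Module R V] [LieRingModule A V] : Prop where
  smul_lie' (f : R) (x : A) (v : V) : ⁅f • x, v⁆ = f • ⁅x, v⁆
  lie_smul' (x : A) (f : R) (v : V) : ⁅x, f • v⁆ = f • ⁅x, v⁆ + ⁅x, f⁆ • v

variable {R A V : Type*} [CommRing R] [LieRing A] [Module R A]
  [AddCommGroup V] [Module R V] [LieRingModule A V]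

/-- The part of the Koszul formula involving brackets, i.e.
`∑_{a < b} (-1) ^ (a + b) ω([X_a, X_b], X_0, …, X̂_a, …, X̂_b, …, X_q)`; the pairs `a < b` are
written as `a = i.castSucc`, `b = j.succ` with `i ≤ j`, whence the minus sign. -/
def koszulBracketPart : ∀ {q : ℕ}, (A [⋀^Fin q]→ₗ[R] V) → (Fin (q + 1) → A) → V
  | 0, _, _ => 0
  | n + 1, ω, X => - ∑ i : Fin (n + 1), ∑ j ≥ i, (-1 : ℤ) ^ (i + j : ℕ) •
      ω (Matrix.vecCons ⁅X i.castSucc, X j.succ⁆ (j.removeNth (i.castSucc.removeNth X)))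

/-- The Koszul formula
`∑_i (-1) ^ i X_i · ω(…, X̂_i, …) + ∑_{i < j} (-1) ^ (i + j) ω([X_i, X_j], …, X̂_i, …, X̂_j, …)`. -/
def koszul {q : ℕ} (ω : A [⋀^Fin q]→ₗ[R] V) (X : Fin (q + 1) → A) : V :=
  ∑ i : Fin (q + 1), (-1 : ℤ) ^ (i : ℕ) • ⁅X i, ω (i.removeNth X)⁆ + koszulBracketPart ω X

open AlternatingMap in
theorem two_nsmul_koszul_eq {q : ℕ} (ω : A [⋀^Fin q]→ₗ[R] V) :
    ∃ D : A [⋀^Fin (q + 1)]→ₗ[ℤ] V, ∀ X, D X = (2 : ℕ) • koszul ω X := by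
  have hz : ∀ n (ω : A [⋀^Fin n]→ₗ[R] V), ∃ ωz : A [⋀^Fin n]→ₗ[ℤ] V, ∀ X, ωz X = ω X :=
    fun n ω => ⟨{ ω.toMultilinearMap.restrictScalars ℤ with
      map_eq_zero_of_eq' := fun v i j h hij => ω.map_eq_zero_of_eq v h hij }, fun X => rfl⟩
  have h1 : ∃ D : A [⋀^Fin (q + 1)]→ₗ[ℤ] V, ∀ X,
      D X = ∑ i : Fin (q + 1), (-1 : ℤ) ^ (i : ℕ) • ⁅X i, ω (i.removeNth X)⁆ := by
    obtain ⟨ωz, hωz⟩ := hz q ω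
    let a : A → V →ₗ[ℤ] V := fun x =>
      (AddMonoidHom.mk' (fun v : V => ⁅x, v⁆) (fun _ _ => lie_add _ _ _)).toIntLinearMap
    let g : A →ₗ[ℤ] A [⋀^Fin q]→ₗ[ℤ] V :=
      (AddMonoidHom.mk' (fun x => (a x).compAlternatingMap ωz)
        (fun x y => by ext v; exact add_lie x y _)).toIntLinearMap
    refine ⟨alternatizeUncurryFin g, fun X => ?_⟩
    rw [alternatizeUncurryFin_apply]
    refine Finset.sum_congr rfl fun i _ => ?_
    rw [← hωz]; rfl
  have h2 : ∃ D : A [⋀^Fin (q + 1)]→ₗ[ℤ] V, ∀ X, D X = (2 : ℕ) • koszulBracketPart ω X := by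
    cases q with
    | zero => exact ⟨0, fun X => by simp [koszulBracketPart]⟩
    | succ n =>
      obtain ⟨ωz, hωz⟩ := hz _ ω
      let b : A → A →ₗ[ℤ] A := fun x =>
        (AddMonoidHom.mk' (fun v : A => ⁅x, v⁆) (fun _ _ => lie_add _ _ _)).toIntLinearMap
      let g : A →ₗ[ℤ] A →ₗ[ℤ] A [⋀^Fin n]→ₗ[ℤ] V :=
        (AddMonoidHom.mk' (fun x => (curryLeft ωz).comp (b x)) (fun x y => by
          ext v w
          change ωz.curryLeft ⁅x + y, v⁆ w = ωz.curryLeft ⁅x, v⁆ w + ωz.curryLeft ⁅y, v⁆ w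
          rw [add_lie, map_add]; rfl)).toIntLinearMap
      have hg : ∀ x y v, g x y v = ω (Matrix.vecCons ⁅x, y⁆ v) := fun x y v => hωz _
      refine ⟨-alternatizeUncurryFin (alternatizeUncurryFinLM ∘ₗ g), fun X => ?_⟩
      rw [AlternatingMap.neg_apply, alternatizeUncurryFin_alternatizeUncurryFinLM_comp_apply]
      simp only [koszulBracketPart, smul_neg, Finset.smul_sum, hg]
      congr 1
      refine Finset.sum_congr rfl fun i _ => Finset.sum_congr rfl fun j _ => ?_
      rw [← lie_skew (X i.castSucc) (X j.succ), smul_comm, two_nsmul]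
      congr 1
      rw [sub_eq_add_neg]
      congr 1
      have := (ω.curryLeft).map_neg ⁅X j.succ, X i.castSucc⁆
      have := congrArg (fun φ => φ (j.removeNth (i.castSucc.removeNth X))) this
      exact this.symm
  obtain ⟨D1, h1⟩ := h1
  obtain ⟨D2, h2⟩ := h2
  refine ⟨2 • D1 + D2, fun X => ?_⟩
  rw [koszul, smul_add, ← h1, ← h2]
  rfl

variable [LieRingModule A R]

theorem koszul_aux_removeNth {B : Type*} {m : ℕ} (i : Fin (m + 1)) (Y : B) (Z : Fin (m + 1) → B) :
    i.succ.removeNth (Matrix.vecCons Y Z) = Matrix.vecCons Y (i.removeNth Z) := by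
  ext k
  refine Fin.cases ?_ (fun k => ?_) k
  · rfl
  · simp [Fin.removeNth]

/-- Function-linearity of the Koszul formula in the first argument. -/
theorem koszul_smul_zero [LieRinehartRing R A] [LieRinehartModule R A V] {q : ℕ}
    (ω : A [⋀^Fin q]→ₗ[R] V) (f : R) (Y : A) (Z : Fin q → A) :
    koszul ω (Matrix.vecCons (f • Y) Z) = f • koszul ω (Matrix.vecCons Y Z) := by
  cases q with
  | zero => simp [koszul, koszulBracketPart, LieRinehartModule.smul_lie' (R := R)]
  | succ n =>
    have hc : ∀ (W : Fin n → A), ω (Matrix.vecCons (f • Y) W) = f • ω (Matrix.vecCons Y W) :=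
      fun W => ω.map_vecCons_smul W f Y
    have hr0 : ∀ (Y : A) (Z : Fin (n + 1) → A),
        Fin.removeNth 0 (Matrix.vecCons Y Z) = Z := fun _ _ => rfl
    have hb : ∀ (j : Fin (n + 1)), ω (Matrix.vecCons ⁅f • Y, Z j⁆ (j.removeNth Z)) =
        f • ω (Matrix.vecCons ⁅Y, Z j⁆ (j.removeNth Z))
          - ⁅Z j, f⁆ • ω (Matrix.vecCons Y (j.removeNth Z)) := by
      intro j
      rw [← lie_skew, LieRinehartRing.leibniz_smul_right' (Z j) Y f, neg_add, ← smul_neg, lie_skew,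
        ← neg_smul, ω.map_vecCons_add, ω.map_vecCons_smul, ω.map_vecCons_smul, neg_smul,
        sub_eq_add_neg]
    have h0 : Finset.Ici (0 : Fin (n + 1)) = Finset.univ := by ext; simp
    have hsum : ∀ Y : A, ∑ i : Fin (n + 1), ∑ j ≥ i, (-1 : ℤ) ^ (i + j : ℕ) •
        ω (Matrix.vecCons ⁅Matrix.vecCons Y Z i.castSucc, Matrix.vecCons Y Z j.succ⁆
          (j.removeNth (i.castSucc.removeNth (Matrix.vecCons Y Z)))) =
        ∑ j : Fin (n + 1), (-1 : ℤ) ^ (j : ℕ) • ω (Matrix.vecCons ⁅Y, Z j⁆ (j.removeNth Z)) +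
        ∑ i : Fin n, ∑ j ∈ Finset.Ici i.succ, (-1 : ℤ) ^ (i.succ + j : ℕ) •
        ω (Matrix.vecCons ⁅Z i.castSucc, Z j⁆
          (j.removeNth (i.succ.castSucc.removeNth (Matrix.vecCons Y Z)))) := by
      intro Y
      rw [Fin.sum_univ_succ, h0]
      congr 1
      refine Finset.sum_congr rfl fun j _ => ?_
      simp [hr0]
    have hlast : ∀ (i : Fin n) (j : Fin (n + 1)), i.succ ≤ j →
        ω (Matrix.vecCons ⁅Z i.castSucc, Z j⁆
          (j.removeNth (i.succ.castSucc.removeNth (Matrix.vecCons (f • Y) Z)))) =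
        f • ω (Matrix.vecCons ⁅Z i.castSucc, Z j⁆
          (j.removeNth (i.succ.castSucc.removeNth (Matrix.vecCons Y Z)))) := by
      intro i j hij
      obtain ⟨j, rfl⟩ := Fin.exists_succ_eq.2 (Fin.ne_of_gt (lt_of_lt_of_le (Fin.succ_pos i) hij))
      cases n with
      | zero => exact i.elim0
      | succ n =>
        rw [← Fin.succ_castSucc, koszul_aux_removeNth, koszul_aux_removeNth, koszul_aux_removeNth,
          koszul_aux_removeNth]
        have := (ω.curryLeft ⁅Z i.castSucc, Z j.succ⁆).map_vecCons_smul
          (j.removeNth (i.castSucc.removeNth Z)) f Y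
        exact this
    have e2 : ∑ i : Fin n, ∑ j ∈ Finset.Ici i.succ, (-1 : ℤ) ^ (i.succ + j : ℕ) •
        ω (Matrix.vecCons ⁅Z i.castSucc, Z j⁆
          (j.removeNth (i.succ.castSucc.removeNth (Matrix.vecCons (f • Y) Z)))) =
        f • ∑ i : Fin n, ∑ j ∈ Finset.Ici i.succ, (-1 : ℤ) ^ (i.succ + j : ℕ) •
        ω (Matrix.vecCons ⁅Z i.castSucc, Z j⁆
          (j.removeNth (i.succ.castSucc.removeNth (Matrix.vecCons Y Z)))) := by
      rw [Finset.smul_sum]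
      refine Finset.sum_congr rfl fun i _ => ?_
      rw [Finset.smul_sum]
      refine Finset.sum_congr rfl fun j hj => ?_
      rw [hlast i j (by simpa using hj), smul_comm]
    have hfst : ∀ Y : A, ∑ i : Fin (n + 2), (-1 : ℤ) ^ (i : ℕ) •
        ⁅Matrix.vecCons Y Z i, ω (i.removeNth (Matrix.vecCons Y Z))⁆ =
        ⁅Y, ω Z⁆ - ∑ i : Fin (n + 1), (-1 : ℤ) ^ (i : ℕ) •
          ⁅Z i, ω (Matrix.vecCons Y (i.removeNth Z))⁆ := by
      intro Y
      rw [Fin.sum_univ_succ, sub_eq_add_neg, ← Finset.sum_neg_distrib]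
      congr 1
      · simp [hr0]
      · refine Finset.sum_congr rfl fun i _ => ?_
        rw [koszul_aux_removeNth, Matrix.cons_val_succ, Fin.val_succ, pow_succ, mul_neg_one,
          neg_smul]
    simp only [koszul, koszulBracketPart]
    rw [hsum, hsum, e2, hfst, hfst]
    simp only [hc, hb, LieRinehartModule.smul_lie', LieRinehartModule.lie_smul', smul_add,
      smul_sub, Finset.sum_add_distrib, Finset.sum_sub_distrib, Finset.smul_sum,
      smul_neg, smul_comm f ((-1 : ℤ) ^ _)]
    abel

/-- The differential of the Lie-Rinehart complex of `V`-valued forms on `A`. -/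
def lieDifferential [IsAddTorsionFree V] [LieRinehartRing R A] [LieRinehartModule R A V] {q : ℕ}
    (ω : A [⋀^Fin q]→ₗ[R] V) : A [⋀^Fin (q + 1)]→ₗ[R] V :=
  have inj : Function.Injective fun v : V => (2 : ℕ) • v :=
    IsAddTorsionFree.nsmul_right_injective two_ne_zero
  have hadd : ∀ [DecidableEq (Fin (q + 1))] (m : Fin (q + 1) → A) (i : Fin (q + 1)) (x y : A),
      koszul ω (Function.update m i (x + y)) =
        koszul ω (Function.update m i x) + koszul ω (Function.update m i y) := by
    intro _ m i x y
    obtain ⟨D, hD⟩ := two_nsmul_koszul_eq ω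
    apply inj
    simp only [smul_add, ← hD, D.map_update_add]
  have halt : ∀ (v : Fin (q + 1) → A) (i j : Fin (q + 1)), v i = v j → i ≠ j →
      koszul ω v = 0 := by
    intro v i j h hij
    obtain ⟨D, hD⟩ := two_nsmul_koszul_eq ω
    apply inj
    simp only [smul_zero, ← hD, D.map_eq_zero_of_eq v h hij]
  { toFun := koszul ω
    map_update_add' := hadd
    map_update_smul' := by
      intro _ m i f x
      have hswap : ∀ v : Fin (q + 1) → A, i ≠ 0 →
          koszul ω (v ∘ Equiv.swap i 0) = - koszul ω v := by
        intro v hi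
        obtain ⟨D, hD⟩ := two_nsmul_koszul_eq ω
        apply inj
        simp only [smul_neg, ← hD, D.map_swap v hi]
      have h0 : ∀ v : Fin (q + 1) → A,
          koszul ω (Function.update v 0 (f • x)) = f • koszul ω (Function.update v 0 x) := by
        intro v
        have : ∀ y, Function.update v 0 y = Matrix.vecCons y (Fin.tail v) := by
          intro y
          ext k
          refine Fin.cases ?_ (fun k => ?_) k <;> simp [Fin.tail]
        have h' : ∀ y, @Function.update _ _ (fun a b => inferInstance) v 0 y =
            Function.update v 0 y := by
          intro y; congr
        simp only [← h', this, koszul_smul_zero]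
      by_cases hi : i = 0
      · subst hi; exact h0 m
      · have hs : ∀ y, Function.update m i y =
            Function.update (m ∘ Equiv.swap i 0) 0 y ∘ Equiv.swap i 0 := by
          intro y
          ext k
          by_cases hk : k = i
          · subst hk; simp
          · by_cases hk0 : k = 0
            · subst hk0
              simp [Function.update_of_ne hk, Function.update_of_ne hi]
            · have : Equiv.swap i 0 k = k := Equiv.swap_apply_of_ne_of_ne hk hk0
              simp [Function.update_of_ne hk, this, Function.update_of_ne hk0]
        rw [hs, hs, hswap _ hi, hswap _ hi, h0, smul_neg]
    map_eq_zero_of_eq' := fun v i j h hij => halt v i j h hij }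

@[simp] theorem lieDifferential_apply [IsAddTorsionFree V] [LieRinehartRing R A]
    [LieRinehartModule R A V] {q : ℕ} (ω : A [⋀^Fin q]→ₗ[R] V) (X : Fin (q + 1) → A) :
    lieDifferential ω X = koszul ω X := rfl

end AlgebraicForms

open scoped Manifold ContDiff
open VectorField

section VectorFields

variable (E : Type*) [NormedAddCommGroup E] [NormedSpace ℝ E] [FiniteDimensional ℝ E]
  (N : Type*) [TopologicalSpace N] [ChartedSpace E N] [IsManifold 𝓘(ℝ, E) ∞ N]

/-- The smooth functions on `N` with values in `F`. -/
abbrev SmoothFun (F : Type*) [NormedAddCommGroup F] [NormedSpace ℝ F] : Type _ :=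
  C^∞⟮𝓘(ℝ, E), N; 𝓘(ℝ, F), F⟯

/-- The smooth vector fields on `N`. -/
def smoothVectorFields : Submodule ℝ (Π x : N, TangentSpace 𝓘(ℝ, E) x) where
  carrier := {X | ContMDiff 𝓘(ℝ, E) 𝓘(ℝ, E).tangent ∞
    (fun x => (⟨x, X x⟩ : TangentBundle 𝓘(ℝ, E) N))}
  add_mem' hX hY := hX.add_section hY
  zero_mem' := Bundle.contMDiff_zeroSection ℝ (TangentSpace 𝓘(ℝ, E) : N → Type _)
  smul_mem' _ _ hX := hX.const_smul_section

abbrev VF : Type _ := smoothVectorFields E N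

variable {E N}

theorem minSmoothness_two_le : minSmoothness ℝ 2 ≤ ∞ := by
  rw [minSmoothness_of_isRCLikeNormedField]; exact WithTop.coe_le_coe.2 (le_top : (2 : ℕ∞) ≤ ⊤)

theorem minSmoothness_three_le : minSmoothness ℝ 3 ≤ ∞ := by
  rw [minSmoothness_of_isRCLikeNormedField]; exact WithTop.coe_le_coe.2 (le_top : (3 : ℕ∞) ≤ ⊤)

instance isManifold_minSmoothness_two : IsManifold 𝓘(ℝ, E) (minSmoothness ℝ 2) N :=
  IsManifold.of_le minSmoothness_two_le

instance isManifold_minSmoothness_three : IsManifold 𝓘(ℝ, E) (minSmoothness ℝ 3) N :=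
  IsManifold.of_le minSmoothness_three_le

/-- The derivative along a bracket of vector fields is the commutator of the derivatives. -/
theorem mvfderiv_mlieBracket {F : Type*} [NormedAddCommGroup F] [NormedSpace ℝ F]
    {X Y : Π x : N, TangentSpace 𝓘(ℝ, E) x} {f : N → F} {x : N}
    (hX : ContMDiffAt 𝓘(ℝ, E) 𝓘(ℝ, E).tangent ∞
      (fun x => (⟨x, X x⟩ : TangentBundle 𝓘(ℝ, E) N)) x)
    (hY : ContMDiffAt 𝓘(ℝ, E) 𝓘(ℝ, E).tangent ∞
      (fun x => (⟨x, Y x⟩ : TangentBundle 𝓘(ℝ, E) N)) x)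
    (hf : ContMDiffAt 𝓘(ℝ, E) 𝓘(ℝ, F) ∞ f x) :
    mvfderiv 𝓘(ℝ, E) f x (mlieBracket 𝓘(ℝ, E) X Y x) =
      mvfderiv 𝓘(ℝ, E) (fun y => mvfderiv 𝓘(ℝ, E) f y (Y y)) x (X x) -
        mvfderiv 𝓘(ℝ, E) (fun y => mvfderiv 𝓘(ℝ, E) f y (X y)) x (Y x) := by
  set φ := extChartAt 𝓘(ℝ, E) x with hφ
  let p : (Π x : N, TangentSpace 𝓘(ℝ, E) x) → E → E :=
    fun Z => mpullbackWithin 𝓘(ℝ, E) 𝓘(ℝ, E) φ.symm Z (Set.range 𝓘(ℝ, E))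
  set f' : E → F := f ∘ φ.symm with hf'
  have hsrc : φ.source ∈ nhds x := extChartAt_source_mem_nhds x
  have hinv : ∀ y ∈ φ.source, (mfderiv 𝓘(ℝ, E) 𝓘(ℝ, E) φ y).IsInvertible :=
    fun y hy => isInvertible_mfderiv_extChartAt hy
  have hφd : ∀ y ∈ φ.source, MDifferentiableAt 𝓘(ℝ, E) 𝓘(ℝ, E) φ y := fun y hy =>
    mdifferentiableAt_extChartAt (by simpa [hφ] using hy)
  have hpZ : ∀ Z, ∀ᶠ y in nhds x, mfderiv 𝓘(ℝ, E) 𝓘(ℝ, E) φ y (Z y) = p Z (φ y) := by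
    intro Z
    have h := eventuallyEq_mpullback_mpullbackWithin_extChartAt (I := 𝓘(ℝ, E)) (x := x)
      (s := Set.univ) Z
    rw [nhdsWithin_univ] at h
    filter_upwards [h, hsrc] with y hy hys
    rw [hy, mpullback_apply]
    exact (hinv y hys).self_apply_inverse _
  have hf'd : ContDiffAt ℝ ∞ f' (φ x) := by
    have h1 : ContMDiffAt 𝓘(ℝ, E) 𝓘(ℝ, E) ∞ φ.symm (φ x) := by
      have := contMDiffWithinAt_extChartAt_symm_range_self (I := 𝓘(ℝ, E)) (n := ∞) x
      rwa [modelWithCornersSelf_coe, Set.range_id, contMDiffWithinAt_univ] at this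
    have h2 : ContMDiffAt 𝓘(ℝ, E) 𝓘(ℝ, F) ∞ f (φ.symm (φ x)) := by
      rw [extChartAt_to_inv]; exact hf
    exact (h2.comp _ h1).contDiffAt
  have key : ∀ (u : E → F) (g : N → F) (y : N), y ∈ φ.source →
      (∀ᶠ z in nhds y, g z = u (φ z)) → DifferentiableAt ℝ u (φ y) → ∀ v,
      mvfderiv 𝓘(ℝ, E) g y v = fderiv ℝ u (φ y) (mfderiv 𝓘(ℝ, E) 𝓘(ℝ, E) φ y v) := by
    intro u g y hy hg hu v
    have : mfderiv 𝓘(ℝ, E) 𝓘(ℝ, F) g y = mfderiv 𝓘(ℝ, E) 𝓘(ℝ, F) (u ∘ φ) y :=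
      Filter.EventuallyEq.mfderiv_eq hg
    change mfderiv 𝓘(ℝ, E) 𝓘(ℝ, F) g y v = _
    rw [this, mfderiv_comp (I' := 𝓘(ℝ, E)) y hu.mdifferentiableAt (hφd y hy), mfderiv_eq_fderiv]
    rfl
  have hx : x ∈ φ.source := mem_extChartAt_source x
  have hfe : ∀ᶠ z in nhds x, f z = f' (φ z) := by
    filter_upwards [hsrc] with z hz
    simp [hf', φ.left_inv hz]
  have hf'e : ∀ᶠ y in nhds x, DifferentiableAt ℝ f' (φ y) := by
    have : ∀ᶠ z in nhds (φ x), ContDiffAt ℝ 1 f' z :=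
      (hf'd.of_le (by exact mod_cast le_top)).eventually (by simp)
    have h2 := (continuousAt_extChartAt (I := 𝓘(ℝ, E)) x).eventually this
    filter_upwards [h2] with y hy using hy.differentiableAt one_ne_zero
  have hZ : ∀ Z, ∀ᶠ y in nhds x,
      mvfderiv 𝓘(ℝ, E) f y (Z y) = (fun z => fderiv ℝ f' z (p Z z)) (φ y) := by
    intro Z
    filter_upwards [hpZ Z, hfe.eventually_nhds, hf'e, hsrc] with y h1 h2 h3 h4
    rw [key f' f y h4 h2 h3, h1]
  have hpd : ∀ Z : Π x : N, TangentSpace 𝓘(ℝ, E) x, ContMDiffAt 𝓘(ℝ, E) 𝓘(ℝ, E).tangent ∞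
      (fun x => (⟨x, Z x⟩ : TangentBundle 𝓘(ℝ, E) N)) x → DifferentiableAt ℝ (p Z) (φ x) := by
    intro Z hZ
    have h := contMDiffWithinAt_mpullbackWithin_extChartAt_symm (I := 𝓘(ℝ, E)) (s := Set.univ)
      (n := ∞) (m := 1) (x := x) (V := Z)
      (hZ.contMDiffWithinAt.of_le (by exact mod_cast le_top)) uniqueMDiffOn_univ (Set.mem_univ x)
      (WithTop.coe_le_coe.2 (le_top : (1 + 1 : ℕ∞) ≤ ⊤))
    have h' := contMDiffWithinAt_vectorSpace_iff_contDiffWithinAt.1 h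
    rw [Set.preimage_univ, Set.inter_univ] at h'
    exact (h'.contDiffAt (extChartAt_target_mem_nhds x)).differentiableAt one_ne_zero
  have hud : ∀ Z : Π x : N, TangentSpace 𝓘(ℝ, E) x, DifferentiableAt ℝ (p Z) (φ x) →
      DifferentiableAt ℝ (fun z => fderiv ℝ f' z (p Z z)) (φ x) := by
    intro Z hZ
    have : DifferentiableAt ℝ (fderiv ℝ f') (φ x) :=
      (hf'd.fderiv_right (m := 1)
        (WithTop.coe_le_coe.2 (le_top : (1 + 1 : ℕ∞) ≤ ⊤))).differentiableAt one_ne_zero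
    exact this.clm_apply hZ
  rw [key _ _ x hx (hZ X) (hud X (hpd X hX)), key _ _ x hx (hZ Y) (hud Y (hpd Y hY)),
    (hpZ X).self_of_nhds, (hpZ Y).self_of_nhds, key f' f x hx hfe hf'e.self_of_nhds,
    ← fderiv_apply_lieBracket hf'd minSmoothness_two_le (hpd Y hY) (hpd X hX)]
  congr 1
  have : mlieBracket 𝓘(ℝ, E) X Y x = (mfderiv 𝓘(ℝ, E) 𝓘(ℝ, E) φ x).inverse
      (lieBracket ℝ (E := E) (p X) (p Y) (φ x)) := by
    rw [← mlieBracketWithin_univ, mlieBracketWithin_apply]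
    rw [← lieBracketWithin_univ (V := p X)]
    simp only [modelWithCornersSelf_coe, Set.range_id, Set.preimage_univ, Set.inter_univ, p, hφ]
    rfl
  rw [this]
  exact (hinv x hx).self_apply_inverse _

namespace VF

instance : CoeFun (VF E N) (fun _ => Π x : N, TangentSpace 𝓘(ℝ, E) x) := ⟨fun X => X.1⟩

theorem contMDiff (X : VF E N) : ContMDiff 𝓘(ℝ, E) 𝓘(ℝ, E).tangent ∞
    (fun x => (⟨x, X x⟩ : TangentBundle 𝓘(ℝ, E) N)) := X.2

theorem mdifferentiableAt (X : VF E N) (x : N) : MDifferentiableAt 𝓘(ℝ, E) 𝓘(ℝ, E).tangent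
    (fun x => (⟨x, X x⟩ : TangentBundle 𝓘(ℝ, E) N)) x :=
  (X.contMDiff x).mdifferentiableAt (by simp)

@[ext] theorem ext {X Y : VF E N} (h : ∀ x, X x = Y x) : X = Y := Subtype.ext (funext h)

/-- The Lie bracket of vector fields. -/
noncomputable instance : Bracket (VF E N) (VF E N) where
  bracket X Y := ⟨mlieBracket 𝓘(ℝ, E) X.1 Y.1, by
    have : IsManifold 𝓘(ℝ, E) (∞ + 1) N := ‹IsManifold 𝓘(ℝ, E) ∞ N›
    have := ContDiff.mlieBracket_vectorField (m := ⊤) (n := ⊤) X.2 Y.2 (by simp)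
    exact this⟩

theorem bracket_apply (X Y : VF E N) (x : N) : ⁅X, Y⁆ x = mlieBracket 𝓘(ℝ, E) X.1 Y.1 x := rfl

noncomputable instance : LieRing (VF E N) where
  add_lie X Y Z := by
    ext x; exact mlieBracket_add_left (X.mdifferentiableAt x) (Y.mdifferentiableAt x)
  lie_add X Y Z := by
    ext x; exact mlieBracket_add_right (Y.mdifferentiableAt x) (Z.mdifferentiableAt x)
  lie_self X := by ext x; simp [bracket_apply]
  leibniz_lie X Y Z := by
    ext x
    have h : ∀ X : VF E N, ContMDiffAt 𝓘(ℝ, E) 𝓘(ℝ, E).tangent (minSmoothness ℝ 2)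
      (fun x => (⟨x, X x⟩ : TangentBundle 𝓘(ℝ, E) N)) x := fun X => (X.contMDiff x).of_le
        minSmoothness_two_le
    exact leibniz_identity_mlieBracket_apply (h X) (h Y) (h Z)

noncomputable instance : LieAlgebra ℝ (VF E N) where
  lie_smul c X Y := by ext x; exact mlieBracket_const_smul_right (Y.mdifferentiableAt x)

/-- Multiplication of vector fields by functions. -/
noncomputable instance : SMul (SmoothFun E N ℝ) (VF E N) where
  smul f X := ⟨fun x => f x • X x, f.contMDiff.smul_section X.2⟩

theorem smul_apply (f : SmoothFun E N ℝ) (X : VF E N) (x : N) : (f • X) x = f x • X x := rfl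

noncomputable instance : Module (SmoothFun E N ℝ) (VF E N) where
  one_smul X := by ext x; exact one_smul ℝ (X x)
  mul_smul f g X := by ext x; exact mul_smul (f x) (g x) (X x)
  smul_zero f := by ext x; exact smul_zero (f x)
  smul_add f X Y := by ext x; exact smul_add (f x) (X x) (Y x)
  add_smul f g X := by ext x; exact add_smul (f x) (g x) (X x)
  zero_smul X := by ext x; exact zero_smul ℝ (X x)

section Action

variable {F : Type*} [NormedAddCommGroup F] [NormedSpace ℝ F]

/-- The derivative of a function along a vector field. -/
noncomputable instance : Bracket (VF E N) (SmoothFun E N F) where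
  bracket X f := ⟨fun x => mvfderiv 𝓘(ℝ, E) f x (X x), by
    have h1 : ContMDiff 𝓘(ℝ, E).tangent 𝓘(ℝ, F).tangent ∞ (tangentMap 𝓘(ℝ, E) 𝓘(ℝ, F) f) :=
      f.contMDiff.contMDiff_tangentMap (by simp)
    exact (contMDiff_snd_tangentBundle_modelSpace F 𝓘(ℝ, F)).comp (h1.comp X.contMDiff)⟩

theorem act_apply (X : VF E N) (f : SmoothFun E N F) (x : N) :
    ⁅X, f⁆ x = mvfderiv 𝓘(ℝ, E) f x (X x) := rfl

theorem mdifferentiableAt_fun (f : SmoothFun E N F) (x : N) :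
    MDifferentiableAt 𝓘(ℝ, E) 𝓘(ℝ, F) f x := (f.contMDiff x).mdifferentiableAt (by simp)

noncomputable instance : LieRingModule (VF E N) (SmoothFun E N F) where
  add_lie X Y f := by
    ext x; exact (mvfderiv 𝓘(ℝ, E) f x).map_add (X x) (Y x)
  lie_add X f g := by
    ext x
    have := mvfderiv_add (mdifferentiableAt_fun f x) (mdifferentiableAt_fun g x)
    exact DFunLike.congr_fun this (X x)
  leibniz_lie X Y f := by
    ext x
    have := mvfderiv_mlieBracket (X.contMDiff x) (Y.contMDiff x) (f.contMDiff x)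
    change ⁅X, ⁅Y, f⁆⁆ x = ⁅⁅X, Y⁆, f⁆ x + ⁅Y, ⁅X, f⁆⁆ x
    rw [act_apply ⁅X, Y⁆, bracket_apply, this]
    simp only [act_apply]
    exact (sub_add_cancel _ _).symm

instance : IsAddTorsionFree (SmoothFun E N F) where
  nsmul_right_injective n hn f g h := by
    ext x
    have h1 : n • f x = n • g x := DFunLike.congr_fun h x
    have : IsAddTorsionFree F := IsAddTorsionFree.of_isTorsionFree ℝ F
    exact IsAddTorsionFree.nsmul_right_injective hn h1

instance : LieRinehartRing (SmoothFun E N ℝ) (VF E N) where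
  lie_smul_eq_mul' f g X := by
    ext x; exact (mvfderiv 𝓘(ℝ, E) g x).map_smul (f x) (X x)
  leibniz_mul_right' X f g := by
    ext x
    have := DFunLike.congr_fun
      (mvfderiv_mul (mdifferentiableAt_fun f x) (mdifferentiableAt_fun g x)) (X x)
    refine this.trans ?_
    change _ = f x * mvfderiv 𝓘(ℝ, E) g x (X x) + mvfderiv 𝓘(ℝ, E) f x (X x) * g x
    simp [mul_comm]
  leibniz_smul_right' X Y f := by
    ext x
    refine (mlieBracket_smul_right (V := X.1) (mdifferentiableAt_fun f x)
      (Y.mdifferentiableAt x)).trans ?_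
    exact add_comm _ _

instance : LieRinehartModule (SmoothFun E N ℝ) (VF E N) (SmoothFun E N F) where
  smul_lie' f X g := by
    ext x; exact (mvfderiv 𝓘(ℝ, E) g x).map_smul (f x) (X x)
  lie_smul' X f g := by
    ext x
    refine (DFunLike.congr_fun
      (mvfderiv_smul (mdifferentiableAt_fun f x) (mdifferentiableAt_fun g x)) (X x)).trans ?_
    rfl

end Action

end VF

end VectorFields

section Adjoint

variable {EG : Type*} [NormedAddCommGroup EG] [NormedSpace ℝ EG]
  {G : Type*} [TopologicalSpace G] [ChartedSpace EG G] [Group G] [LieGroup 𝓘(ℝ, EG) ∞ G]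

instance lieGroup_minSmoothness_three : LieGroup 𝓘(ℝ, EG) (minSmoothness ℝ 3) G :=
  LieGroup.of_le minSmoothness_three_le

theorem contMDiff_conj (g : G) : ContMDiff 𝓘(ℝ, EG) 𝓘(ℝ, EG) ∞ (fun h : G => g * h * g⁻¹) :=
  (contMDiff_const.mul contMDiff_id).mul contMDiff_const

theorem mdifferentiable_conj (g : G) : MDifferentiable 𝓘(ℝ, EG) 𝓘(ℝ, EG)
    (fun h : G => g * h * g⁻¹) := (contMDiff_conj g).mdifferentiable (by simp)

/-- The adjoint representation `Ad_g`, the derivative at `1` of the conjugation by `g`. -/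
noncomputable def adjointRep (g : G) :
    GroupLieAlgebra 𝓘(ℝ, EG) G →ₗ[ℝ] GroupLieAlgebra 𝓘(ℝ, EG) G where
  toFun v := (mfderiv 𝓘(ℝ, EG) 𝓘(ℝ, EG) (fun h : G => g * h * g⁻¹) 1 v : EG)
  map_add' v w := (mfderiv 𝓘(ℝ, EG) 𝓘(ℝ, EG) (fun h : G => g * h * g⁻¹) 1).map_add v w
  map_smul' c v := (mfderiv 𝓘(ℝ, EG) 𝓘(ℝ, EG) (fun h : G => g * h * g⁻¹) 1).map_smul c v

theorem adjointRep_apply (g : G) (v : GroupLieAlgebra 𝓘(ℝ, EG) G) : (adjointRep g v : EG) =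
    mfderiv 𝓘(ℝ, EG) 𝓘(ℝ, EG) (fun h : G => g * h * g⁻¹) 1 v := rfl

theorem adjointRep_one (v : GroupLieAlgebra 𝓘(ℝ, EG) G) : adjointRep (1 : G) v = v := by
  have : (fun h : G => 1 * h * 1⁻¹) = id := by ext; simp
  change mfderiv 𝓘(ℝ, EG) 𝓘(ℝ, EG) (fun h : G => 1 * h * 1⁻¹) 1 v = _
  rw [this, mfderiv_id]; rfl

theorem mfderiv_apply_congr {N E F N' : Type*} [NormedAddCommGroup E] [NormedSpace ℝ E]
    [NormedAddCommGroup F] [NormedSpace ℝ F] [TopologicalSpace N] [ChartedSpace E N]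
    [TopologicalSpace N'] [ChartedSpace F N'] (f : N → N') {x y : N} (h : x = y) (v : E) :
    (mfderiv 𝓘(ℝ, E) 𝓘(ℝ, F) f x v : F) = mfderiv 𝓘(ℝ, E) 𝓘(ℝ, F) f y v := by
  subst h; rfl

theorem adjointRep_mul (a b : G) (v : GroupLieAlgebra 𝓘(ℝ, EG) G) :
    adjointRep (a * b) v = adjointRep a (adjointRep b v) := by
  have : (fun h : G => a * b * h * (a * b)⁻¹) =
      (fun h : G => a * h * a⁻¹) ∘ (fun h : G => b * h * b⁻¹) := by ext; simp [mul_assoc]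
  have h2 := mfderiv_comp (I' := 𝓘(ℝ, EG)) (1 : G) (mdifferentiable_conj a (b * 1 * b⁻¹))
    (mdifferentiable_conj b 1)
  rw [← this] at h2
  refine (DFunLike.congr_fun h2 v).trans ?_
  exact mfderiv_apply_congr _ (by simp) _

/-- The adjoint representation is by automorphisms of the Lie algebra. -/
theorem adjointRep_lie [CompleteSpace EG] (g : G) (v w : GroupLieAlgebra 𝓘(ℝ, EG) G) :
    adjointRep g ⁅v, w⁆ = ⁅adjointRep g v, adjointRep g w⁆ := by
  let c : G → G := fun h => g * h * g⁻¹
  have hc : ∀ a b, c (a * b) = c a * c b := fun a b => by simp [c, mul_assoc]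
  have hcc : ∀ h, ContMDiffAt 𝓘(ℝ, EG) 𝓘(ℝ, EG) ∞ c h := fun h => (contMDiff_conj g) h
  have hinv : ∀ h : G, (mfderiv 𝓘(ℝ, EG) 𝓘(ℝ, EG) c h).IsInvertible := by
    intro h
    let d : G → G := fun h => g⁻¹ * h * g⁻¹⁻¹
    have e1 : d ∘ c = id := by ext; simp [d, c, mul_assoc]
    have e2 : c ∘ d = id := by ext; simp [d, c, mul_assoc]
    have hdc : d (c h) = h := congrFun e1 h
    have m1 := mfderiv_comp (I' := 𝓘(ℝ, EG)) h (mdifferentiable_conj g⁻¹ (c h))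
      (mdifferentiable_conj g h)
    have m2 := mfderiv_comp (I' := 𝓘(ℝ, EG)) (c h) (mdifferentiable_conj g (d (c h)))
      (mdifferentiable_conj g⁻¹ (c h))
    change mfderiv _ _ (d ∘ c) h = _ at m1
    change mfderiv _ _ (c ∘ d) (c h) = _ at m2
    rw [e1, mfderiv_id] at m1
    rw [e2, mfderiv_id] at m2
    refine ContinuousLinearMap.IsInvertible.of_inverse
      (g := mfderiv 𝓘(ℝ, EG) 𝓘(ℝ, EG) d (c h)) ?_ m1.symm
    ext u
    have := DFunLike.congr_fun m2.symm u
    refine Eq.trans ?_ this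
    exact (mfderiv_apply_congr c hdc _).symm
  have hpull : ∀ u, mpullback 𝓘(ℝ, EG) 𝓘(ℝ, EG) c (mulInvariantVectorField (adjointRep g u)) =
      mulInvariantVectorField u := by
    intro u
    ext h
    rw [mpullback_apply]
    have e : c ∘ (fun x => h * x) = (fun x => c h * x) ∘ c := by ext x; exact hc h x
    have hl : ∀ a b : G, MDifferentiableAt 𝓘(ℝ, EG) 𝓘(ℝ, EG) (fun x => a * x) b := fun a b =>
      (contMDiff_mul_left (I := 𝓘(ℝ, EG)) (n := ∞) (a := a)).mdifferentiable (by simp) b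
    have m1 := mfderiv_comp (I' := 𝓘(ℝ, EG)) (1 : G) (mdifferentiable_conj g (h * 1)) (hl h 1)
    have m2 := mfderiv_comp (I' := 𝓘(ℝ, EG)) (1 : G) (hl (c h) (c 1)) (mdifferentiable_conj g 1)
    change mfderiv _ _ (c ∘ _) (1 : G) = _ at m1
    change mfderiv _ _ (_ ∘ c) (1 : G) = _ at m2
    rw [e, m2] at m1
    have m3 := DFunLike.congr_fun m1 u
    have h1 : (mulInvariantVectorField (adjointRep g u) (c h) : EG) =
        mfderiv 𝓘(ℝ, EG) 𝓘(ℝ, EG) c h (mulInvariantVectorField u h) := by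
      refine Eq.trans ?_ (m3.trans (mfderiv_apply_congr c (mul_one h) _))
      exact mfderiv_apply_congr (fun x => c h * x) (by simp [c]) _
    exact (congrArg (mfderiv 𝓘(ℝ, EG) 𝓘(ℝ, EG) c h).inverse h1).trans
      ((hinv h).inverse_apply_self _)
  have hb := mpullback_mlieBracket (I := 𝓘(ℝ, EG)) (I' := 𝓘(ℝ, EG)) (f := c) (x₀ := (1 : G))
    (V := mulInvariantVectorField (adjointRep g v)) (W := mulInvariantVectorField (adjointRep g w))
    (mdifferentiableAt_mulInvariantVectorField _) (mdifferentiableAt_mulInvariantVectorField _)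
    (hcc 1) minSmoothness_two_le
  rw [hpull, hpull, mpullback_apply] at hb
  have h2 := congrArg (mfderiv 𝓘(ℝ, EG) 𝓘(ℝ, EG) c 1) hb
  have h3 := ((hinv 1).self_apply_inverse _).symm.trans h2
  refine h3.symm.trans ?_
  have h1 : c 1 = 1 := by simp [c]
  have : ∀ a : G, a = 1 → (mlieBracket 𝓘(ℝ, EG) (mulInvariantVectorField (adjointRep g v))
      (mulInvariantVectorField (adjointRep g w)) a : EG) = ⁅adjointRep g v, adjointRep g w⁆ := by
    rintro _ rfl; rfl
  exact this _ h1

/-- `Ad_g` as an automorphism of the Lie algebra. -/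
noncomputable def adjointEquiv [CompleteSpace EG] (g : G) :
    GroupLieAlgebra 𝓘(ℝ, EG) G ≃ₗ⁅ℝ⁆ GroupLieAlgebra 𝓘(ℝ, EG) G :=
  { adjointRep g with
    map_lie' := adjointRep_lie g _ _
    invFun := adjointRep g⁻¹
    left_inv := fun v => by
      change adjointRep g⁻¹ (adjointRep g v) = v
      rw [← adjointRep_mul, inv_mul_cancel, adjointRep_one]
    right_inv := fun v => by
      change adjointRep g (adjointRep g⁻¹ v) = v
      rw [← adjointRep_mul, mul_inv_cancel, adjointRep_one] }

theorem adjointEquiv_apply [CompleteSpace EG] (g : G) (v : GroupLieAlgebra 𝓘(ℝ, EG) G) :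
    adjointEquiv g v = adjointRep g v := rfl

end Adjoint

section FunctionLieAlgebras

/-- The pointwise bracket of functions with values in a Lie algebra. -/
instance functionLieRing {T L : Type*} [LieRing L] : LieRing (T → L) where
  bracket v w := fun t => ⁅v t, w t⁆
  add_lie _ _ _ := funext fun _ => add_lie _ _ _
  lie_add _ _ _ := funext fun _ => lie_add _ _ _
  lie_self _ := funext fun _ => lie_self _
  leibniz_lie _ _ _ := funext fun _ => leibniz_lie _ _ _

instance functionLieAlgebra {T L : Type*} [LieRing L] [LieAlgebra ℝ L] :
    LieAlgebra ℝ (T → L) where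
  lie_smul _ _ _ := funext fun _ => lie_smul _ _ _

end FunctionLieAlgebras

section PrincipalBundles

/-- Smooth principal `G`-bundles `P → M`, with structure group acting from the right. -/
structure SmoothPrincipalBundle
    (EM : Type*) [NormedAddCommGroup EM] [NormedSpace ℝ EM]
    (M : Type*) [TopologicalSpace M] [ChartedSpace EM M]
    (EG : Type*) [NormedAddCommGroup EG] [NormedSpace ℝ EG]
    (G : Type*) [TopologicalSpace G] [ChartedSpace EG G] [Group G]
    (EP : Type*) [NormedAddCommGroup EP] [NormedSpace ℝ EP]
    (P : Type*) [TopologicalSpace P] [ChartedSpace EP P] where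
  /-- the projection -/
  proj : P → M
  /-- the right action -/
  act : P → G → P
  act_one : ∀ p, act p 1 = p
  act_mul : ∀ p g h, act p (g * h) = act (act p g) h
  proj_act : ∀ p g, proj (act p g) = proj p
  contMDiff_proj : ContMDiff 𝓘(ℝ, EP) 𝓘(ℝ, EM) ∞ proj
  contMDiff_act : ContMDiff (𝓘(ℝ, EP).prod 𝓘(ℝ, EG)) 𝓘(ℝ, EP) ∞ (fun q : P × G => act q.1 q.2)
  exists_trivialization : ∀ x : M, ∃ U : Set M, IsOpen U ∧ x ∈ U ∧
    ∃ e : OpenPartialHomeomorph P (M × G), e.source = proj ⁻¹' U ∧ e.target = U ×ˢ Set.univ ∧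
      ContMDiffOn 𝓘(ℝ, EP) (𝓘(ℝ, EM).prod 𝓘(ℝ, EG)) ∞ e e.source ∧
      ContMDiffOn (𝓘(ℝ, EM).prod 𝓘(ℝ, EG)) 𝓘(ℝ, EP) ∞ e.symm e.target ∧
      ∀ p ∈ e.source, (e p).1 = proj p ∧ ∀ g, e (act p g) = (proj p, (e p).2 * g)

variable {EM : Type*} [NormedAddCommGroup EM] [NormedSpace ℝ EM] [FiniteDimensional ℝ EM]
  {M : Type*} [TopologicalSpace M] [ChartedSpace EM M] [IsManifold 𝓘(ℝ, EM) ∞ M]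
  {EG : Type*} [NormedAddCommGroup EG] [NormedSpace ℝ EG] [FiniteDimensional ℝ EG]
  {G : Type*} [TopologicalSpace G] [ChartedSpace EG G] [Group G] [LieGroup 𝓘(ℝ, EG) ∞ G]
  {EP : Type*} [NormedAddCommGroup EP] [NormedSpace ℝ EP] [FiniteDimensional ℝ EP]
  {P : Type*} [TopologicalSpace P] [ChartedSpace EP P] [IsManifold 𝓘(ℝ, EP) ∞ P]

namespace SmoothPrincipalBundle

section Basic

variable (B : SmoothPrincipalBundle EM M EG G EP P)

theorem exists_act_eq {p q : P} (h : B.proj p = B.proj q) : ∃ g, B.act p g = q := by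
  obtain ⟨U, -, hx, e, hs, ht, -, -, he⟩ := B.exists_trivialization (B.proj p)
  have hp : p ∈ e.source := by rw [hs]; exact hx
  have hq : q ∈ e.source := by rw [hs]; change B.proj q ∈ U; rwa [← h]
  refine ⟨(e p).2⁻¹ * (e q).2, e.injOn ?_ hq ?_⟩
  · rw [hs]; change B.proj _ ∈ U; rwa [B.proj_act]
  · rw [(he p hp).2, h, ← (he q hq).1]; simp

/-- Through every point of `M` there is a smooth local section. -/
theorem exists_section (x : M) : ∃ U : Set M, IsOpen U ∧ x ∈ U ∧ ∃ s : M → P,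
    ContMDiffOn 𝓘(ℝ, EM) 𝓘(ℝ, EP) ∞ s U ∧ ∀ y ∈ U, B.proj (s y) = y := by
  obtain ⟨U, hU, hx, e, hs, ht, -, he', he⟩ := B.exists_trivialization x
  have hm : ∀ y ∈ U, (y, (1 : G)) ∈ e.target := fun y hy => by rw [ht]; exact ⟨hy, trivial⟩
  refine ⟨U, hU, hx, fun y => e.symm (y, 1), ?_, fun y hy => ?_⟩
  · exact he'.comp (contMDiffOn_id.prodMk contMDiffOn_const) hm
  · rw [← (he _ (e.map_target (hm y hy))).1, e.right_inv (hm y hy)]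

theorem exists_proj_eq (x : M) : ∃ p, B.proj p = x := by
  obtain ⟨U, -, hx, s, -, hs⟩ := B.exists_section x
  exact ⟨s x, hs x hx⟩

/-- An auxiliary choice of a point over `x`. -/
noncomputable def point (x : M) : P := (B.exists_proj_eq x).choose

theorem proj_point (x : M) : B.proj (B.point x) = x := (B.exists_proj_eq x).choose_spec

theorem contMDiff_act_right (g : G) : ContMDiff 𝓘(ℝ, EP) 𝓘(ℝ, EP) ∞ (fun p => B.act p g) :=
  B.contMDiff_act.comp (contMDiff_id.prodMk contMDiff_const)

theorem contMDiff_orbit (p : P) : ContMDiff 𝓘(ℝ, EG) 𝓘(ℝ, EP) ∞ (fun g => B.act p g) :=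
  B.contMDiff_act.comp (contMDiff_const.prodMk contMDiff_id)

theorem mdifferentiable_act (g : G) : MDifferentiable 𝓘(ℝ, EP) 𝓘(ℝ, EP) (fun p => B.act p g) :=
  (B.contMDiff_act_right g).mdifferentiable (by simp)

theorem isInvertible_mfderiv_act (g : G) (p : P) :
    (mfderiv 𝓘(ℝ, EP) 𝓘(ℝ, EP) (fun p => B.act p g) p).IsInvertible := by
  let c : P → P := fun p => B.act p g
  let d : P → P := fun p => B.act p g⁻¹
  have e1 : d ∘ c = id := by ext; simp [d, c, ← B.act_mul, B.act_one]
  have e2 : c ∘ d = id := by ext; simp [d, c, ← B.act_mul, B.act_one]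
  have hdc : d (c p) = p := congrFun e1 p
  have m1 := mfderiv_comp (I' := 𝓘(ℝ, EP)) p (B.mdifferentiable_act g⁻¹ (c p))
    (B.mdifferentiable_act g p)
  have m2 := mfderiv_comp (I' := 𝓘(ℝ, EP)) (c p) (B.mdifferentiable_act g (d (c p)))
    (B.mdifferentiable_act g⁻¹ (c p))
  change mfderiv _ _ (d ∘ c) p = _ at m1
  change mfderiv _ _ (c ∘ d) (c p) = _ at m2
  rw [e1, mfderiv_id] at m1
  rw [e2, mfderiv_id] at m2
  refine ContinuousLinearMap.IsInvertible.of_inverse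
    (g := mfderiv 𝓘(ℝ, EP) 𝓘(ℝ, EP) d (c p)) ?_ m1.symm
  ext u
  have := DFunLike.congr_fun m2.symm u
  refine Eq.trans ?_ this
  exact (mfderiv_apply_congr c hdc _).symm

end Basic

section Atiyah

variable (B : SmoothPrincipalBundle EM M EG G EP P)

/-- The `G`-invariant vector fields on the total space. -/
noncomputable def invariantVectorFields : LieSubalgebra ℝ (VF EP P) where
  carrier := {X | ∀ g p, mfderiv 𝓘(ℝ, EP) 𝓘(ℝ, EP) (fun p => B.act p g) p (X p) = X (B.act p g)}
  add_mem' {X Y} hX hY := fun g p => by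
    refine (ContinuousLinearMap.map_add _ (X p) (Y p)).trans ?_
    rw [hX, hY]; rfl
  zero_mem' := fun g p => ContinuousLinearMap.map_zero _
  smul_mem' c X hX := fun g p => by
    refine (ContinuousLinearMap.map_smul _ c (X p)).trans ?_
    rw [hX]; rfl
  lie_mem' {X Y} hX hY := fun g p => by
    have hpull : ∀ Z : VF EP P, (∀ g p,
        mfderiv 𝓘(ℝ, EP) 𝓘(ℝ, EP) (fun p => B.act p g) p (Z p) = Z (B.act p g)) →
        mpullback 𝓘(ℝ, EP) 𝓘(ℝ, EP) (fun p => B.act p g) Z.1 = Z.1 := by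
      intro Z hZ
      ext q
      rw [mpullback_apply, ← hZ g q]
      exact (B.isInvertible_mfderiv_act g q).inverse_apply_self _
    have hb := mpullback_mlieBracket (I := 𝓘(ℝ, EP)) (I' := 𝓘(ℝ, EP)) (f := fun p => B.act p g)
      (x₀ := p) (V := X.1) (W := Y.1) (X.mdifferentiableAt _) (Y.mdifferentiableAt _)
      (B.contMDiff_act_right g p) minSmoothness_two_le
    rw [hpull X hX, hpull Y hY, mpullback_apply] at hb
    rw [VF.bracket_apply, VF.bracket_apply, ← hb]
    exact (B.isInvertible_mfderiv_act g p).self_apply_inverse _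

/-- The Atiyah Lie algebroid, as the Lie algebra of its sections. -/
abbrev Atiyah : Type _ := B.invariantVectorFields

/-- The pullback of functions along the projection. -/
noncomputable def pullback {F : Type*} [NormedAddCommGroup F] [NormedSpace ℝ F] (f : SmoothFun EM M F) :
    SmoothFun EP P F := ⟨fun p => f (B.proj p), f.contMDiff.comp B.contMDiff_proj⟩

noncomputable instance : SMul (SmoothFun EM M ℝ) B.Atiyah where
  smul f X := ⟨B.pullback f • X.1, fun g p => by
    refine (ContinuousLinearMap.map_smul _ (f (B.proj p)) (X.1 p)).trans ?_
    rw [X.2 g p, VF.smul_apply]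
    change _ = f (B.proj (B.act p g)) • _
    rw [B.proj_act]⟩

theorem smul_val (f : SmoothFun EM M ℝ) (X : B.Atiyah) : (f • X).1 = B.pullback f • X.1 := rfl

noncomputable instance : Module (SmoothFun EM M ℝ) B.Atiyah where
  one_smul X := Subtype.ext (one_smul (SmoothFun EP P ℝ) X.1)
  mul_smul f g X := Subtype.ext (mul_smul (B.pullback f) (B.pullback g) X.1)
  smul_zero f := Subtype.ext (smul_zero (B.pullback f))
  smul_add f X Y := Subtype.ext (smul_add (B.pullback f) X.1 Y.1)
  add_smul f g X := Subtype.ext (add_smul (B.pullback f) (B.pullback g) X.1)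
  zero_smul X := Subtype.ext (zero_smul (SmoothFun EP P ℝ) X.1)

/-- An invariant vector field has the same projection at all points of a fibre. -/
theorem mfderiv_proj_eq (X : B.Atiyah) {p q : P} (h : B.proj p = B.proj q) :
    (mfderiv 𝓘(ℝ, EP) 𝓘(ℝ, EM) B.proj p (X.1 p) : EM) =
      mfderiv 𝓘(ℝ, EP) 𝓘(ℝ, EM) B.proj q (X.1 q) := by
  obtain ⟨g, rfl⟩ := B.exists_act_eq h
  have hp : MDifferentiable 𝓘(ℝ, EP) 𝓘(ℝ, EM) B.proj := B.contMDiff_proj.mdifferentiable (by simp)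
  have e : B.proj ∘ (fun p => B.act p g) = B.proj := funext fun p => B.proj_act p g
  have m := mfderiv_comp (I' := 𝓘(ℝ, EP)) p (hp (B.act p g)) (B.mdifferentiable_act g p)
  rw [e] at m
  rw [m, ← X.2 g p]
  rfl

/-- The anchor of the Atiyah Lie algebroid, projecting invariant vector fields to `M`. -/
noncomputable def anchor (X : B.Atiyah) : VF EM M :=
  ⟨fun x => (mfderiv 𝓘(ℝ, EP) 𝓘(ℝ, EM) B.proj (B.point x) (X.1 (B.point x)) : EM), by
    intro x
    obtain ⟨U, hU, hx, s, hs, hps⟩ := B.exists_section x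
    have h1 : ContMDiff 𝓘(ℝ, EP).tangent 𝓘(ℝ, EM).tangent ∞
        (tangentMap 𝓘(ℝ, EP) 𝓘(ℝ, EM) B.proj) := B.contMDiff_proj.contMDiff_tangentMap (by simp)
    have h2 := (h1.comp X.1.contMDiff).comp_contMDiffOn hs
    refine (h2.congr fun y hy => ?_).contMDiffAt (hU.mem_nhds hx)
    have h3 := B.mfderiv_proj_eq X ((B.proj_point y).trans (hps y hy).symm)
    have h4 : ∀ (z : M) (v : EM), z = y →
        (⟨y, v⟩ : TangentBundle 𝓘(ℝ, EM) M) = ⟨z, v⟩ := by rintro z v rfl; rfl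
    exact (h4 _ _ (hps y hy)).trans (congrArg _ h3.symm).symm⟩

theorem anchor_apply (X : B.Atiyah) (p : P) : (B.anchor X (B.proj p) : EM) =
    mfderiv 𝓘(ℝ, EP) 𝓘(ℝ, EM) B.proj p (X.1 p) :=
  B.mfderiv_proj_eq X (B.proj_point _)

section Action

variable {F : Type*} [NormedAddCommGroup F] [NormedSpace ℝ F]

/-- The Atiyah Lie algebroid acts on functions on `M` through the anchor. -/
noncomputable instance : Bracket B.Atiyah (SmoothFun EM M F) where
  bracket X f := ⁅B.anchor X, f⁆

theorem bracket_fun (X : B.Atiyah) (f : SmoothFun EM M F) : ⁅X, f⁆ = ⁅B.anchor X, f⁆ := rfl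

theorem pullback_injective :
    Function.Injective (B.pullback : SmoothFun EM M F → SmoothFun EP P F) := by
  intro f g h
  ext x
  obtain ⟨p, rfl⟩ := B.exists_proj_eq x
  exact DFunLike.congr_fun h p

theorem pullback_bracket (X : B.Atiyah) (f : SmoothFun EM M F) :
    B.pullback ⁅X, f⁆ = ⁅X.1, B.pullback f⁆ := by
  ext p
  have hp : MDifferentiable 𝓘(ℝ, EP) 𝓘(ℝ, EM) B.proj := B.contMDiff_proj.mdifferentiable (by simp)
  have m := mfderiv_comp (I' := 𝓘(ℝ, EM)) p (VF.mdifferentiableAt_fun f (B.proj p)) (hp p)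
  have h1 : mvfderiv 𝓘(ℝ, EP) (B.pullback f) p (X.1 p) =
      mfderiv 𝓘(ℝ, EM) 𝓘(ℝ, F) f (B.proj p) (mfderiv 𝓘(ℝ, EP) 𝓘(ℝ, EM) B.proj p (X.1 p)) :=
    DFunLike.congr_fun m (X.1 p)
  refine Eq.trans ?_ h1.symm
  exact congrArg (mfderiv 𝓘(ℝ, EM) 𝓘(ℝ, F) f (B.proj p)) (B.anchor_apply X p)

noncomputable instance : LieRingModule B.Atiyah (SmoothFun EM M F) where
  add_lie X Y f := by
    apply B.pullback_injective
    rw [pullback_bracket]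
    refine (add_lie X.1 Y.1 (B.pullback f)).trans ?_
    rw [← pullback_bracket, ← pullback_bracket]; rfl
  lie_add X f g := by
    apply B.pullback_injective
    rw [pullback_bracket]
    refine (lie_add X.1 (B.pullback f) (B.pullback g)).trans ?_
    rw [← pullback_bracket, ← pullback_bracket]; rfl
  leibniz_lie X Y f := by
    apply B.pullback_injective
    change _ = B.pullback ⁅⁅X, Y⁆, f⁆ + B.pullback ⁅Y, ⁅X, f⁆⁆
    simp only [pullback_bracket]
    exact leibniz_lie X.1 Y.1 (B.pullback f)

instance : LieRinehartRing (SmoothFun EM M ℝ) B.Atiyah where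
  lie_smul_eq_mul' f g X := by
    apply B.pullback_injective
    change _ = B.pullback f * B.pullback ⁅X, g⁆
    rw [pullback_bracket, pullback_bracket]
    exact LieRinehartRing.lie_smul_eq_mul' (B.pullback f) (B.pullback g) X.1
  leibniz_mul_right' X f g := by
    apply B.pullback_injective
    change _ = B.pullback f * B.pullback ⁅X, g⁆ + B.pullback ⁅X, f⁆ * B.pullback g
    simp only [pullback_bracket]
    exact LieRinehartRing.leibniz_mul_right' X.1 (B.pullback f) (B.pullback g)
  leibniz_smul_right' X Y f := by
    apply Subtype.ext
    change ⁅X.1, B.pullback f • Y.1⁆ = B.pullback f • ⁅X.1, Y.1⁆ + B.pullback ⁅X, f⁆ • Y.1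
    rw [pullback_bracket]
    exact LieRinehartRing.leibniz_smul_right' X.1 Y.1 (B.pullback f)

instance : LieRinehartModule (SmoothFun EM M ℝ) B.Atiyah (SmoothFun EM M F) where
  smul_lie' f X g := by
    apply B.pullback_injective
    change _ = B.pullback f • B.pullback ⁅X, g⁆
    rw [pullback_bracket, pullback_bracket]
    exact LieRinehartModule.smul_lie' (B.pullback f) X.1 (B.pullback g)
  lie_smul' X f g := by
    apply B.pullback_injective
    change _ = B.pullback f • B.pullback ⁅X, g⁆ + B.pullback ⁅X, f⁆ • B.pullback g
    simp only [pullback_bracket]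
    exact LieRinehartModule.lie_smul' X.1 (B.pullback f) (B.pullback g)

end Action

end Atiyah

section AdjointBundle

variable (B : SmoothPrincipalBundle EM M EG G EP P)

theorem act_right_injective (p : P) : Function.Injective (B.act p) := by
  intro g h hgh
  obtain ⟨U, -, hx, e, hs, -, -, -, he⟩ := B.exists_trivialization (B.proj p)
  have hp : p ∈ e.source := by rw [hs]; exact hx
  have h1 := (he p hp).2 g
  rw [hgh, (he p hp).2 h] at h1
  exact (mul_left_cancel (Prod.ext_iff.1 h1).2).symm

/-- The fibre at `x` of the adjoint bundle `P ×_Ad 𝔤`, realized as the Lie algebra of the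
equivariant maps from the fibre of `P` at `x` to the Lie algebra of `G`. -/
noncomputable def adFiber (x : M) :
    LieSubalgebra ℝ ({p : P // B.proj p = x} → GroupLieAlgebra 𝓘(ℝ, EG) G) where
  carrier := {v | ∀ (p : {p : P // B.proj p = x}) (g : G),
    v ⟨B.act p g, (B.proj_act _ _).trans p.2⟩ = adjointRep g⁻¹ (v p)}
  add_mem' {v w} hv hw := fun p g => by simp [hv p g, hw p g]
  zero_mem' := fun p g => by simp
  smul_mem' c v hv := fun p g => by simp [hv p g]
  lie_mem' {v w} hv hw := fun p g => by
    change ⁅v _, w _⁆ = adjointRep g⁻¹ ⁅v p, w p⁆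
    rw [hv p g, hw p g, adjointRep_lie]

/-- A point `p` of `P` identifies the fibre of the adjoint bundle with the Lie algebra. -/
noncomputable def fiberEquiv (p : P) :
    B.adFiber (B.proj p) ≃ₗ⁅ℝ⁆ GroupLieAlgebra 𝓘(ℝ, EG) G :=
  LieEquiv.ofBijective
    { toFun := fun v => v.1 ⟨p, rfl⟩
      map_add' := fun _ _ => rfl
      map_smul' := fun _ _ => rfl
      map_lie' := rfl } (by
    constructor
    · intro v w h
      apply Subtype.ext
      ext ⟨q, hq⟩
      obtain ⟨g, rfl⟩ := B.exists_act_eq hq.symm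
      rw [v.2 ⟨p, rfl⟩ g, w.2 ⟨p, rfl⟩ g]
      exact congrArg _ h
    · intro ξ
      choose γ hγ using fun q : {q : P // B.proj q = B.proj p} => B.exists_act_eq q.2.symm
      refine ⟨⟨fun q => adjointRep (γ q)⁻¹ ξ, fun q g => ?_⟩, ?_⟩
      · have : γ ⟨B.act q g, (B.proj_act _ _).trans q.2⟩ = γ q * g := by
          apply B.act_right_injective p
          rw [hγ, B.act_mul, hγ]
        change adjointRep (γ _)⁻¹ ξ = _
        rw [this, mul_inv_rev, adjointRep_mul]
      · have : γ ⟨p, rfl⟩ = 1 := by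
          apply B.act_right_injective p
          rw [hγ, B.act_one]
        change adjointRep (γ ⟨p, rfl⟩)⁻¹ ξ = ξ
        rw [this, inv_one, adjointRep_one])

theorem fiberEquiv_apply (p : P) (v : B.adFiber (B.proj p)) :
    B.fiberEquiv p v = v.1 ⟨p, rfl⟩ := rfl

/-- The sections of the adjoint bundle, i.e. the smooth equivariant maps from `P` to the Lie
algebra of `G`. -/
noncomputable def adSections : LieSubalgebra ℝ (P → GroupLieAlgebra 𝓘(ℝ, EG) G) where
  carrier := {v | ContMDiff (M' := EG) 𝓘(ℝ, EP) 𝓘(ℝ, EG) ∞ v ∧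
    ∀ p g, v (B.act p g) = adjointRep g⁻¹ (v p)}
  add_mem' {v w} hv hw := ⟨hv.1.add hw.1, fun p g => by simp [hv.2 p g, hw.2 p g]⟩
  zero_mem' := ⟨contMDiff_const, fun p g => by simp⟩
  smul_mem' c v hv := ⟨(contDiff_const_smul (F := EG) c).contMDiff.comp hv.1,
    fun p g => by simp [hv.2 p g]⟩
  lie_mem' {v w} hv hw := ⟨by
    let b₀ : GroupLieAlgebra 𝓘(ℝ, EG) G →ₗ[ℝ] GroupLieAlgebra 𝓘(ℝ, EG) G →ₗ[ℝ]
        GroupLieAlgebra 𝓘(ℝ, EG) G :=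
      LinearMap.mk₂ ℝ (fun x y => ⁅x, y⁆) add_lie smul_lie lie_add lie_smul
    let b : EG →ₗ[ℝ] EG →ₗ[ℝ] EG := b₀
    let b' : EG →L[ℝ] EG →L[ℝ] EG :=
      LinearMap.toContinuousLinearMap (LinearMap.toContinuousLinearMap.toLinearMap ∘ₗ b)
    have h1 : ContMDiff 𝓘(ℝ, EP) 𝓘(ℝ, EG →L[ℝ] EG) ∞ (fun p => b' (v p)) :=
      b'.contDiff.contMDiff.comp hv.1
    exact h1.clm_apply hw.1, fun p g => by
    change ⁅v _, w _⁆ = adjointRep g⁻¹ ⁅v p, w p⁆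
    rw [hv.2 p g, hw.2 p g, adjointRep_lie]⟩

/-- The value at `x` of a section of the adjoint bundle. -/
def sectionAt (v : B.adSections) (x : M) : B.adFiber x :=
  ⟨fun p => v.1 p, fun p g => v.2.2 p g⟩

/-- The fundamental vector field associated to a section of the adjoint bundle is smooth. -/
theorem contMDiff_vertical (v : B.adSections) : ContMDiff 𝓘(ℝ, EP) 𝓘(ℝ, EP).tangent ∞
    (fun p => (⟨p, mfderiv 𝓘(ℝ, EG) 𝓘(ℝ, EP) (fun g => B.act p g) 1 (v.1 p)⟩ :
      TangentBundle 𝓘(ℝ, EP) P)) := by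
  let F₁ : P → TangentBundle 𝓘(ℝ, EP) P × TangentBundle 𝓘(ℝ, EG) G :=
    fun p => (⟨p, 0⟩, ⟨1, v.1 p⟩)
  have S₁ : ContMDiff 𝓘(ℝ, EP) (𝓘(ℝ, EP).tangent.prod 𝓘(ℝ, EG).tangent) ∞ F₁ := by
    refine (Bundle.contMDiff_zeroSection ℝ (TangentSpace 𝓘(ℝ, EP) : P → Type _)).prodMk ?_
    intro p
    rw [Bundle.contMDiffAt_totalSpace]
    refine ⟨contMDiffAt_const, ?_⟩
    have : ∀ u : EG, (trivializationAt EG (TangentSpace 𝓘(ℝ, EG)) (1 : G)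
        (⟨1, u⟩ : TangentBundle 𝓘(ℝ, EG) G)).2 = u := by
      intro u
      have h : (chartAt EG (1 : G) ∘ (chartAt EG (1 : G)).symm) =ᶠ[nhds (chartAt EG (1 : G) 1)] id :=
        (chartAt EG (1 : G)).eventually_right_inverse
          ((chartAt EG (1 : G)).map_source (mem_chart_source EG 1))
      simp only [TangentBundle.trivializationAt_apply, modelWithCornersSelf_coe, Set.range_id,
        fderivWithin_univ, OpenPartialHomeomorph.extend, modelWithCornersSelf_partialEquiv,
        PartialEquiv.trans_refl]
      have h2 := congrArg (fun L : EG →L[ℝ] EG => L u) h.fderiv_eq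
      refine Eq.trans h2 ?_
      simp
    exact (v.2.1 p).congr_of_eventuallyEq (Filter.Eventually.of_forall fun q => this _)
  let F₂ := (equivTangentBundleProd 𝓘(ℝ, EP) P 𝓘(ℝ, EG) G).symm
  have S₂ : ContMDiff (𝓘(ℝ, EP).tangent.prod 𝓘(ℝ, EG).tangent)
      (𝓘(ℝ, EP).prod 𝓘(ℝ, EG)).tangent ∞ F₂ := contMDiff_equivTangentBundleProd_symm
  let F₃ : TangentBundle (𝓘(ℝ, EP).prod 𝓘(ℝ, EG)) (P × G) → TangentBundle 𝓘(ℝ, EP) P :=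
    tangentMap (𝓘(ℝ, EP).prod 𝓘(ℝ, EG)) 𝓘(ℝ, EP) (fun q : P × G => B.act q.1 q.2)
  have S₃ : ContMDiff (𝓘(ℝ, EP).prod 𝓘(ℝ, EG)).tangent 𝓘(ℝ, EP).tangent ∞ F₃ :=
    B.contMDiff_act.contMDiff_tangentMap (by simp)
  have hm : ∀ p, MDifferentiableAt (𝓘(ℝ, EP).prod 𝓘(ℝ, EG)) 𝓘(ℝ, EP)
    (fun q : P × G => B.act q.1 q.2) (p, 1) :=
    fun p => B.contMDiff_act.mdifferentiable (by simp) (p, 1)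
  refine ((S₃.comp S₂).comp S₁).congr fun p => ?_
  have h4 : ∀ (q : P) (v w : EP), q = p → v = w →
      (⟨p, v⟩ : TangentBundle 𝓘(ℝ, EP) P) = ⟨q, w⟩ := by rintro q v _ rfl rfl; rfl
  refine h4 _ _ _ (B.act_one p) ?_
  refine Eq.trans ?_ (mfderiv_prod_eq_add_apply (hm p)).symm
  have hz : (mfderiv 𝓘(ℝ, EP) 𝓘(ℝ, EP) (fun z => B.act z 1) p (0 : EP) : EP) = 0 :=
    ContinuousLinearMap.map_zero _
  have hadd : ∀ a b : EP, a = 0 → b = a + b := fun a b h => by rw [h, zero_add]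
  exact hadd _ _ hz

/-- The vertical vector field `d/dt (p · exp (t v(p)))` at `t = 0` of a section `v` of the adjoint
bundle. -/
noncomputable def vertical (v : B.adSections) : VF EP P :=
  ⟨fun p => (mfderiv 𝓘(ℝ, EG) 𝓘(ℝ, EP) (fun g => B.act p g) 1 (v.1 p) : EP),
    B.contMDiff_vertical v⟩

theorem vertical_mem (v : B.adSections) : B.vertical v ∈ B.invariantVectorFields :=
  fun g p => by
    have hp := (B.contMDiff_orbit p).mdifferentiable (by simp) (1 : G)
    have hpg := (B.contMDiff_orbit (B.act p g)).mdifferentiable (by simp) (g⁻¹ * 1 * g⁻¹⁻¹)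
    have e : (fun p => B.act p g) ∘ (fun h => B.act p h) =
        (fun h => B.act (B.act p g) h) ∘ (fun h => g⁻¹ * h * g⁻¹⁻¹) := by
      ext h
      simp [← B.act_mul, mul_assoc]
    have m1 := mfderiv_comp (I' := 𝓘(ℝ, EP)) (1 : G) (B.mdifferentiable_act g (B.act p 1)) hp
    have m2 := mfderiv_comp (I' := 𝓘(ℝ, EG)) (1 : G) hpg (mdifferentiable_conj g⁻¹ 1)
    rw [e, m2] at m1
    have m3 := DFunLike.congr_fun m1 (v.1 p)
    refine (mfderiv_apply_congr (E := EP) (F := EP) (fun p => B.act p g)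
      (B.act_one p).symm _).trans (m3.symm.trans ?_)
    refine (mfderiv_apply_congr (E := EG) (F := EP) (fun h => B.act (B.act p g) h)
      (show g⁻¹ * 1 * g⁻¹⁻¹ = (1 : G) by simp) _).trans ?_
    exact congrArg (mfderiv 𝓘(ℝ, EG) 𝓘(ℝ, EP) (fun h => B.act (B.act p g) h) 1) (v.2.2 p g).symm

/-- The inclusion of the sections of the adjoint bundle in the Atiyah Lie algebroid, given by
`ι(v)(p) = d/dt (p · exp (-t v(p)))` at `t = 0`. -/
noncomputable def ι (v : B.adSections) : B.Atiyah :=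
  ⟨-B.vertical v, B.invariantVectorFields.neg_mem (B.vertical_mem v)⟩

/-- Inner metrics: smooth families of symmetric bilinear forms on the fibres of the adjoint
bundle. -/
structure InnerMetric where
  form : ∀ x, LinearMap.BilinForm ℝ (B.adFiber x)
  symm : ∀ x v w, form x v w = form x w v
  smooth : ∀ v w : B.adSections, ContMDiff 𝓘(ℝ, EM) 𝓘(ℝ, ℝ) ∞
    (fun x => form x (B.sectionAt v x) (B.sectionAt w x))

/-- The value of the Killing form on two elements of a fibre of the adjoint bundle. -/
noncomputable def killingFiber (x : M) : LinearMap.BilinForm ℝ (B.adFiber x) :=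
  LinearMap.mk₂ ℝ
    (fun v w => killingForm ℝ (GroupLieAlgebra 𝓘(ℝ, EG) G) (v.1 ⟨B.point x, B.proj_point x⟩)
      (w.1 ⟨B.point x, B.proj_point x⟩))
    (fun u v w => by simp) (fun c v w => by simp) (fun u v w => by simp) (fun c v w => by simp)

/-- The choice of the point in the fibre does not matter. -/
theorem killingFiber_apply {x : M} (v w : B.adFiber x) (p : {p : P // B.proj p = x}) :
    B.killingFiber x v w = killingForm ℝ (GroupLieAlgebra 𝓘(ℝ, EG) G) (v.1 p) (w.1 p) := by
  obtain ⟨p, rfl⟩ := p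
  obtain ⟨g, hg⟩ := B.exists_act_eq (B.proj_point (B.proj p)).symm
  have h : ∀ u : B.adFiber (B.proj p), u.1 ⟨B.point (B.proj p), B.proj_point _⟩ =
      adjointEquiv g⁻¹ (u.1 ⟨p, rfl⟩) := by
    intro u
    rw [adjointEquiv_apply, ← u.2 ⟨p, rfl⟩ g]
    exact congrArg u.1 (Subtype.ext hg.symm)
  change killingForm ℝ (GroupLieAlgebra 𝓘(ℝ, EG) G) _ _ = _
  rw [h, h, LieAlgebra.killingForm_of_equiv_apply]

/-- The inner metric given by the Killing form. -/
noncomputable def killingMetric : B.InnerMetric where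
  form := B.killingFiber
  symm _ _ _ := LieModule.traceForm_comm ℝ _ _ _ _
  smooth v w := by
    intro x
    obtain ⟨U, hU, hx, s, hs, hps⟩ := B.exists_section x
    let b : EG →ₗ[ℝ] EG →ₗ[ℝ] ℝ := killingForm ℝ (GroupLieAlgebra 𝓘(ℝ, EG) G)
    let b' : EG →L[ℝ] EG →L[ℝ] ℝ :=
      LinearMap.toContinuousLinearMap (LinearMap.toContinuousLinearMap.toLinearMap ∘ₗ b)
    have h1 : ContMDiff 𝓘(ℝ, EP) 𝓘(ℝ, EG →L[ℝ] ℝ) ∞ (fun p => b' (v.1 p)) :=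
      b'.contDiff.contMDiff.comp v.2.1
    have h2 : ContMDiff 𝓘(ℝ, EP) 𝓘(ℝ, ℝ) ∞ (fun p => b' (v.1 p) (w.1 p)) :=
      h1.clm_apply w.2.1
    refine ((h2.comp_contMDiffOn hs).congr fun y hy => ?_).contMDiffAt (hU.mem_nhds hx)
    exact B.killingFiber_apply _ _ ⟨s y, hps y hy⟩

/-- Local trivializations over `U` of the adjoint bundle as a bundle of Lie algebras. The values
outside of `U` are irrelevant. -/
structure AdTrivialization (U : Set M) where
  toEquiv : ∀ x : M, GroupLieAlgebra 𝓘(ℝ, EG) G ≃ₗ⁅ℝ⁆ B.adFiber x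
  smooth : ∀ ξ, ContMDiffOn (M' := EG) 𝓘(ℝ, EP) 𝓘(ℝ, EG) ∞
    (fun p => (toEquiv (B.proj p) ξ).1 ⟨p, rfl⟩) (B.proj ⁻¹' U)

end AdjointBundle

section InnerIntegration

/-- The degree `q` forms on the Atiyah Lie algebroid with values in the complex functions. -/
abbrev LieForm (B : SmoothPrincipalBundle EM M EG G EP P) (q : ℕ) : Type _ :=
  B.Atiyah [⋀^Fin q]→ₗ[SmoothFun EM M ℝ] SmoothFun EM M ℂ

/-- The degree `q` differential forms on `M` with values in the complex functions. -/
abbrev BaseForm (EM : Type*) [NormedAddCommGroup EM] [NormedSpace ℝ EM] [FiniteDimensional ℝ EM]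
    (M : Type*) [TopologicalSpace M] [ChartedSpace EM M] [IsManifold 𝓘(ℝ, EM) ∞ M] (q : ℕ) : Type _ :=
  VF EM M [⋀^Fin q]→ₗ[SmoothFun EM M ℝ] SmoothFun EM M ℂ

variable {B : SmoothPrincipalBundle EM M EG G EP P} {n : ℕ}

/-- The matrix of an inner metric at `x`, in the basis of the fibre which corresponds to the basis
`E` of the Lie algebra under the isomorphism `Ψ`. -/
noncomputable def InnerMetric.localMatrix (h : B.InnerMetric)
    (E : Module.Basis (Fin n) ℝ (GroupLieAlgebra 𝓘(ℝ, EG) G)) {x : M}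
    (Ψ : GroupLieAlgebra 𝓘(ℝ, EG) G ≃ₗ⁅ℝ⁆ B.adFiber x) : Matrix (Fin n) (Fin n) ℝ :=
  Matrix.of fun a b => h.form x (Ψ (E a)) (Ψ (E b))

/-- `η` is the factor of `√|h| θ^1 ∧ ⋯ ∧ θ^n` in the form `α`, in the trivializations of the
algebroid given by local sections of `P`. This factor is extracted by inserting `n` elements
`ι(γ_1), …, ι(γ_n)` of the kernel in the last arguments of `α`: they are annihilated by forms
coming from `M`, and the value of `θ^a` on `ι(γ)` at a point `p` of the section is the `a`-th
coordinate of `γ(p)` in the basis `E`. -/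
def IsInnerIntegral (h : B.InnerMetric)
    (E : Module.Basis (Fin n) ℝ (GroupLieAlgebra 𝓘(ℝ, EG) G)) {r : ℕ}
    (α : B.LieForm (r + n)) (η : BaseForm EM M r) : Prop :=
  ∀ (X : Fin r → B.Atiyah) (γ : Fin n → B.adSections) (p : P),
    α (Fin.append X fun a => B.ι (γ a)) (B.proj p) =
      η (fun i => B.anchor (X i)) (B.proj p) *
        ((√|(h.localMatrix E (B.fiberEquiv p).symm).det| * E.det fun a => (γ a).1 p : ℝ) : ℂ)

open Classical in
/-- The inner integral of a form of degree `r + n`. -/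
noncomputable def innerIntegralDegree (h : B.InnerMetric)
    (E : Module.Basis (Fin n) ℝ (GroupLieAlgebra 𝓘(ℝ, EG) G)) {r : ℕ}
    (α : B.LieForm (r + n)) : BaseForm EM M r :=
  if hη : ∃ η, IsInnerIntegral h E α η then hη.choose else 0

/-- The inner integral of a form, given by its components `α q` in all degrees `q`. The components
of degree less than `n` do not contribute. -/
noncomputable def innerIntegral (h : B.InnerMetric)
    (E : Module.Basis (Fin n) ℝ (GroupLieAlgebra 𝓘(ℝ, EG) G))
    (α : ∀ q, B.LieForm q) : ∀ r, BaseForm EM M r :=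
  fun r => innerIntegralDegree h E (α (r + n))

/-- The differential of a form on the Atiyah Lie algebroid, given by its components. -/
noncomputable def dLie (α : ∀ q, B.LieForm q) : ∀ q, B.LieForm q
  | 0 => 0
  | q + 1 => lieDifferential (α q)

/-- The de Rham differential of a form on `M`, given by its components. -/
noncomputable def deRham (η : ∀ q, BaseForm EM M q) : ∀ q, BaseForm EM M q
  | 0 => 0
  | q + 1 => lieDifferential (η q)

end InnerIntegration

end SmoothPrincipalBundle

end PrincipalBundles

/-! Near a point of `M`, a local section of `P` splits the algebroid `A` into horizontal fields and
the kernel `L`, whose rank is `n`. Let `ω` have degree `r + n` and insert `n` vertical arguments.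
One more vertical argument would give zero for reasons of rank, so the other `r` arguments matter
only through their anchors (`lieForm_append_congr`). In the vertical arguments `ω` is pointwise a
top-degree alternating form on `𝔤`, hence a multiple of the determinant (`volume_smul_adForm`). That
multiple is the required form `η` on the base (`exists_isFactor`).

For this to make sense on `M`, the function `det (γ_1(p), …, γ_n(p))` has to be constant along the
fibres of `P`. The group `Ad` preserves the nondegenerate Killing form, so `det Ad_g = ±1`, and
connectedness forces the value `1` (`det_adjointRep`). The Killing form is moreover invariant under
every automorphism of `𝔤`. Its matrix is therefore the same in all trivializations
(`localMatrix_killingMetric`), and `√|h|` is a single nonzero constant `c`.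

The differentials are compared by Cartan's formula `dω(Y, Z) = Y ω(Z) - Σ_j ω(…, [Y, Z_j], …) -
d(i_Y ω)(Z)` (`koszul_vecCons`), by induction on the number of base arguments (`koszul_append`). The
first two terms on `A` reduce to those on `M`. Indeed `[Y, ι γ] = ι (Y·γ)` (`lie_ι`), and the
Leibniz rule for the determinant (`lie_volume`) cancels the vertical brackets against the derivative
of the volume factor.

Contractions finally lead to a form of degree `n - 1` whose differential is evaluated on `n`
vertical arguments, and this value has to vanish (`koszul_vertical_eq_zero`). Here unimodularity
enters: every `(n-1)`-form on `𝔤` is a contraction `i_v vol`, and on vertical arguments `d(i_v vol)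
= L_v vol - i_v d vol`. The first term is zero by invariance of the volume, the second because its
degree exceeds the rank. -/

set_option linter.unusedSectionVars false

/-! ### Cartan's formula for the Koszul differential -/

section CartanFormula

open Finset

variable {R A V : Type*} [CommRing R] [LieRing A] [Module R A]
  [AddCommGroup V] [Module R V] [LieRingModule A V]

theorem AlternatingMap.map_update_eq_vecCons_removeNth {k : ℕ} (ϖ : A [⋀^Fin (k + 1)]→ₗ[R] V)
    (Z : Fin (k + 1) → A) (j : Fin (k + 1)) (x : A) :
    ϖ (Function.update Z j x) = (-1 : ℤ) ^ (j : ℕ) • ϖ (Matrix.vecCons x (j.removeNth Z)) := by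
  have := ϖ.map_insertNth j x (j.removeNth Z)
  rw [Fin.insertNth_removeNth] at this
  rw [this]

theorem AlternatingMap.map_vecCons_swap {k : ℕ} (ϖ : A [⋀^Fin (k + 2)]→ₗ[R] V)
    (x y : A) (Z : Fin k → A) :
    ϖ (Matrix.vecCons x (Matrix.vecCons y Z)) = - ϖ (Matrix.vecCons y (Matrix.vecCons x Z)) := by
  have h := ϖ.map_swap (Matrix.vecCons x (Matrix.vecCons y Z)) (i := 0) (j := 1) (by simp)
  rw [← neg_eq_iff_eq_neg, ← h]
  congr 1
  ext i
  refine Fin.cases ?_ (fun i => Fin.cases ?_ (fun i => ?_) i) i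
  · simp
  · change Matrix.vecCons x (Matrix.vecCons y Z) (Equiv.swap 0 1 1) = x
    simp
  · have : Equiv.swap (0 : Fin (k + 2)) 1 i.succ.succ = i.succ.succ :=
      Equiv.swap_apply_of_ne_of_ne (by simp) (by simp [Fin.ext_iff])
    simp [this]

/-- Cartan's formula for the Koszul differential in degree zero. -/
theorem koszul_vecCons_zero (ϖ : A [⋀^Fin 0]→ₗ[R] V) (Y : A) (Z : Fin 0 → A) :
    koszul ϖ (Matrix.vecCons Y Z) = ⁅Y, ϖ Z⁆ := by
  have h : Fin.removeNth 0 (Matrix.vecCons Y Z) = Z := Subsingleton.elim _ _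
  simp [koszul, koszulBracketPart, h]

/-- Cartan's formula for the Koszul differential. -/
theorem koszul_vecCons {k : ℕ} (ϖ : A [⋀^Fin (k + 1)]→ₗ[R] V) (Y : A) (Z : Fin (k + 1) → A) :
    koszul ϖ (Matrix.vecCons Y Z) =
      ⁅Y, ϖ Z⁆ - ∑ j, ϖ (Function.update Z j ⁅Y, Z j⁆) - koszul (ϖ.curryLeft Y) Z := by
  have h0 : Finset.Ici (0 : Fin (k + 1)) = Finset.univ := by ext; simp
  have hr0 : Fin.removeNth 0 (Matrix.vecCons Y Z) = Z := rfl
  -- The index `0` differentiates along `Y`; the other indices are shifted by one, which changes the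
  -- sign.
  have hfst : ∑ i : Fin (k + 2), (-1 : ℤ) ^ (i : ℕ) •
      ⁅Matrix.vecCons Y Z i, ϖ (i.removeNth (Matrix.vecCons Y Z))⁆ =
      ⁅Y, ϖ Z⁆ - ∑ i : Fin (k + 1), (-1 : ℤ) ^ (i : ℕ) •
        ⁅Z i, ϖ.curryLeft Y (i.removeNth Z)⁆ := by
    rw [Fin.sum_univ_succ, sub_eq_add_neg, ← Finset.sum_neg_distrib]
    congr 1
    · simp [hr0]
    · refine Finset.sum_congr rfl fun i _ => ?_
      rw [koszul_aux_removeNth, Matrix.cons_val_succ, Fin.val_succ, pow_succ, mul_neg_one,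
        neg_smul]
      rfl
  -- The pairs containing `Y` produce the sum of the `[Y, Z_j]`. In the other pairs `Y` stands just
  -- behind the bracket; exchanging the two gives the bracket part of the contraction with a minus
  -- sign.
  have hsum : koszulBracketPart ϖ (Matrix.vecCons Y Z) =
      - ∑ j, ϖ (Function.update Z j ⁅Y, Z j⁆) - koszulBracketPart (ϖ.curryLeft Y) Z := by
    rw [koszulBracketPart, Fin.sum_univ_succ, h0, neg_add, sub_eq_add_neg]
    congr 1
    · congr 1
      refine Finset.sum_congr rfl fun j _ => ?_
      rw [ϖ.map_update_eq_vecCons_removeNth]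
      simp [hr0]
    · congr 1
      cases k with
      | zero => simp [koszulBracketPart]
      | succ k =>
        rw [koszulBracketPart, ← Finset.sum_neg_distrib]
        refine Finset.sum_congr rfl fun i _ => ?_
        rw [← Finset.sum_neg_distrib]
        have hIci : Finset.Ici i.succ = (Finset.Ici i).map (Fin.succEmb _) := by
          ext j
          refine Fin.cases ?_ (fun j => ?_) j <;> simp
        rw [hIci, Finset.sum_map]
        refine Finset.sum_congr rfl fun j _ => ?_
        rw [Fin.coe_succEmb, ← Fin.succ_castSucc, koszul_aux_removeNth, koszul_aux_removeNth,
          ϖ.map_vecCons_swap, Matrix.cons_val_succ, Matrix.cons_val_succ, smul_neg]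
        congr 1
        have : (-1 : ℤ) ^ ((i.succ : ℕ) + (j.succ : ℕ)) = (-1) ^ (i + j : ℕ) := by
          rw [Fin.val_succ, Fin.val_succ]; ring
        rw [this]
        rfl
  rw [koszul, hfst, hsum, koszul]
  abel

/-- The bracket part does not differentiate the values of the form, it only inserts the arguments
and their brackets. An identity that holds merely after `φ`, for instance after evaluation at one
point, and only on a set of arguments closed under brackets, therefore passes to it. The derivative
part of the Koszul formula has no such property. -/
theorem koszulBracketPart_eq_sum {ι W : Type*} [AddCommGroup W] (φ : V →+ W) (s : Finset ι)
    {S : Set A} (hS : ∀ x ∈ S, ∀ y ∈ S, ⁅x, y⁆ ∈ S) {k : ℕ} (ϖ' : A [⋀^Fin k]→ₗ[R] V)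
    (ϖ : ι → A [⋀^Fin k]→ₗ[R] V)
    (h : ∀ m : Fin k → A, (∀ j, m j ∈ S) → φ (ϖ' m) = ∑ i ∈ s, φ (ϖ i m))
    (X : Fin (k + 1) → A) (hX : ∀ j, X j ∈ S) :
    φ (koszulBracketPart ϖ' X) = ∑ i ∈ s, φ (koszulBracketPart (ϖ i) X) := by
  cases k with
  | zero => simp [koszulBracketPart]
  | succ k =>
    simp only [koszulBracketPart, map_neg, map_sum, map_zsmul, Finset.sum_neg_distrib]
    rw [Finset.sum_comm]
    congr 1
    refine Finset.sum_congr rfl fun i _ => ?_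
    rw [Finset.sum_comm]
    refine Finset.sum_congr rfl fun j _ => ?_
    rw [h, Finset.smul_sum]
    intro l
    refine Fin.cases ?_ (fun l => ?_) l
    · exact hS _ (hX _) _ (hX _)
    · exact hX _

end CartanFormula

/-! ### Alternating maps: fixing slots, arguments modulo a subgroup, contractions of the determinant
-/

section Alternating

variable {R A V : Type*} [CommRing R] [AddCommGroup A] [Module R A] [AddCommGroup V] [Module R V]

theorem Function.extend_update {ι κ α : Type*} [DecidableEq ι] [DecidableEq κ] {s : κ → ι}
    (hs : Function.Injective s) (γ : κ → α) (m : ι → α) (a : κ) (x : α) :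
    Function.extend s (Function.update γ a x) m =
      Function.update (Function.extend s γ m) (s a) x := by
  ext j
  by_cases hj : ∃ b, s b = j
  · obtain ⟨b, rfl⟩ := hj
    rw [hs.extend_apply]
    by_cases hb : b = a
    · subst hb; simp
    · rw [Function.update_of_ne hb, Function.update_of_ne (hs.ne hb), hs.extend_apply]
  · rw [Function.extend_apply' _ _ _ hj, Function.update_of_ne, Function.extend_apply' _ _ _ hj]
    exact fun h => hj ⟨a, h.symm⟩

/-- The alternating map in the slots in the range of `s` obtained by fixing the other slots. -/
noncomputable def AlternatingMap.extendSlots {ι κ : Type*} (ϖ : A [⋀^ι]→ₗ[R] V) {s : κ → ι}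
    (hs : Function.Injective s) (m : ι → A) : A [⋀^κ]→ₗ[R] V where
  toFun γ := ϖ (Function.extend s γ m)
  map_update_add' γ a x y := by
    classical
    simp only [Function.extend_update hs, ϖ.map_update_add]
  map_update_smul' γ a c x := by
    classical
    simp only [Function.extend_update hs, ϖ.map_update_smul]
  map_eq_zero_of_eq' γ a b hab hne := by
    refine ϖ.map_eq_zero_of_eq _ (i := s a) (j := s b) ?_ (hs.ne hne)
    rw [hs.extend_apply, hs.extend_apply, hab]

/-- If a multilinear map followed by `φ` vanishes as soon as one argument is in `K`, it only
depends on the arguments modulo `K`. -/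
theorem MultilinearMap.apply_congr_of_sub_mem {ι W : Type*} [Finite ι] [AddCommGroup W]
    (f : MultilinearMap R (fun _ : ι => A) V) (φ : V →+ W) (K : AddSubgroup A)
    (hK : ∀ m i, m i ∈ K → φ (f m) = 0) {m m' : ι → A} (h : ∀ i, m i - m' i ∈ K) :
    φ (f m) = φ (f m') := by
  classical
  have := Fintype.ofFinite ι
  -- The arguments are exchanged one at a time: those in `s` are already taken from `m`, the others
  -- still from `m'`.
  have key : ∀ s : Finset ι, φ (f (s.piecewise m m')) = φ (f m') := by
    intro s
    induction s using Finset.induction_on with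
    | empty => simp
    | insert a s ha ih =>
      rw [← ih, Finset.piecewise_insert, ← sub_eq_zero, ← map_sub]
      have h1 : s.piecewise m m' = Function.update (s.piecewise m m') a (m' a) := by
        rw [eq_comm, Function.update_eq_self_iff]
        simp [ha]
      conv in f (s.piecewise m m') => rw [h1]
      rw [← f.map_update_sub]
      exact hK _ a (by simpa using h a)
  have := key Finset.univ
  rwa [Finset.piecewise_univ] at this

/-- An alternating map of degree one less than the dimension is a combination of contractions of
the determinant. -/
theorem AlternatingMap.eq_sum_smul_det {L W : Type*} [AddCommGroup L] [Module ℝ L]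
    [AddCommGroup W] [Module ℝ W] {m : ℕ} (E : Module.Basis (Fin (m + 1)) ℝ L)
    (β : L [⋀^Fin m]→ₗ[ℝ] W) (w : Fin m → L) :
    β w = ∑ i : Fin (m + 1), E.det (Matrix.vecCons (E i) w) •
      ((-1 : ℤ) ^ (i : ℕ) • β (i.removeNth E)) := by
  let β' : L [⋀^Fin m]→ₗ[ℝ] W := ∑ i : Fin (m + 1),
    (LinearMap.toSpanSingleton ℝ W ((-1 : ℤ) ^ (i : ℕ) • β (i.removeNth E))).compAlternatingMap
      (E.det.curryLeft (E i))
  have hβ' : ∀ w, β' w = ∑ i : Fin (m + 1), E.det (Matrix.vecCons (E i) w) •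
      ((-1 : ℤ) ^ (i : ℕ) • β (i.removeNth E)) := by
    intro w
    change (AlternatingMap.toMultilinearMapLM (S := ℝ) β') w = _
    simp only [β', map_sum, sum_apply]
    rfl
  rw [← hβ']
  congr 1
  refine Module.Basis.ext_alternating E fun v hv => ?_
  -- An injective `v` misses exactly one index `k`, so its basis vectors are a permutation of the
  -- basis with `E k` removed.
  have hk : ∃ k, ∀ j, v j ≠ k := by
    by_contra! h
    have hsurj : Function.Surjective v := h
    have := Fintype.card_le_of_surjective v hsurj
    simp at this
  obtain ⟨k, hk⟩ := hk
  choose σ hσ using fun j => Fin.exists_succAbove_eq (hk j)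
  have hσi : Function.Injective σ := fun a b hab => hv (by rw [← hσ a, ← hσ b, hab])
  let τ : Equiv.Perm (Fin m) := Equiv.ofBijective σ (Finite.injective_iff_bijective.1 hσi)
  have hv' : (fun j => E (v j)) = (k.removeNth E) ∘ τ := by
    ext1 j
    change _ = E (k.succAbove (σ j))
    rw [hσ]
  rw [hv', β.map_perm, β'.map_perm]
  congr 1
  -- For `i ≠ k` the vector `E i` occurs twice in the determinant. For `i = k` the determinant is
  -- `(-1) ^ k`, which the sign in the coefficient cancels.
  rw [hβ', Finset.sum_eq_single k]
  · have h := E.det.map_insertNth k (E k) (k.removeNth E)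
    rw [Fin.insertNth_self_removeNth, E.det_self] at h
    have h' : E.det (Matrix.vecCons (E k) (k.removeNth E)) = (-1) ^ (k : ℕ) := by
      rcases Nat.even_or_odd (k : ℕ) with h2 | h2
      · simpa [h2.neg_one_pow] using h.symm
      · rw [h2.neg_one_pow] at h ⊢; simp at h; linarith
    rw [h']
    rcases Nat.even_or_odd (k : ℕ) with h2 | h2 <;> simp [h2.neg_one_pow]
  · intro i _ hi
    obtain ⟨j, rfl⟩ := Fin.exists_succAbove_eq hi
    rw [E.det.map_eq_zero_of_eq _ (i := 0) (j := j.succ), zero_smul]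
    · rfl
    · exact (Fin.succ_ne_zero j).symm
  · simp

end Alternating

/-! ### Smooth dependence of partial derivatives on parameters, and their symmetry -/

section SmoothFamilies

variable {E₀ : Type*} [NormedAddCommGroup E₀] [NormedSpace ℝ E₀]
  {N₀ : Type*} [TopologicalSpace N₀] [ChartedSpace E₀ N₀]
  {E₁ : Type*} [NormedAddCommGroup E₁] [NormedSpace ℝ E₁]
  {N₁ : Type*} [TopologicalSpace N₁] [ChartedSpace E₁ N₁] [IsManifold 𝓘(ℝ, E₁) ∞ N₁]
  {E₂ : Type*} [NormedAddCommGroup E₂] [NormedSpace ℝ E₂]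
  {N₂ : Type*} [TopologicalSpace N₂] [ChartedSpace E₂ N₂] [IsManifold 𝓘(ℝ, E₂) ∞ N₂]
  {E₃ : Type*} [NormedAddCommGroup E₃] [NormedSpace ℝ E₃]
  {N₃ : Type*} [TopologicalSpace N₃] [ChartedSpace E₃ N₃] [IsManifold 𝓘(ℝ, E₃) ∞ N₃]
  {V : Type*} [NormedAddCommGroup V] [NormedSpace ℝ V]

theorem TangentBundle.mk_congr {x y : N₁} {v w : E₁} (h : x = y) (h' : v = w) :
    (⟨x, v⟩ : TangentBundle 𝓘(ℝ, E₁) N₁) = ⟨y, w⟩ := by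
  subst h h'; rfl

/-- The trivialization of the tangent bundle at `x` is the identity on the fibre at `x`. -/
theorem trivializationAt_tangentSpace_self (x : N₁) (u : E₁) :
    (trivializationAt E₁ (TangentSpace 𝓘(ℝ, E₁)) x (⟨x, u⟩ : TangentBundle 𝓘(ℝ, E₁) N₁)).2 = u := by
  have h : (chartAt E₁ x ∘ (chartAt E₁ x).symm) =ᶠ[nhds (chartAt E₁ x x)] id :=
    (chartAt E₁ x).eventually_right_inverse ((chartAt E₁ x).map_source (mem_chart_source E₁ x))
  simp only [TangentBundle.trivializationAt_apply, modelWithCornersSelf_coe, Set.range_id,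
    fderivWithin_univ, OpenPartialHomeomorph.extend, modelWithCornersSelf_partialEquiv,
    PartialEquiv.trans_refl]
  have h2 := congrArg (fun L : E₁ →L[ℝ] E₁ => L u) h.fderiv_eq
  refine Eq.trans h2 ?_
  simp

/-- Smooth maps into a single tangent space, as maps into the tangent bundle. -/
theorem contMDiffAt_tangentBundle_const {x : N₁} {v : N₀ → E₁} {p : N₀} :
    ContMDiffAt 𝓘(ℝ, E₀) 𝓘(ℝ, E₁).tangent ∞
      (fun q => (⟨x, v q⟩ : TangentBundle 𝓘(ℝ, E₁) N₁)) p ↔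
    ContMDiffAt 𝓘(ℝ, E₀) 𝓘(ℝ, E₁) ∞ v p := by
  rw [Bundle.contMDiffAt_totalSpace]
  constructor
  · intro h
    exact h.2.congr_of_eventuallyEq
      (Filter.Eventually.of_forall fun q => (trivializationAt_tangentSpace_self x _).symm)
  · intro h
    exact ⟨contMDiffAt_const, h.congr_of_eventuallyEq
      (Filter.Eventually.of_forall fun q => trivializationAt_tangentSpace_self x _)⟩

/-- The derivative of `Φ (f p) ·` along `ζ p` depends smoothly on `p`. -/
theorem contMDiffAt_mfderiv_partial {Φ : N₁ → N₂ → N₃} {O : Set (N₁ × N₂)} (hO : IsOpen O)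
    (hΦ : ContMDiffOn (𝓘(ℝ, E₁).prod 𝓘(ℝ, E₂)) 𝓘(ℝ, E₃) ∞ (fun q : N₁ × N₂ => Φ q.1 q.2) O)
    {f : N₀ → N₁} {b : N₀ → N₂} {ζ : N₀ → E₂} {p : N₀} (hp : (f p, b p) ∈ O)
    (hf : ContMDiffAt 𝓘(ℝ, E₀) 𝓘(ℝ, E₁) ∞ f p)
    (hζ : ContMDiffAt 𝓘(ℝ, E₀) 𝓘(ℝ, E₂).tangent ∞
      (fun q => (⟨b q, ζ q⟩ : TangentBundle 𝓘(ℝ, E₂) N₂)) p) :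
    ContMDiffAt 𝓘(ℝ, E₀) 𝓘(ℝ, E₃).tangent ∞
      (fun q => (⟨Φ (f q) (b q), mfderiv 𝓘(ℝ, E₂) 𝓘(ℝ, E₃) (Φ (f q)) (b q) (ζ q)⟩ :
        TangentBundle 𝓘(ℝ, E₃) N₃)) p := by
  -- The partial derivative is the tangent map of the function of both variables, applied to the
  -- pair `(0, ζ)`. It is thus a composite of smooth maps; the tangent map is taken within `O` since
  -- smoothness is only known there.
  let F₁ : N₀ → TangentBundle 𝓘(ℝ, E₁) N₁ × TangentBundle 𝓘(ℝ, E₂) N₂ :=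
    fun q => (⟨f q, 0⟩, ⟨b q, ζ q⟩)
  have S₁ : ContMDiffAt 𝓘(ℝ, E₀) (𝓘(ℝ, E₁).tangent.prod 𝓘(ℝ, E₂).tangent) ∞ F₁ p :=
    ((Bundle.contMDiff_zeroSection ℝ (TangentSpace 𝓘(ℝ, E₁) : N₁ → Type _)).contMDiffAt.comp p
      hf).prodMk hζ
  let F₂ := (equivTangentBundleProd 𝓘(ℝ, E₁) N₁ 𝓘(ℝ, E₂) N₂).symm
  have S₂ : ContMDiff (𝓘(ℝ, E₁).tangent.prod 𝓘(ℝ, E₂).tangent)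
      (𝓘(ℝ, E₁).prod 𝓘(ℝ, E₂)).tangent ∞ F₂ := contMDiff_equivTangentBundleProd_symm
  have S₂₁ := (S₂ (F₁ p)).comp p S₁
  let F₃ : TangentBundle (𝓘(ℝ, E₁).prod 𝓘(ℝ, E₂)) (N₁ × N₂) → TangentBundle 𝓘(ℝ, E₃) N₃ :=
    tangentMapWithin (𝓘(ℝ, E₁).prod 𝓘(ℝ, E₂)) 𝓘(ℝ, E₃) (fun q : N₁ × N₂ => Φ q.1 q.2) O
  have S₃ := hΦ.contMDiffOn_tangentMapWithin (m := ∞) (by simp) hO.uniqueMDiffOn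
  have hO' : IsOpen (Bundle.TotalSpace.proj ⁻¹' O :
      Set (TangentBundle (𝓘(ℝ, E₁).prod 𝓘(ℝ, E₂)) (N₁ × N₂))) :=
    hO.preimage (FiberBundle.continuous_proj (E₁ × E₂) (TangentSpace (𝓘(ℝ, E₁).prod 𝓘(ℝ, E₂))))
  have S₄ := (S₃.contMDiffAt (hO'.mem_nhds (show F₂ (F₁ p) ∈ _ from hp))).comp p S₂₁
  refine S₄.congr_of_eventuallyEq ?_
  have hc : ContinuousAt (fun q => (f q, b q)) p :=
    hf.continuousAt.prodMk ((FiberBundle.continuous_proj E₂ (TangentSpace 𝓘(ℝ, E₂))).continuousAt.comp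
      hζ.continuousAt)
  filter_upwards [hc.preimage_mem_nhds (hO.mem_nhds hp)] with q hq
  have hm : MDifferentiableAt (𝓘(ℝ, E₁).prod 𝓘(ℝ, E₂)) 𝓘(ℝ, E₃)
      (fun q : N₁ × N₂ => Φ q.1 q.2) (f q, b q) :=
    (hΦ.contMDiffAt (hO.mem_nhds hq)).mdifferentiableAt (by simp)
  refine TangentBundle.mk_congr (E₁ := E₃) (N₁ := N₃) rfl ?_
  refine Eq.trans ?_ (DFunLike.congr_fun (mfderivWithin_of_isOpen hO hq) ((0, ζ q) : E₁ × E₂)).symm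
  refine Eq.trans ?_ (mfderiv_prod_eq_add_apply hm).symm
  have hadd : ∀ a b : E₃, a = 0 → b = a + b := fun a b h => by rw [h, zero_add]
  exact hadd _ _ (ContinuousLinearMap.map_zero
    (mfderiv 𝓘(ℝ, E₁) 𝓘(ℝ, E₃) (fun z => Φ z (b q)) (f q)))

/-- The derivative at `x` computed in the chart at `x`. -/
theorem mvfderiv_eq_fderiv_extChartAt {g : N₁ → V} {h : E₁ → V} {x : N₁}
    (hg : ∀ᶠ y in nhds x, g y = h (extChartAt 𝓘(ℝ, E₁) x y))
    (hh : DifferentiableAt ℝ h (extChartAt 𝓘(ℝ, E₁) x x)) (v : E₁) :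
    mvfderiv 𝓘(ℝ, E₁) g x v = fderiv ℝ h (extChartAt 𝓘(ℝ, E₁) x x) v := by
  have hd : MDifferentiableAt 𝓘(ℝ, E₁) 𝓘(ℝ, V) g x :=
    (hh.mdifferentiableAt.comp x (mdifferentiableAt_extChartAt (mem_chart_source E₁ x)))
      |>.congr_of_eventuallyEq hg
  have h1 : mvfderiv 𝓘(ℝ, E₁) g x v =
      fderiv ℝ (g ∘ (extChartAt 𝓘(ℝ, E₁) x).symm) (extChartAt 𝓘(ℝ, E₁) x x) v := by
    refine (DFunLike.congr_fun hd.mfderiv v).trans ?_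
    rw [modelWithCornersSelf_coe, Set.range_id, fderivWithin_univ]
    rfl
  rw [h1]
  have h2 : g ∘ (extChartAt 𝓘(ℝ, E₁) x).symm =ᶠ[nhds (extChartAt 𝓘(ℝ, E₁) x x)] h := by
    have h3 := (continuousAt_extChartAt_symm (I := 𝓘(ℝ, E₁)) x).eventually
      (by rw [extChartAt_to_inv]; exact hg)
    filter_upwards [h3, extChartAt_target_mem_nhds (I := 𝓘(ℝ, E₁)) x] with z hz hz'
    rw [Function.comp_apply, hz, (extChartAt 𝓘(ℝ, E₁) x).right_inv hz']
  rw [h2.fderiv_eq]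

/-- Partial derivatives on a product of manifolds commute. -/
theorem mvfderiv_partial_comm {F : N₁ × N₂ → V} {a : N₁} {b : N₂}
    (hF : ContMDiffAt (𝓘(ℝ, E₁).prod 𝓘(ℝ, E₂)) 𝓘(ℝ, V) ∞ F (a, b)) (u : E₁) (w : E₂) :
    mvfderiv 𝓘(ℝ, E₂) (fun y => mvfderiv 𝓘(ℝ, E₁) (fun x => F (x, y)) a u) b w =
      mvfderiv 𝓘(ℝ, E₁) (fun x => mvfderiv 𝓘(ℝ, E₂) (fun y => F (x, y)) b w) a u := by
  set α := extChartAt 𝓘(ℝ, E₁) a with hα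
  set β := extChartAt 𝓘(ℝ, E₂) b with hβ
  -- In charts the statement is the symmetry of the second derivative of `φ`, applied to `(u, 0)`
  -- and `(0, w)`.
  let φ : E₁ × E₂ → V := fun z => F (α.symm z.1, β.symm z.2)
  have hφ : ContDiffAt ℝ ∞ φ (α a, β b) := by
    have h1 : ContMDiffAt 𝓘(ℝ, E₁) 𝓘(ℝ, E₁) ∞ α.symm (α a) := by
      have := contMDiffWithinAt_extChartAt_symm_range_self (I := 𝓘(ℝ, E₁)) (n := ∞) a
      rwa [modelWithCornersSelf_coe, Set.range_id, contMDiffWithinAt_univ] at this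
    have h2 : ContMDiffAt 𝓘(ℝ, E₂) 𝓘(ℝ, E₂) ∞ β.symm (β b) := by
      have := contMDiffWithinAt_extChartAt_symm_range_self (I := 𝓘(ℝ, E₂)) (n := ∞) b
      rwa [modelWithCornersSelf_coe, Set.range_id, contMDiffWithinAt_univ] at this
    have h3 : ContMDiffAt (𝓘(ℝ, E₁).prod 𝓘(ℝ, E₂)) (𝓘(ℝ, E₁).prod 𝓘(ℝ, E₂)) ∞
        (Prod.map α.symm β.symm) (α a, β b) := h1.prodMap h2
    have h4 : ContMDiffAt (𝓘(ℝ, E₁).prod 𝓘(ℝ, E₂)) 𝓘(ℝ, V) ∞ F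
        (Prod.map α.symm β.symm (α a, β b)) := by
      simpa [hα, hβ, extChartAt_to_inv] using hF
    have h5 := h4.comp _ h3
    rw [← modelWithCornersSelf_prod, chartedSpaceSelf_prod] at h5
    exact h5.contDiffAt
  have hφe : ∀ᶠ z in nhds (α a, β b), DifferentiableAt ℝ φ z := by
    have : ∀ᶠ z in nhds (α a, β b), ContDiffAt ℝ 1 φ z :=
      (hφ.of_le (by exact mod_cast le_top)).eventually (by simp)
    filter_upwards [this] with z hz using hz.differentiableAt one_ne_zero
  have hd2 : DifferentiableAt ℝ (fderiv ℝ φ) (α a, β b) :=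
    (hφ.fderiv_right (m := 1)
      (WithTop.coe_le_coe.2 (le_top : (1 + 1 : ℕ∞) ≤ ⊤))).differentiableAt one_ne_zero
  have ha : α.source ∈ nhds a := extChartAt_source_mem_nhds a
  have hb : β.source ∈ nhds b := extChartAt_source_mem_nhds b
  have hF : ∀ x ∈ α.source, ∀ y ∈ β.source, F (x, y) = φ (α x, β y) := fun x hx y hy => by
    simp [φ, α.left_inv hx, β.left_inv hy]
  have h1 : ∀ᶠ y in nhds b, mvfderiv 𝓘(ℝ, E₁) (fun x => F (x, y)) a u =
      (fun z => fderiv ℝ φ (α a, z) (u, 0)) (β y) := by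
    have hc : ContinuousAt (fun y => (α a, β y)) b :=
      continuousAt_const.prodMk (continuousAt_extChartAt b)
    filter_upwards [hb, hc.eventually hφe] with y hy hy'
    have hin : HasFDerivAt (fun z : E₁ => (z, β y)) (ContinuousLinearMap.inl ℝ E₁ E₂) (α a) :=
      hasFDerivAt_prodMk_left _ _
    have hcomp := hy'.hasFDerivAt.comp (α a) hin
    rw [mvfderiv_eq_fderiv_extChartAt (h := fun z => φ (z, β y)) ?_ hcomp.differentiableAt]
    · exact (congrArg (fun L : E₁ →L[ℝ] V => L u) hcomp.fderiv).trans (by simp)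
    · filter_upwards [ha] with x hx using hF x hx y hy
  have h2 : ∀ᶠ x in nhds a, mvfderiv 𝓘(ℝ, E₂) (fun y => F (x, y)) b w =
      (fun z => fderiv ℝ φ (z, β b) (0, w)) (α x) := by
    have hc : ContinuousAt (fun x => (α x, β b)) a :=
      (continuousAt_extChartAt a).prodMk continuousAt_const
    filter_upwards [ha, hc.eventually hφe] with x hx hx'
    have hin : HasFDerivAt (fun z : E₂ => (α x, z)) (ContinuousLinearMap.inr ℝ E₁ E₂) (β b) :=
      hasFDerivAt_prodMk_right _ _
    have hcomp := hx'.hasFDerivAt.comp (β b) hin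
    rw [mvfderiv_eq_fderiv_extChartAt (h := fun z => φ (α x, z)) ?_ hcomp.differentiableAt]
    · exact (congrArg (fun L : E₂ →L[ℝ] V => L w) hcomp.fderiv).trans (by simp)
    · filter_upwards [hb] with y hy using hF x hx y hy
  have d1 : HasFDerivAt (fun z => fderiv ℝ φ (α a, z) (u, 0))
      ((ContinuousLinearMap.apply ℝ V (u, 0)).comp
        ((fderiv ℝ (fderiv ℝ φ) (α a, β b)).comp (ContinuousLinearMap.inr ℝ E₁ E₂))) (β b) :=
    (ContinuousLinearMap.apply ℝ V ((u, 0) : E₁ × E₂)).hasFDerivAt.comp (β b)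
      (hd2.hasFDerivAt.comp (β b) (hasFDerivAt_prodMk_right _ _))
  have d2 : HasFDerivAt (fun z => fderiv ℝ φ (z, β b) (0, w))
      ((ContinuousLinearMap.apply ℝ V (0, w)).comp
        ((fderiv ℝ (fderiv ℝ φ) (α a, β b)).comp (ContinuousLinearMap.inl ℝ E₁ E₂))) (α a) :=
    (ContinuousLinearMap.apply ℝ V ((0, w) : E₁ × E₂)).hasFDerivAt.comp (α a)
      (hd2.hasFDerivAt.comp (α a) (hasFDerivAt_prodMk_left _ _))
  rw [mvfderiv_eq_fderiv_extChartAt h1 d1.differentiableAt,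
    mvfderiv_eq_fderiv_extChartAt h2 d2.differentiableAt, d1.fderiv, d2.fderiv]
  simpa using hφ.isSymmSndFDerivAt minSmoothness_two_le (0, w) (u, 0)

end SmoothFamilies

/-! ### Derivatives of vector-valued functions along vector fields -/

section Derivatives

variable {E₁ : Type*} [NormedAddCommGroup E₁] [NormedSpace ℝ E₁]
  {N₁ : Type*} [TopologicalSpace N₁] [ChartedSpace E₁ N₁]
  {E₂ : Type*} [NormedAddCommGroup E₂] [NormedSpace ℝ E₂]
  {N₂ : Type*} [TopologicalSpace N₂] [ChartedSpace E₂ N₂]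
  {V : Type*} [NormedAddCommGroup V] [NormedSpace ℝ V]

theorem mvfderiv_comp_apply' {f : N₂ → V} {g : N₁ → N₂} {x : N₁}
    (hf : MDifferentiableAt 𝓘(ℝ, E₂) 𝓘(ℝ, V) f (g x))
    (hg : MDifferentiableAt 𝓘(ℝ, E₁) 𝓘(ℝ, E₂) g x) (v : TangentSpace 𝓘(ℝ, E₁) x) :
    mvfderiv 𝓘(ℝ, E₁) (fun y => f (g y)) x v =
      mvfderiv 𝓘(ℝ, E₂) f (g x) (mfderiv 𝓘(ℝ, E₁) 𝓘(ℝ, E₂) g x v) :=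
  DFunLike.congr_fun (mfderiv_comp (I' := 𝓘(ℝ, E₂)) x hf hg) v

theorem mvfderiv_congr_of_eventuallyEq {f g : N₁ → V} {x : N₁} (h : f =ᶠ[nhds x] g)
    (v : TangentSpace 𝓘(ℝ, E₁) x) :
    mvfderiv 𝓘(ℝ, E₁) f x v = mvfderiv 𝓘(ℝ, E₁) g x v :=
  DFunLike.congr_fun h.mfderiv_eq v

theorem mvfderiv_clm_comp {W : Type*} [NormedAddCommGroup W] [NormedSpace ℝ W] (L : V →L[ℝ] W)
    {f : N₁ → V} {x : N₁} (hf : MDifferentiableAt 𝓘(ℝ, E₁) 𝓘(ℝ, V) f x)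
    (v : TangentSpace 𝓘(ℝ, E₁) x) :
    mvfderiv 𝓘(ℝ, E₁) (fun y => L (f y)) x v = L (mvfderiv 𝓘(ℝ, E₁) f x v) := by
  rw [mvfderiv_comp_apply' (f := L) L.differentiableAt.mdifferentiableAt hf]
  refine (DFunLike.congr_fun (mfderiv_eq_fderiv (f := L) (x := f x)) _).trans ?_
  rw [L.fderiv]
  rfl

/-- This is `contMDiffAt_mfderiv_partial` with a dummy real parameter. It handles functions that are
smooth on an open set only, such as charts. -/
theorem contMDiffAt_mvfderiv_apply [IsManifold 𝓘(ℝ, E₁) ∞ N₁] {f : N₁ → V} {x : N₁}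
    {U : Set N₁} (hU : IsOpen U) (hx : x ∈ U)
    (hfU : ContMDiffOn 𝓘(ℝ, E₁) 𝓘(ℝ, V) ∞ f U) {X : Π x : N₁, TangentSpace 𝓘(ℝ, E₁) x}
    (hX : ContMDiffAt 𝓘(ℝ, E₁) 𝓘(ℝ, E₁).tangent ∞
      (fun x => (⟨x, X x⟩ : TangentBundle 𝓘(ℝ, E₁) N₁)) x) :
    ContMDiffAt 𝓘(ℝ, E₁) 𝓘(ℝ, V) ∞ (fun y => mvfderiv 𝓘(ℝ, E₁) f y (X y)) x := by
  have h := contMDiffAt_mfderiv_partial (Φ := fun (_ : ℝ) y => f y) (E₁ := ℝ) (N₁ := ℝ)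
    (f := fun _ : N₁ => (0 : ℝ))
    (b := fun y => y) (ζ := X) (O := Set.univ ×ˢ U) (isOpen_univ.prod hU)
    (hfU.comp contMDiffOn_snd fun q hq => hq.2) ⟨trivial, hx⟩ contMDiffAt_const hX
  exact (contMDiff_snd_tangentBundle_modelSpace V 𝓘(ℝ, V) _).comp x h

theorem mvfderiv_extChartAt_self [IsManifold 𝓘(ℝ, E₁) ∞ N₁] (x : N₁)
    (v : TangentSpace 𝓘(ℝ, E₁) x) :
    mvfderiv 𝓘(ℝ, E₁) (extChartAt 𝓘(ℝ, E₁) x) x v = v := by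
  refine (mvfderiv_eq_fderiv_extChartAt (E₁ := E₁) (N₁ := N₁) (V := E₁) (h := id) (by simp)
    differentiableAt_id v).trans ?_
  rw [fderiv_id]
  rfl

/-- A vector field which annihilates all functions is zero. -/
theorem VF.ext_act [FiniteDimensional ℝ E₁] [IsManifold 𝓘(ℝ, E₁) ∞ N₁] [T2Space N₁] {X Y : VF E₁ N₁}
    (h : ∀ f : SmoothFun E₁ N₁ E₁, ⁅X, f⁆ = ⁅Y, f⁆) : X = Y := by
  ext x
  let χ : SmoothBumpFunction 𝓘(ℝ, E₁) x := Classical.arbitrary _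
  -- A cut-off chart is a global function whose derivative at `x` is the identity, so it recovers
  -- the vector at `x`.
  let f : SmoothFun E₁ N₁ E₁ := ⟨fun y => χ y • extChartAt 𝓘(ℝ, E₁) x y,
    χ.contMDiff_smul contMDiffOn_extChartAt⟩
  have hf : ∀ v : TangentSpace 𝓘(ℝ, E₁) x, mvfderiv 𝓘(ℝ, E₁) f x v = v := by
    intro v
    rw [mvfderiv_congr_of_eventuallyEq (g := extChartAt 𝓘(ℝ, E₁) x), mvfderiv_extChartAt_self]
    filter_upwards [χ.eventuallyEq_one] with y hy
    change χ y • extChartAt 𝓘(ℝ, E₁) x y = _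
    rw [hy]; simp
  have := DFunLike.congr_fun (h f) x
  rw [VF.act_apply, VF.act_apply] at this
  rwa [hf, hf] at this

end Derivatives

/-! ### The Atiyah sequence as modules over the functions on the base -/

section InnerIntegralTheory

variable {EM : Type*} [NormedAddCommGroup EM] [NormedSpace ℝ EM] [FiniteDimensional ℝ EM]
  {M : Type*} [TopologicalSpace M] [ChartedSpace EM M] [IsManifold 𝓘(ℝ, EM) ∞ M]
  {EG : Type*} [NormedAddCommGroup EG] [NormedSpace ℝ EG] [FiniteDimensional ℝ EG]
  {G : Type*} [TopologicalSpace G] [ChartedSpace EG G] [Group G] [LieGroup 𝓘(ℝ, EG) ∞ G]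
  {EP : Type*} [NormedAddCommGroup EP] [NormedSpace ℝ EP] [FiniteDimensional ℝ EP]
  {P : Type*} [TopologicalSpace P] [ChartedSpace EP P] [IsManifold 𝓘(ℝ, EP) ∞ P]

/-- `Ad_g w` is the partial derivative at `h = 1` of the smooth map `(g, h) ↦ g h g⁻¹`. All these
vectors lie in the tangent space at `1`, where smoothness into the tangent bundle is ordinary
smoothness. -/
theorem contMDiff_adjointRep_apply (w : GroupLieAlgebra 𝓘(ℝ, EG) G) :
    ContMDiff (M' := EG) 𝓘(ℝ, EG) 𝓘(ℝ, EG) ∞ (fun g : G => adjointRep g w) := by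
  intro g
  have hΦ : ContMDiff (𝓘(ℝ, EG).prod 𝓘(ℝ, EG)) 𝓘(ℝ, EG) ∞
      (fun q : G × G => q.1 * q.2 * q.1⁻¹) := (contMDiff_fst.mul contMDiff_snd).mul contMDiff_fst.inv
  have h := contMDiffAt_mfderiv_partial (Φ := fun g h : G => g * h * g⁻¹) isOpen_univ
    hΦ.contMDiffOn (f := fun g : G => g) (b := fun _ => 1) (ζ := fun _ => w) (p := g) trivial
    contMDiffAt_id (contMDiffAt_tangentBundle_const.2 contMDiffAt_const)
  refine (contMDiffAt_tangentBundle_const (N₁ := G) (x := 1)).1 ?_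
  refine h.congr_of_eventuallyEq (Filter.Eventually.of_forall fun q => ?_)
  exact TangentBundle.mk_congr (N₁ := G) (E₁ := EG) (by simp) rfl

namespace SmoothPrincipalBundle

variable (B : SmoothPrincipalBundle EM M EG G EP P)

section Module

/-- A section of the adjoint bundle as a smooth function with values in the Lie algebra. -/
noncomputable def adFun (v : B.adSections) : SmoothFun EP P EG := ⟨v.1, v.2.1⟩

noncomputable instance : SMul (SmoothFun EM M ℝ) B.adSections where
  smul f v := ⟨fun p => f (B.proj p) • v.1 p,
    (B.pullback f • B.adFun v).contMDiff, fun p g => by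
      change f (B.proj (B.act p g)) • v.1 (B.act p g) = _
      rw [B.proj_act, v.2.2 p g, map_smul]⟩

theorem smul_adSections_apply (f : SmoothFun EM M ℝ) (v : B.adSections) (p : P) :
    (f • v).1 p = f (B.proj p) • v.1 p := rfl

noncomputable instance : Module (SmoothFun EM M ℝ) B.adSections where
  one_smul v := Subtype.ext (funext fun p => one_smul ℝ (v.1 p))
  mul_smul f g v := Subtype.ext (funext fun p => mul_smul (f (B.proj p)) (g (B.proj p)) (v.1 p))
  smul_zero f := Subtype.ext (funext fun p => smul_zero (f (B.proj p)))
  smul_add f v w := Subtype.ext (funext fun p => smul_add (f (B.proj p)) (v.1 p) (w.1 p))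
  add_smul f g v := Subtype.ext (funext fun p => add_smul (f (B.proj p)) (g (B.proj p)) (v.1 p))
  zero_smul v := Subtype.ext (funext fun p => zero_smul ℝ (v.1 p))

theorem ι_apply (v : B.adSections) (p : P) : ((B.ι v).1 p : EP) =
    -(mfderiv 𝓘(ℝ, EG) 𝓘(ℝ, EP) (fun g => B.act p g) 1 (v.1 p) : EP) := rfl

/-- `ι` as a linear map over the functions. -/
noncomputable def ιₗ : B.adSections →ₗ[SmoothFun EM M ℝ] B.Atiyah where
  toFun := B.ι
  map_add' v w := Subtype.ext <| VF.ext fun p => by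
    have h := (mfderiv 𝓘(ℝ, EG) 𝓘(ℝ, EP) (fun g => B.act p g) 1).map_add (v.1 p) (w.1 p)
    exact (congrArg (fun z : EP => -z) h).trans (neg_add _ _)
  map_smul' f v := Subtype.ext <| VF.ext fun p => by
    have h := (mfderiv 𝓘(ℝ, EG) 𝓘(ℝ, EP) (fun g => B.act p g) 1).map_smul (f (B.proj p)) (v.1 p)
    exact (congrArg (fun z : EP => -z) h).trans (smul_neg _ _).symm

/-- The anchor as a linear map over the functions. -/
noncomputable def anchorₗ : B.Atiyah →ₗ[SmoothFun EM M ℝ] VF EM M where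
  toFun := B.anchor
  map_add' X Y := VF.ext fun x =>
    (mfderiv 𝓘(ℝ, EP) 𝓘(ℝ, EM) B.proj (B.point x)).map_add (X.1 (B.point x)) (Y.1 (B.point x))
  map_smul' f X := VF.ext fun x => by
    refine ((mfderiv 𝓘(ℝ, EP) 𝓘(ℝ, EM) B.proj (B.point x)).map_smul
      (f (B.proj (B.point x))) (X.1 (B.point x))).trans ?_
    rw [B.proj_point]
    rfl

theorem anchorₗ_apply (X : B.Atiyah) : B.anchorₗ X = B.anchor X := rfl

/-- The projection is constant on the orbits of the action, to which the fundamental fields are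
tangent. -/
theorem anchor_ι (v : B.adSections) : B.anchor (B.ι v) = 0 := by
  ext x
  obtain ⟨p, rfl⟩ := B.exists_proj_eq x
  refine (B.anchor_apply _ p).trans ?_
  rw [ι_apply]
  have h := mfderiv_comp (I' := 𝓘(ℝ, EP)) (1 : G)
    ((B.contMDiff_proj.mdifferentiable (by simp) (B.act p 1)))
    ((B.contMDiff_orbit p).mdifferentiable (by simp) 1)
  have e : B.proj ∘ (fun g => B.act p g) = fun _ => B.proj p := funext fun g => B.proj_act p g
  rw [e, mfderiv_const] at h
  have h2 := DFunLike.congr_fun h (v.1 p)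
  have h3 : (mfderiv 𝓘(ℝ, EP) 𝓘(ℝ, EM) B.proj p
      (mfderiv 𝓘(ℝ, EG) 𝓘(ℝ, EP) (fun g => B.act p g) 1 (v.1 p) : EP) : EM) = 0 :=
    (mfderiv_apply_congr (E := EP) (F := EM) B.proj (B.act_one p).symm _).trans h2.symm
  refine ((mfderiv 𝓘(ℝ, EP) 𝓘(ℝ, EM) B.proj p).map_neg _).trans ?_
  exact (congrArg (fun z : EM => -z) h3).trans neg_zero

/-- A vector field is determined by its action on functions, and both sides act by the commutator
because the action of the algebroid through the anchor is a Lie action. -/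
theorem anchor_lie [T2Space M] (X Y : B.Atiyah) :
    B.anchor ⁅X, Y⁆ = ⁅B.anchor X, B.anchor Y⁆ := by
  apply VF.ext_act
  intro f
  rw [← bracket_fun, lie_lie, lie_lie]
  rfl

end Module

/-! ### Brackets with fundamental and vertical fields -/

section Connection

/-- The fundamental vector field of an element of the Lie algebra. -/
noncomputable def fundamental (ξ : GroupLieAlgebra 𝓘(ℝ, EG) G) : VF EP P :=
  ⟨fun p => (mfderiv 𝓘(ℝ, EG) 𝓘(ℝ, EP) (fun g => B.act p g) 1 ξ : EP), by
    intro p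
    have h := contMDiffAt_mfderiv_partial (Φ := B.act) isOpen_univ
      B.contMDiff_act.contMDiffOn (f := fun p : P => p) (b := fun _ => 1) (ζ := fun _ => ξ) (p := p)
      trivial contMDiffAt_id (contMDiffAt_tangentBundle_const.2 contMDiffAt_const)
    refine h.congr_of_eventuallyEq (Filter.Eventually.of_forall fun q => ?_)
    exact TangentBundle.mk_congr (N₁ := P) (E₁ := EP) (B.act_one q).symm rfl⟩

/-- Invariant vector fields commute with the fundamental vector fields. -/
theorem lie_fundamental (X : B.Atiyah) (ξ : GroupLieAlgebra 𝓘(ℝ, EG) G) :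
    ⁅X.1, B.fundamental ξ⁆ = 0 := by
  ext p
  set f := extChartAt 𝓘(ℝ, EP) p with hf
  have hs : f.source ∈ nhds p := extChartAt_source_mem_nhds p
  have hso : IsOpen f.source := isOpen_extChartAt_source p
  have hp : p ∈ f.source := mem_extChartAt_source p
  have hfc : ContMDiffOn 𝓘(ℝ, EP) 𝓘(ℝ, EP) ∞ f f.source := by
    rw [hf, extChartAt_source]; exact contMDiffOn_extChartAt
  have hfd : ∀ q ∈ f.source, MDifferentiableAt 𝓘(ℝ, EP) 𝓘(ℝ, EP) f q := fun q hq =>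
    (hfc.contMDiffAt (hso.mem_nhds hq)).mdifferentiableAt (by simp)
  have hfp := hfc.contMDiffAt (hso.mem_nhds hp)
  have hact : ∀ q, MDifferentiable 𝓘(ℝ, EG) 𝓘(ℝ, EP) (fun g => B.act q g) := fun q =>
    (B.contMDiff_orbit q).mdifferentiable (by simp)
  -- Testing the bracket on the chart `f`, the derivative along the fundamental field is a partial
  -- derivative of `F` in the group direction. By invariance of `X`, the derivative along `X` is one
  -- in the direction of `P`. The two commute.
  let F : P × G → EP := fun q => f (B.act q.1 q.2)
  have hF : ContMDiffAt (𝓘(ℝ, EP).prod 𝓘(ℝ, EG)) 𝓘(ℝ, EP) ∞ F (p, 1) := by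
    have : ContMDiffAt 𝓘(ℝ, EP) 𝓘(ℝ, EP) ∞ f (B.act p 1) := by rwa [B.act_one]
    exact this.comp (p, (1 : G)) (B.contMDiff_act (p, 1))
  have hV : ∀ q ∈ f.source, mvfderiv 𝓘(ℝ, EP) f q (B.fundamental ξ q) =
      mvfderiv 𝓘(ℝ, EG) (fun g => F (q, g)) 1 ξ := by
    intro q hq
    have h1 := mvfderiv_comp_apply' (f := f) (g := fun g => B.act q g) (x := (1 : G))
      (hfd _ (by rwa [B.act_one])) (hact q 1) ξ
    refine Eq.trans ?_ h1.symm
    exact mfderiv_apply_congr (E := EP) (F := EP) f (B.act_one q).symm _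
  have hX : ∀ g, B.act p g ∈ f.source → mvfderiv 𝓘(ℝ, EP) f (B.act p g) (X.1 (B.act p g)) =
      mvfderiv 𝓘(ℝ, EP) (fun q => F (q, g)) p (X.1 p) := by
    intro g hg
    have h1 := mvfderiv_comp_apply' (f := f) (g := fun q => B.act q g) (x := p)
      (hfd _ hg) (B.mdifferentiable_act g p) (X.1 p)
    rw [X.2 g p] at h1
    exact h1.symm
  have hXd : MDifferentiableAt 𝓘(ℝ, EP) 𝓘(ℝ, EP)
      (fun q => mvfderiv 𝓘(ℝ, EP) f q (X.1 q)) p :=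
    (contMDiffAt_mvfderiv_apply hso hp hfc (X.1.contMDiff p)).mdifferentiableAt (by simp)
  have key := mvfderiv_mlieBracket (X.1.contMDiff p) ((B.fundamental ξ).contMDiff p) hfp
  have h2 : mvfderiv 𝓘(ℝ, EP) (fun q => mvfderiv 𝓘(ℝ, EP) f q (B.fundamental ξ q)) p (X.1 p) =
      mvfderiv 𝓘(ℝ, EP) (fun q => mvfderiv 𝓘(ℝ, EP) f q (X.1 q)) p (B.fundamental ξ p) := by
    refine (mvfderiv_congr_of_eventuallyEq (Filter.eventually_of_mem hs hV) _).trans ?_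
    refine (mvfderiv_partial_comm hF (X.1 p) ξ).symm.trans ?_
    have hXd' : MDifferentiableAt 𝓘(ℝ, EP) 𝓘(ℝ, EP)
      (fun q => mvfderiv 𝓘(ℝ, EP) f q (X.1 q)) (B.act p 1) := by rwa [B.act_one]
    have h3 := mvfderiv_comp_apply' hXd' (hact p 1) ξ
    have hc : ContinuousAt (fun g => B.act p g) (1 : G) := (B.contMDiff_orbit p).continuous.continuousAt
    rw [mvfderiv_congr_of_eventuallyEq (g := fun g =>
      mvfderiv 𝓘(ℝ, EP) f (B.act p g) (X.1 (B.act p g))), h3]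
    · exact mfderiv_apply_congr (E := EP) (F := EP) _ (B.act_one p) _
    · filter_upwards [hc.preimage_mem_nhds (by rwa [B.act_one])] with g hg using (hX g hg).symm
  -- The chart at `p` has the identity as its derivative there, so the vanishing of the tested
  -- bracket is that of the bracket itself.
  rw [h2, sub_self, hf] at key
  exact (mvfderiv_extChartAt_self (E₁ := EP) p _).symm.trans key

/-- The derivative of a section of the adjoint bundle along an element of the algebroid. -/
noncomputable def adDeriv (X : B.Atiyah) (v : B.adSections) : B.adSections :=
  ⟨fun p => (⁅X.1, B.adFun v⁆ p : EG), (⁅X.1, B.adFun v⁆).contMDiff, fun p g => by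
    let L : EG →ₗ[ℝ] EG := adjointRep (g⁻¹ : G)
    have hd : ∀ q, MDifferentiableAt 𝓘(ℝ, EP) 𝓘(ℝ, EG) (B.adFun v) q :=
      fun q => VF.mdifferentiableAt_fun _ q
    have h1 := mvfderiv_comp_apply' (E₁ := EP) (g := fun p => B.act p g) (hd (B.act p g)) (B.mdifferentiable_act g p) (X.1 p)
    rw [X.2 g p] at h1
    refine h1.symm.trans ?_
    have e : (fun q => B.adFun v (B.act q g)) =
        fun q => LinearMap.toContinuousLinearMap L (B.adFun v q) := funext fun q => v.2.2 q g
    rw [e, mvfderiv_clm_comp _ (hd p)]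
    rfl⟩

/-- In a fixed basis of `𝔤` the vertical field of `v` is a combination of fundamental fields, whose
coefficients are the coordinate functions of `v` on `P`. As `X` commutes with the fundamental
fields, the bracket only differentiates the coefficients. -/
theorem lie_ι (X : B.Atiyah) (v : B.adSections) : ⁅X, B.ι v⁆ = B.ι (B.adDeriv X v) := by
  let e : Module.Basis (Fin (Module.finrank ℝ EG)) ℝ (GroupLieAlgebra 𝓘(ℝ, EG) G) :=
    Module.finBasis ℝ EG
  let c : ∀ a, EG →L[ℝ] ℝ := fun a => LinearMap.toContinuousLinearMap (e.coord a)
  let w : (Fin (Module.finrank ℝ EG)) → SmoothFun EP P ℝ :=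
    fun a => ⟨fun p => c a (B.adFun v p), (c a).contDiff.contMDiff.comp (B.adFun v).contMDiff⟩
  have hsum : ∀ v : B.adSections, ∀ w : (Fin (Module.finrank ℝ EG)) → SmoothFun EP P ℝ,
      (∀ a p, w a p = c a (v.1 p)) → B.vertical v = ∑ a, w a • B.fundamental (e a) := by
    intro v w hw
    ext p
    have h1 : ∀ s : Finset (Fin (Module.finrank ℝ EG)),
        ((∑ a ∈ s, w a • B.fundamental (e a) : VF EP P) p : EP) =
        ∑ a ∈ s, (w a p • (B.fundamental (e a) p : EP) : EP) := by
      intro s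
      induction s using Finset.induction_on with
      | empty => rfl
      | insert a s ha ih => rw [Finset.sum_insert ha, Finset.sum_insert ha, ← ih]; rfl
    rw [h1]
    have h2 : v.1 p = ∑ a, w a p • e a := by
      simp only [hw]
      exact (e.sum_repr (v.1 p)).symm
    let D : GroupLieAlgebra 𝓘(ℝ, EG) G →ₗ[ℝ] EP := (mfderiv 𝓘(ℝ, EG) 𝓘(ℝ, EP) (fun g => B.act p g) 1).toLinearMap
    refine (congrArg D h2).trans ?_
    rw [map_sum]
    exact Finset.sum_congr rfl fun a _ => D.map_smul _ _
  apply Subtype.ext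
  change ⁅X.1, -B.vertical v⁆ = -B.vertical (B.adDeriv X v)
  rw [lie_neg, hsum v w (fun _ _ => rfl), hsum (B.adDeriv X v) (fun a => ⁅X.1, w a⁆), lie_sum]
  · congr 1
    refine Finset.sum_congr rfl fun a _ => ?_
    rw [LieRinehartRing.leibniz_smul_right', lie_fundamental, smul_zero, zero_add]
  · intro a p
    exact mvfderiv_clm_comp _ (VF.mdifferentiableAt_fun _ p) _

end Connection

end SmoothPrincipalBundle

/-! ### Local gauges with cutoff -/

namespace SmoothPrincipalBundle

variable (B : SmoothPrincipalBundle EM M EG G EP P)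

/-- A local section `s` over `U`, the induced fibre coordinate `τ` with values in the group, and a
cutoff function supported in `U`. -/
structure LocalGauge (p₀ : P) where
  U : Set M
  isOpen : IsOpen U
  proj_mem : B.proj p₀ ∈ U
  τ : P → G
  s : M → P
  χ : SmoothFun EM M ℝ
  contMDiffOn_τ : ContMDiffOn 𝓘(ℝ, EP) 𝓘(ℝ, EG) ∞ τ (B.proj ⁻¹' U)
  contMDiffOn_s : ContMDiffOn 𝓘(ℝ, EM) 𝓘(ℝ, EP) ∞ s U
  proj_s : ∀ y ∈ U, B.proj (s y) = y
  τ_act : ∀ p, B.proj p ∈ U → ∀ g, τ (B.act p g) = τ p * g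
  act_τ : ∀ p, B.proj p ∈ U → B.act (s (B.proj p)) (τ p) = p
  τ_self : τ p₀ = 1
  χ_one : ∀ᶠ x in nhds (B.proj p₀), χ x = 1
  χ_supp : tsupport χ ⊆ U

/-- The fibre coordinate of a trivialization is translated on the left so that the section passes
through `p₀`. The cutoff is a bump function at the base point with support in `U`; it turns local
constructions into global elements of `A` and `L`. -/
theorem nonempty_localGauge [T2Space M] (p₀ : P) : Nonempty (B.LocalGauge p₀) := by
  obtain ⟨U, hU, hx, e, hs, ht, he1, he2, he⟩ := B.exists_trivialization (B.proj p₀)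
  have hmem : ∀ {p}, B.proj p ∈ U → p ∈ e.source := fun {p} hp => by rw [hs]; exact hp
  have hm : ∀ y ∈ U, ∀ g, (y, g) ∈ e.target := fun y hy g => by rw [ht]; exact ⟨hy, trivial⟩
  have hpr : ∀ y ∈ U, ∀ g, B.proj (e.symm (y, g)) = y := fun y hy g => by
    rw [← (he _ (e.map_target (hm y hy g))).1, e.right_inv (hm y hy g)]
  obtain ⟨χ, -, hχ⟩ := (SmoothBumpFunction.nhds_basis_tsupport (I := 𝓘(ℝ, EM)) (B.proj p₀)).mem_iff.1
    (hU.mem_nhds hx)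
  refine ⟨{
    U := U
    isOpen := hU
    proj_mem := hx
    τ := fun p => (e p₀).2⁻¹ * (e p).2
    s := fun y => e.symm (y, (e p₀).2)
    χ := ⟨χ, χ.contMDiff⟩
    contMDiffOn_τ := by
      rw [← hs]
      exact (contMDiff_mul_left (I := 𝓘(ℝ, EG)) (a := (e p₀).2⁻¹)).comp_contMDiffOn
        (contMDiff_snd.comp_contMDiffOn he1)
    contMDiffOn_s := he2.comp (contMDiffOn_id.prodMk contMDiffOn_const) fun y hy => hm y hy _
    proj_s := fun y hy => hpr y hy _
    τ_act := fun p hp g => by rw [(he p (hmem hp)).2]; exact (mul_assoc _ _ _).symm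
    act_τ := fun p hp => by
      have h1 := hpr _ hp (e p₀).2
      refine e.injOn (hmem (by rwa [B.proj_act, h1])) (hmem hp) ?_
      rw [(he _ (hmem (by rwa [h1]))).2, h1, e.right_inv (hm _ hp _), mul_inv_cancel_left,
        ← (he p (hmem hp)).1]
    τ_self := inv_mul_cancel _
    χ_one := χ.eventuallyEq_one
    χ_supp := hχ }⟩

namespace LocalGauge

variable {B} {p₀ : P} (Λ : B.LocalGauge p₀)

theorem isOpen_preimage : IsOpen (B.proj ⁻¹' Λ.U) := Λ.isOpen.preimage B.contMDiff_proj.continuous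

theorem χ_eq_zero {x : M} (hx : x ∉ Λ.U) : Λ.χ x = 0 :=
  image_eq_zero_of_notMem_tsupport fun h => hx (Λ.χ_supp h)

theorem eventually_χ_eq_zero {x : M} (hx : x ∉ Λ.U) : ∀ᶠ y in nhds x, Λ.χ y = 0 := by
  filter_upwards [(isClosed_tsupport Λ.χ).isOpen_compl.mem_nhds fun h => hx (Λ.χ_supp h)] with y hy
  exact image_eq_zero_of_notMem_tsupport hy

theorem χ_self : Λ.χ (B.proj p₀) = 1 := Λ.χ_one.self_of_nhds

theorem s_self : Λ.s (B.proj p₀) = p₀ := by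
  have := Λ.act_τ p₀ Λ.proj_mem
  rwa [Λ.τ_self, B.act_one] at this

theorem contMDiffAt_τ {p : P} (hp : B.proj p ∈ Λ.U) : ContMDiffAt 𝓘(ℝ, EP) 𝓘(ℝ, EG) ∞ Λ.τ p :=
  Λ.contMDiffOn_τ.contMDiffAt (Λ.isOpen_preimage.mem_nhds hp)

theorem contMDiffAt_s {y : M} (hy : y ∈ Λ.U) : ContMDiffAt 𝓘(ℝ, EM) 𝓘(ℝ, EP) ∞ Λ.s y :=
  Λ.contMDiffOn_s.contMDiffAt (Λ.isOpen.mem_nhds hy)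

theorem eventually_mem {p : P} (hp : B.proj p ∈ Λ.U) : ∀ᶠ q in nhds p, B.proj q ∈ Λ.U :=
  Λ.isOpen_preimage.mem_nhds hp

/-- Smooth functions on the domain of the gauge are extended by means of the cutoff function. -/
theorem contMDiff_χ_smul {V : Type*} [NormedAddCommGroup V] [NormedSpace ℝ V] {v : P → V}
    (hv : ∀ p, B.proj p ∈ Λ.U → ContMDiffAt 𝓘(ℝ, EP) 𝓘(ℝ, V) ∞ v p) :
    ContMDiff 𝓘(ℝ, EP) 𝓘(ℝ, V) ∞ (fun p => Λ.χ (B.proj p) • v p) := by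
  intro p
  by_cases hp : B.proj p ∈ Λ.U
  · exact (B.pullback Λ.χ).contMDiff.contMDiffAt.smul (hv p hp)
  · refine (contMDiffAt_const (c := (0 : V))).congr_of_eventuallyEq ?_
    filter_upwards [B.contMDiff_proj.continuous.continuousAt.eventually
      (Λ.eventually_χ_eq_zero hp)] with q hq
    rw [hq, zero_smul]

theorem contMDiff_χ_smul_section {X : Π p : P, TangentSpace 𝓘(ℝ, EP) p}
    (hX : ∀ p, B.proj p ∈ Λ.U → ContMDiffAt 𝓘(ℝ, EP) 𝓘(ℝ, EP).tangent ∞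
      (fun p => (⟨p, X p⟩ : TangentBundle 𝓘(ℝ, EP) P)) p) :
    ContMDiff 𝓘(ℝ, EP) 𝓘(ℝ, EP).tangent ∞
      (fun p => (⟨p, Λ.χ (B.proj p) • X p⟩ : TangentBundle 𝓘(ℝ, EP) P)) := by
  intro p
  by_cases hp : B.proj p ∈ Λ.U
  · exact (B.pullback Λ.χ).contMDiff.contMDiffAt.smul_section (hX p hp)
  · refine (Bundle.contMDiff_zeroSection ℝ (TangentSpace 𝓘(ℝ, EP) : P → Type _)).contMDiffAt
      |>.congr_of_eventuallyEq ?_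
    filter_upwards [B.contMDiff_proj.continuous.continuousAt.eventually
      (Λ.eventually_χ_eq_zero hp)] with q hq
    exact TangentBundle.mk_congr (N₁ := P) (E₁ := EP) rfl (by rw [hq]; exact zero_smul ℝ (X q : EP))

/-! ### Local frames of the adjoint bundle -/

section Frame

/-- The element of the adjoint bundle which is constant in the gauge, multiplied by the cutoff
function. -/
noncomputable def frame (w : GroupLieAlgebra 𝓘(ℝ, EG) G) : B.adSections :=
  ⟨fun p => Λ.χ (B.proj p) • adjointRep (Λ.τ p)⁻¹ w,
    Λ.contMDiff_χ_smul (V := EG) (v := fun p => adjointRep (Λ.τ p)⁻¹ w) fun p hp =>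
      (contMDiff_adjointRep_apply w (Λ.τ p)⁻¹).comp p (Λ.contMDiffAt_τ hp).inv,
    fun p g => by
      change Λ.χ (B.proj (B.act p g)) • adjointRep (Λ.τ (B.act p g))⁻¹ w = _
      rw [B.proj_act, map_smul]
      by_cases hp : B.proj p ∈ Λ.U
      · rw [Λ.τ_act p hp, mul_inv_rev, adjointRep_mul]
      · rw [Λ.χ_eq_zero hp, zero_smul, zero_smul]⟩

theorem frame_apply (w : GroupLieAlgebra 𝓘(ℝ, EG) G) (p : P) :
    (Λ.frame w).1 p = Λ.χ (B.proj p) • adjointRep (Λ.τ p)⁻¹ w := rfl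

theorem frame_self (w : GroupLieAlgebra 𝓘(ℝ, EG) G) : (Λ.frame w).1 p₀ = w := by
  rw [frame_apply, Λ.χ_self, Λ.τ_self, inv_one, adjointRep_one, one_smul]

variable {n : ℕ} (E : Module.Basis (Fin n) ℝ (GroupLieAlgebra 𝓘(ℝ, EG) G))

/-- The coordinates of a section in the local frame, multiplied by the cutoff function. -/
noncomputable def coord (γ : B.adSections) (a : Fin n) : SmoothFun EM M ℝ :=
  ⟨fun y => Λ.χ y • E.coord a (γ.1 (Λ.s y)), by
    let L : EG →ₗ[ℝ] ℝ := E.coord a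
    intro y
    by_cases hy : y ∈ Λ.U
    · exact Λ.χ.contMDiff.contMDiffAt.smul
        ((LinearMap.toContinuousLinearMap L).contDiff.contMDiff.contMDiffAt.comp y
          ((B.adFun γ).contMDiff.contMDiffAt.comp y (Λ.contMDiffAt_s hy)))
    · refine (contMDiffAt_const (c := (0 : ℝ))).congr_of_eventuallyEq ?_
      filter_upwards [Λ.eventually_χ_eq_zero hy] with q hq
      rw [hq, zero_smul]⟩

theorem coord_eq_zero {γ : B.adSections} (hγ : γ.1 p₀ = 0) (a : Fin n) :
    Λ.coord E γ a (B.proj p₀) = 0 := by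
  change Λ.χ _ • E.coord a (γ.1 (Λ.s _)) = 0
  rw [Λ.s_self, hγ, map_zero, smul_zero]

/-- Both the coordinates and the frame carry the cutoff, hence its square. On `U` this is
equivariance along `p = s(π p) · τ(p)` and the expansion of `γ(s(π p))` in `E`. -/
theorem sum_coord_smul_frame (γ : B.adSections) :
    ∑ a, Λ.coord E γ a • Λ.frame (E a) = (Λ.χ * Λ.χ) • γ := by
  apply Subtype.ext
  ext1 p
  have h1 : ∀ s : Finset (Fin n),
      ((∑ a ∈ s, Λ.coord E γ a • Λ.frame (E a) : B.adSections).1 p) =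
      ∑ a ∈ s, Λ.coord E γ a (B.proj p) • (Λ.frame (E a)).1 p := by
    intro s
    induction s using Finset.induction_on with
    | empty => rfl
    | insert a s ha ih => rw [Finset.sum_insert ha, Finset.sum_insert ha, ← ih]; rfl
  rw [h1, smul_adSections_apply]
  change ∑ a, (Λ.χ (B.proj p) * E.coord a (γ.1 (Λ.s (B.proj p)))) • Λ.χ (B.proj p) •
    adjointRep (Λ.τ p)⁻¹ (E a) = (Λ.χ (B.proj p) * Λ.χ (B.proj p)) • γ.1 p
  by_cases hp : B.proj p ∈ Λ.U
  · have h2 : γ.1 p = ∑ a, E.coord a (γ.1 (Λ.s (B.proj p))) • adjointRep (Λ.τ p)⁻¹ (E a) := by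
      conv_lhs => rw [← Λ.act_τ p hp, γ.2.2, ← E.sum_repr (γ.1 (Λ.s (B.proj p)))]
      simp only [map_sum, map_smul]
      rfl
    rw [h2, Finset.smul_sum]
    refine Finset.sum_congr rfl fun a _ => ?_
    rw [smul_smul, smul_smul]
    congr 1
    ring
  · simp [Λ.χ_eq_zero hp]

end Frame

end LocalGauge

end SmoothPrincipalBundle

theorem mfderiv_comp_apply' {E₁ : Type*} [NormedAddCommGroup E₁] [NormedSpace ℝ E₁]
    {N₁ : Type*} [TopologicalSpace N₁] [ChartedSpace E₁ N₁]
    {E₂ : Type*} [NormedAddCommGroup E₂] [NormedSpace ℝ E₂]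
    {N₂ : Type*} [TopologicalSpace N₂] [ChartedSpace E₂ N₂]
    {E₃ : Type*} [NormedAddCommGroup E₃] [NormedSpace ℝ E₃]
    {N₃ : Type*} [TopologicalSpace N₃] [ChartedSpace E₃ N₃]
    {f : N₂ → N₃} {g : N₁ → N₂} {x : N₁} {y : N₂} (hy : g x = y)
    (hf : MDifferentiableAt 𝓘(ℝ, E₂) 𝓘(ℝ, E₃) f y)
    (hg : MDifferentiableAt 𝓘(ℝ, E₁) 𝓘(ℝ, E₂) g x) (v : E₁) :
    (mfderiv 𝓘(ℝ, E₁) 𝓘(ℝ, E₃) (fun z => f (g z)) x v : E₃) =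
      mfderiv 𝓘(ℝ, E₂) 𝓘(ℝ, E₃) f y (mfderiv 𝓘(ℝ, E₁) 𝓘(ℝ, E₂) g x v : E₂) := by
  subst hy
  exact DFunLike.congr_fun (mfderiv_comp (I' := 𝓘(ℝ, E₂)) x hf hg) v

theorem mfderiv_apply_congr_fun {E₁ : Type*} [NormedAddCommGroup E₁] [NormedSpace ℝ E₁]
    {N₁ : Type*} [TopologicalSpace N₁] [ChartedSpace E₁ N₁]
    {E₂ : Type*} [NormedAddCommGroup E₂] [NormedSpace ℝ E₂]
    {N₂ : Type*} [TopologicalSpace N₂] [ChartedSpace E₂ N₂] {f g : N₁ → N₂} {x : N₁}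
    (h : f =ᶠ[nhds x] g) (v : E₁) :
    (mfderiv 𝓘(ℝ, E₁) 𝓘(ℝ, E₂) f x v : E₂) = mfderiv 𝓘(ℝ, E₁) 𝓘(ℝ, E₂) g x v := by
  exact DFunLike.congr_fun h.mfderiv_eq v

/-! ### Horizontal lifts and the flat connection of a gauge -/

namespace SmoothPrincipalBundle.LocalGauge

variable {B : SmoothPrincipalBundle EM M EG G EP P} {p₀ : P} (Λ : B.LocalGauge p₀)

/-- The infinitesimal action of the Lie algebra at the point `p`. -/
noncomputable def infinitesimalAct (B : SmoothPrincipalBundle EM M EG G EP P) (p : P) (ξ : EG) : EP :=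
  mfderiv 𝓘(ℝ, EG) 𝓘(ℝ, EP) (fun g => B.act p g) 1 ξ

/-- The horizontal lift of a tangent vector at `π p` in the gauge. -/
noncomputable def horizontal (p : P) (v : EM) : EP :=
  mfderiv 𝓘(ℝ, EM) 𝓘(ℝ, EP) (fun y => B.act (Λ.s y) (Λ.τ p)) (B.proj p) v

theorem mdifferentiableAt_act_s {y : M} (hy : y ∈ Λ.U) (g : G) :
    MDifferentiableAt 𝓘(ℝ, EM) 𝓘(ℝ, EP) (fun y => B.act (Λ.s y) g) y :=
  ((B.contMDiff_act_right g).contMDiffAt.comp y (Λ.contMDiffAt_s hy)).mdifferentiableAt (by simp)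

/-- The lift at `p` is the derivative of the translated section `y ↦ s(y) · g` with `g = τ(p)`, so
smoothness in `p` is that of a partial derivative with the group element as parameter. -/
theorem contMDiffAt_horizontal (Y : VF EM M) {p : P} (hp : B.proj p ∈ Λ.U) :
    ContMDiffAt 𝓘(ℝ, EP) 𝓘(ℝ, EP).tangent ∞
      (fun p => (⟨p, Λ.horizontal p (Y (B.proj p))⟩ : TangentBundle 𝓘(ℝ, EP) P)) p := by
  have hΦ : ContMDiffOn (𝓘(ℝ, EG).prod 𝓘(ℝ, EM)) 𝓘(ℝ, EP) ∞
      (fun q : G × M => B.act (Λ.s q.2) q.1) (Set.univ ×ˢ Λ.U) := by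
    have h1 : ContMDiffOn (𝓘(ℝ, EG).prod 𝓘(ℝ, EM)) 𝓘(ℝ, EP) ∞
        (fun q : G × M => Λ.s q.2) (Set.univ ×ˢ Λ.U) :=
      Λ.contMDiffOn_s.comp contMDiffOn_snd fun q hq => hq.2
    exact B.contMDiff_act.comp_contMDiffOn (h1.prodMk contMDiffOn_fst)
  have h := contMDiffAt_mfderiv_partial (Φ := fun (g : G) y => B.act (Λ.s y) g)
    (isOpen_univ.prod Λ.isOpen) hΦ (f := Λ.τ) (b := B.proj) (ζ := fun p => Y (B.proj p)) (p := p)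
    ⟨trivial, hp⟩ (Λ.contMDiffAt_τ hp)
    ((Y.contMDiff _).comp p B.contMDiff_proj.contMDiffAt)
  refine h.congr_of_eventuallyEq ?_
  filter_upwards [Λ.eventually_mem hp] with q hq
  exact TangentBundle.mk_congr (N₁ := P) (E₁ := EP) (Λ.act_τ q hq).symm rfl

theorem mfderiv_act_horizontal {p : P} (hp : B.proj p ∈ Λ.U) (g : G) (v : EM) :
    (mfderiv 𝓘(ℝ, EP) 𝓘(ℝ, EP) (fun p => B.act p g) p (Λ.horizontal p v : EP) : EP) =
      Λ.horizontal (B.act p g) v := by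
  rw [horizontal, horizontal, B.proj_act]
  refine (mfderiv_comp_apply' (f := fun p => B.act p g)
    (g := fun y => B.act (Λ.s y) (Λ.τ p)) (x := B.proj p) (Λ.act_τ p hp) (B.mdifferentiable_act g p)
    (Λ.mdifferentiableAt_act_s hp _) v).symm.trans ?_
  rw [Λ.τ_act p hp]
  exact mfderiv_apply_congr_fun (Filter.Eventually.of_forall fun y => (B.act_mul _ _ _).symm) v

theorem mfderiv_proj_horizontal {p : P} (hp : B.proj p ∈ Λ.U) (v : EM) :
    (mfderiv 𝓘(ℝ, EP) 𝓘(ℝ, EM) B.proj p (Λ.horizontal p v : EP) : EM) = v := by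
  rw [horizontal]
  refine (mfderiv_comp_apply' (f := B.proj)
    (g := fun y => B.act (Λ.s y) (Λ.τ p)) (x := B.proj p) (Λ.act_τ p hp)
    (B.contMDiff_proj.mdifferentiable (by simp) p)
    (Λ.mdifferentiableAt_act_s hp _) v).symm.trans ?_
  have h : (fun y => B.proj (B.act (Λ.s y) (Λ.τ p))) =ᶠ[nhds (B.proj p)] id := by
    filter_upwards [Λ.isOpen.mem_nhds hp] with y hy
    rw [B.proj_act, Λ.proj_s y hy, id]
  rw [mfderiv_apply_congr_fun h]
  exact DFunLike.congr_fun (mfderiv_id (I := 𝓘(ℝ, EM))) v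

/-- The horizontal lift of vector fields in the gauge, multiplied by the cutoff function. -/
noncomputable def lift : VF EM M →ₗ[SmoothFun EM M ℝ] B.Atiyah where
  toFun Y := ⟨⟨fun p => (Λ.χ (B.proj p) • Λ.horizontal p (Y (B.proj p)) : EP),
    Λ.contMDiff_χ_smul_section fun p hp => Λ.contMDiffAt_horizontal Y hp⟩, fun g p => by
      refine ((mfderiv 𝓘(ℝ, EP) 𝓘(ℝ, EP) (fun p => B.act p g) p).map_smul (Λ.χ (B.proj p))
        (Λ.horizontal p (Y (B.proj p)) : EP)).trans ?_
      change Λ.χ (B.proj p) • (_ : EP) = Λ.χ (B.proj (B.act p g)) •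
        Λ.horizontal (B.act p g) (Y (B.proj (B.act p g)))
      rw [B.proj_act]
      by_cases hp : B.proj p ∈ Λ.U
      · exact congrArg _ (Λ.mfderiv_act_horizontal hp g _)
      · rw [Λ.χ_eq_zero hp]
        exact (zero_smul ℝ (_ : EP)).trans (zero_smul ℝ (_ : EP)).symm⟩
  map_add' Y Z := Subtype.ext <| VF.ext fun p => by
    have h := (mfderiv 𝓘(ℝ, EM) 𝓘(ℝ, EP) (fun y => B.act (Λ.s y) (Λ.τ p)) (B.proj p)).map_add
      (Y (B.proj p)) (Z (B.proj p))
    exact (congrArg (fun z : EP => Λ.χ (B.proj p) • z) h).trans (smul_add _ _ _)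
  map_smul' f Y := Subtype.ext <| VF.ext fun p => by
    have h := (mfderiv 𝓘(ℝ, EM) 𝓘(ℝ, EP) (fun y => B.act (Λ.s y) (Λ.τ p)) (B.proj p)).map_smul
      (f (B.proj p)) (Y (B.proj p))
    exact (congrArg (fun z : EP => Λ.χ (B.proj p) • z) h).trans
      (smul_comm (Λ.χ (B.proj p)) (f (B.proj p)) (Λ.horizontal p (Y (B.proj p))))

theorem lift_apply (Y : VF EM M) (p : P) :
    ((Λ.lift Y).1 p : EP) = Λ.χ (B.proj p) • Λ.horizontal p (Y (B.proj p)) := rfl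

theorem anchor_lift (Y : VF EM M) : B.anchor (Λ.lift Y) = Λ.χ • Y := by
  ext x
  obtain ⟨p, rfl⟩ := B.exists_proj_eq x
  refine (B.anchor_apply _ p).trans ?_
  rw [lift_apply]
  refine ((mfderiv 𝓘(ℝ, EP) 𝓘(ℝ, EM) B.proj p).map_smul (Λ.χ (B.proj p))
    (Λ.horizontal p (Y (B.proj p)) : EP)).trans ?_
  by_cases hp : B.proj p ∈ Λ.U
  · exact congrArg (fun z : EM => Λ.χ (B.proj p) • z) (Λ.mfderiv_proj_horizontal hp _)
  · rw [VF.smul_apply, Λ.χ_eq_zero hp]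
    exact (zero_smul ℝ (_ : EM)).trans (zero_smul ℝ (_ : EM)).symm

/-- The connection form of the gauge. -/
noncomputable def connection (p : P) (v : EP) : EG :=
  mfderiv 𝓘(ℝ, EP) 𝓘(ℝ, EG) (fun q => (Λ.τ p)⁻¹ * Λ.τ q) p v

theorem mdifferentiable_mul_left (g : G) :
    MDifferentiable 𝓘(ℝ, EG) 𝓘(ℝ, EG) (fun h : G => g * h) :=
  (contMDiff_mul_left (I := 𝓘(ℝ, EG)) (n := ∞) (a := g)).mdifferentiable (by simp)

theorem mdifferentiableAt_τ {p : P} (hp : B.proj p ∈ Λ.U) :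
    MDifferentiableAt 𝓘(ℝ, EP) 𝓘(ℝ, EG) Λ.τ p := (Λ.contMDiffAt_τ hp).mdifferentiableAt (by simp)

theorem mdifferentiableAt_mul_τ {p : P} (hp : B.proj p ∈ Λ.U) (g : G) :
    MDifferentiableAt 𝓘(ℝ, EP) 𝓘(ℝ, EG) (fun q => g * Λ.τ q) p :=
  (mdifferentiable_mul_left g (Λ.τ p)).comp p (Λ.mdifferentiableAt_τ hp)

/-- The map being differentiated itself depends on `p` through the translation by `τ(p)⁻¹`. The
derivative is split by the chain rule into that of `τ` and that of the multiplication, the latter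
with `τ(p)⁻¹` as parameter. -/
theorem contMDiffAt_connection (X : B.Atiyah) {p : P} (hp : B.proj p ∈ Λ.U) :
    ContMDiffAt 𝓘(ℝ, EP) 𝓘(ℝ, EG) ∞ (fun p => Λ.connection p (X.1 p)) p := by
  have h1 := contMDiffAt_mfderiv_partial (E₁ := ℝ) (N₁ := ℝ) (Φ := fun (_ : ℝ) q => Λ.τ q)
    (isOpen_univ.prod Λ.isOpen_preimage)
    (Λ.contMDiffOn_τ.comp contMDiffOn_snd fun q hq => hq.2) (f := fun _ => 0)
    (b := fun q => q) (ζ := X.1) (p := p) ⟨trivial, hp⟩ contMDiffAt_const (X.1.contMDiff p)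
  have h2 := contMDiffAt_mfderiv_partial (Φ := fun g h : G => g * h) isOpen_univ
    (contMDiff_mul 𝓘(ℝ, EG) ∞).contMDiffOn (f := fun q => (Λ.τ q)⁻¹) (p := p) trivial
    (Λ.contMDiffAt_τ hp).inv h1
  refine (contMDiffAt_tangentBundle_const (N₁ := G) (x := 1)).1 (h2.congr_of_eventuallyEq ?_)
  filter_upwards [Λ.eventually_mem hp] with q hq
  exact TangentBundle.mk_congr (N₁ := G) (E₁ := EG) (by simp)
    (mfderiv_comp_apply' (f := fun h => (Λ.τ q)⁻¹ * h) rfl (mdifferentiable_mul_left _ _)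
      (Λ.mdifferentiableAt_τ hq) _)

/-- Differentiate `τ(p·g)⁻¹ τ(q·g) = g⁻¹ (τ(p)⁻¹ τ(q)) g` in `q` and use the invariance of `X`. -/
theorem connection_act (X : B.Atiyah) {p : P} (hp : B.proj p ∈ Λ.U) (g : G) :
    Λ.connection (B.act p g) (X.1 (B.act p g)) = adjointRep g⁻¹ (Λ.connection p (X.1 p)) := by
  have hpg : B.proj (B.act p g) ∈ Λ.U := by rwa [B.proj_act]
  refine (congrArg (Λ.connection (B.act p g)) (X.2 g p).symm).trans ?_
  refine (mfderiv_comp_apply' (E₁ := EP) (f := fun q => (Λ.τ (B.act p g))⁻¹ * Λ.τ q)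
    (g := fun p => B.act p g) rfl
    (Λ.mdifferentiableAt_mul_τ hpg _) (B.mdifferentiable_act g p) (X.1 p)).symm.trans ?_
  refine Eq.trans ?_ (mfderiv_comp_apply' (f := fun h => g⁻¹ * h * g⁻¹⁻¹)
    (g := fun q => (Λ.τ p)⁻¹ * Λ.τ q) (inv_mul_cancel _)
    (mdifferentiable_conj g⁻¹ 1) (Λ.mdifferentiableAt_mul_τ hp _) (X.1 p))
  refine mfderiv_apply_congr_fun ?_ _
  filter_upwards [Λ.eventually_mem hp] with q hq
  rw [Λ.τ_act p hp, Λ.τ_act q hq]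
  simp [mul_assoc]

theorem connection_infinitesimalAct {p : P} (hp : B.proj p ∈ Λ.U) (ξ : EG) :
    Λ.connection p (infinitesimalAct B p ξ) = ξ := by
  refine (mfderiv_comp_apply' (f := fun q => (Λ.τ p)⁻¹ * Λ.τ q) (B.act_one p)
    (Λ.mdifferentiableAt_mul_τ hp _) ((B.contMDiff_orbit p).mdifferentiable (by simp) 1)
    ξ).symm.trans ?_
  have : (fun g => (Λ.τ p)⁻¹ * Λ.τ (B.act p g)) = id := by
    ext1 g
    rw [Λ.τ_act p hp, inv_mul_cancel_left, id]
  rw [this]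
  exact DFunLike.congr_fun (mfderiv_id (I := 𝓘(ℝ, EG))) ξ

/-- Near `p` one has `q = s(π q) · τ(p) · (τ(p)⁻¹ τ(q))`. The derivative of this identity at `p` is
the sum of the contributions of the base and the group variable, i.e. of the horizontal and the
vertical part. -/
theorem horizontal_add_infinitesimalAct {p : P} (hp : B.proj p ∈ Λ.U) (v : EP) :
    Λ.horizontal p (mfderiv 𝓘(ℝ, EP) 𝓘(ℝ, EM) B.proj p v : EM) +
      infinitesimalAct B p (Λ.connection p v) = v := by
  let H : M × G → P := fun z => B.act (B.act (Λ.s z.1) (Λ.τ p)) z.2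
  have hH : MDifferentiableAt (𝓘(ℝ, EM).prod 𝓘(ℝ, EG)) 𝓘(ℝ, EP) H (B.proj p, (Λ.τ p)⁻¹ * Λ.τ p) := by
    have h1 : ContMDiffAt (𝓘(ℝ, EM).prod 𝓘(ℝ, EG)) 𝓘(ℝ, EP) ∞
        (fun z : M × G => B.act (Λ.s z.1) (Λ.τ p)) (B.proj p, (Λ.τ p)⁻¹ * Λ.τ p) :=
      (B.contMDiff_act_right (Λ.τ p)).contMDiffAt.comp _
        (ContMDiffAt.comp (g := Λ.s) (f := Prod.fst) (B.proj p, (Λ.τ p)⁻¹ * Λ.τ p)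
          (Λ.contMDiffAt_s hp) contMDiffAt_fst)
    exact (B.contMDiff_act.contMDiffAt.comp _ (h1.prodMk contMDiffAt_snd)).mdifferentiableAt
      (by simp)
  have hπ := B.contMDiff_proj.mdifferentiable (by simp) p
  have hm := Λ.mdifferentiableAt_mul_τ hp (Λ.τ p)⁻¹
  have h := DFunLike.congr_fun (mfderiv_comp p hH (hπ.prodMk hm)) v
  have hid : H ∘ (fun q => (B.proj q, (Λ.τ p)⁻¹ * Λ.τ q)) =ᶠ[nhds p] id := by
    filter_upwards [Λ.eventually_mem hp] with q hq
    change B.act (B.act (Λ.s (B.proj q)) (Λ.τ p)) ((Λ.τ p)⁻¹ * Λ.τ q) = q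
    rw [← B.act_mul, mul_inv_cancel_left, Λ.act_τ q hq]
  have h2 : (mfderiv 𝓘(ℝ, EP) 𝓘(ℝ, EP) (H ∘ fun q => (B.proj q, (Λ.τ p)⁻¹ * Λ.τ q)) p v : EP) = v :=
    (mfderiv_apply_congr_fun hid v).trans (DFunLike.congr_fun (mfderiv_id (I := 𝓘(ℝ, EP))) v)
  have h3 := mfderiv_prod_eq_add_apply hH (v := (mfderiv 𝓘(ℝ, EP) (𝓘(ℝ, EM).prod 𝓘(ℝ, EG))
    (fun q => (B.proj q, (Λ.τ p)⁻¹ * Λ.τ q)) p v : EM × EG))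
  have h4 := DFunLike.congr_fun (mfderiv_prodMk hπ hm) v
  refine Eq.trans ?_ (h3.symm.trans (h.symm.trans h2))
  have e1 : (fun z : M => H (z, (Λ.τ p)⁻¹ * Λ.τ p)) = fun y => B.act (Λ.s y) (Λ.τ p) := by
    ext1 y
    simp [H, B.act_one]
  have e2 : (fun z : G => H (B.proj p, z)) = fun g => B.act p g := by
    ext1 g
    simp only [H, Λ.act_τ p hp]
  have h41 := congrArg (fun z : EM × EG => z.1) h4
  have h42 := congrArg (fun z : EM × EG => z.2) h4
  have e3 := (DFunLike.congr_arg (mfderiv 𝓘(ℝ, EM) 𝓘(ℝ, EP)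
    (fun z : M => H (z, (Λ.τ p)⁻¹ * Λ.τ p)) (B.proj p)) h41).trans
    (mfderiv_apply_congr_fun (Filter.Eventually.of_forall (congrFun e1)) _)
  have e4 := (DFunLike.congr_arg (mfderiv 𝓘(ℝ, EG) 𝓘(ℝ, EP)
    (fun z : G => H (B.proj p, z)) ((Λ.τ p)⁻¹ * Λ.τ p)) h42).trans
    ((mfderiv_apply_congr_fun (Filter.Eventually.of_forall (congrFun e2)) _).trans
    (mfderiv_apply_congr (E := EG) (F := EP) (fun g => B.act p g) (inv_mul_cancel (Λ.τ p)) _))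
  exact (congrArg₂ (fun z w : EP => z + w) e3 e4).symm

/-- The vertical part of an element of the algebroid in the gauge, multiplied by the cutoff
function. -/
noncomputable def vert : B.Atiyah →ₗ[SmoothFun EM M ℝ] B.adSections where
  toFun X := ⟨fun p => -(Λ.χ (B.proj p) • (Λ.connection p (X.1 p) : EG)),
    (Λ.contMDiff_χ_smul (V := EG) fun p hp => Λ.contMDiffAt_connection X hp).neg, fun p g => by
      change -(Λ.χ (B.proj (B.act p g)) • Λ.connection (B.act p g) (X.1 (B.act p g))) =
        adjointRep g⁻¹ (-(Λ.χ (B.proj p) •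
          (Λ.connection p (X.1 p) : GroupLieAlgebra 𝓘(ℝ, EG) G)))
      have hlin : ∀ (c : ℝ) (ξ : GroupLieAlgebra 𝓘(ℝ, EG) G),
          adjointRep g⁻¹ (-(c • ξ)) = -(c • adjointRep g⁻¹ ξ) := fun c ξ => by simp
      refine Eq.trans ?_ (hlin _ _).symm
      rw [B.proj_act]
      by_cases hp : B.proj p ∈ Λ.U
      · exact congrArg (fun z : EG => -(Λ.χ (B.proj p) • z)) (Λ.connection_act X hp g)
      · rw [Λ.χ_eq_zero hp]
        exact congrArg Neg.neg ((zero_smul ℝ (_ : EG)).trans (zero_smul ℝ (_ : EG)).symm)⟩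
  map_add' X Y := Subtype.ext <| funext fun p => by
    have h := (mfderiv 𝓘(ℝ, EP) 𝓘(ℝ, EG) (fun q => (Λ.τ p)⁻¹ * Λ.τ q) p).map_add (X.1 p) (Y.1 p)
    refine (congrArg (fun z : EG => -(Λ.χ (B.proj p) • z)) h).trans ?_
    exact (congrArg Neg.neg (smul_add (Λ.χ (B.proj p)) (Λ.connection p (X.1 p))
      (Λ.connection p (Y.1 p)))).trans (neg_add _ _)
  map_smul' f X := Subtype.ext <| funext fun p => by
    have h := (mfderiv 𝓘(ℝ, EP) 𝓘(ℝ, EG) (fun q => (Λ.τ p)⁻¹ * Λ.τ q) p).map_smul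
      (f (B.proj p)) (X.1 p)
    refine (congrArg (fun z : EG => -(Λ.χ (B.proj p) • z)) h).trans ?_
    exact (congrArg Neg.neg (smul_comm (Λ.χ (B.proj p)) (f (B.proj p))
      (Λ.connection p (X.1 p)))).trans (smul_neg _ _).symm

theorem infinitesimalAct_smul (p : P) (c : ℝ) (ξ : EG) :
    infinitesimalAct B p (c • ξ) = c • infinitesimalAct B p ξ :=
  (mfderiv 𝓘(ℝ, EG) 𝓘(ℝ, EP) (fun g => B.act p g) 1).map_smul c ξ

theorem infinitesimalAct_neg (p : P) (ξ : EG) :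
    infinitesimalAct B p (-ξ) = - infinitesimalAct B p ξ :=
  (mfderiv 𝓘(ℝ, EG) 𝓘(ℝ, EP) (fun g => B.act p g) 1).map_neg ξ

/-- The decomposition of an element of the algebroid in its horizontal and vertical parts. -/
theorem lift_anchor_add_ι_vert (X : B.Atiyah) :
    Λ.lift (B.anchor X) + B.ι (Λ.vert X) = Λ.χ • X := by
  apply Subtype.ext
  ext p
  change (Λ.χ (B.proj p) • Λ.horizontal p (B.anchor X (B.proj p)) : EP) +
    -(infinitesimalAct B p (-(Λ.χ (B.proj p) • Λ.connection p (X.1 p)))) =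
      (Λ.χ (B.proj p) • (X.1 p : EP) : EP)
  -- The sign in `vert` compensates for that of `ι`, which differentiates `p · exp (-t v)`.
  rw [infinitesimalAct_neg, infinitesimalAct_smul, neg_neg]
  by_cases hp : B.proj p ∈ Λ.U
  · refine (smul_add _ _ _).symm.trans (congrArg (fun z : EP => Λ.χ (B.proj p) • z) ?_)
    refine Eq.trans ?_ (Λ.horizontal_add_infinitesimalAct hp (X.1 p))
    exact congrArg (fun z : EM => Λ.horizontal p z + _) (B.anchor_apply X p)
  · rw [Λ.χ_eq_zero hp]
    refine (congrArg₂ (fun z w : EP => z + w) (zero_smul ℝ _) (zero_smul ℝ _)).trans ?_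
    exact (add_zero _).trans (zero_smul ℝ (_ : EP)).symm

theorem vert_ι (γ : B.adSections) : Λ.vert (B.ι γ) = Λ.χ • γ := by
  apply Subtype.ext
  ext1 p
  change -(Λ.χ (B.proj p) • Λ.connection p (-(infinitesimalAct B p (γ.1 p)))) =
    Λ.χ (B.proj p) • (γ.1 p : EG)
  have h : Λ.connection p (-(infinitesimalAct B p (γ.1 p))) =
      - Λ.connection p (infinitesimalAct B p (γ.1 p)) :=
    (mfderiv 𝓘(ℝ, EP) 𝓘(ℝ, EG) (fun q => (Λ.τ p)⁻¹ * Λ.τ q) p).map_neg _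
  rw [h, smul_neg, neg_neg]
  by_cases hp : B.proj p ∈ Λ.U
  · exact congrArg (fun z : EG => Λ.χ (B.proj p) • z) (Λ.connection_infinitesimalAct hp (γ.1 p))
  · rw [Λ.χ_eq_zero hp]
    exact (zero_smul ℝ (_ : EG)).trans (zero_smul ℝ (_ : EG)).symm

end SmoothPrincipalBundle.LocalGauge

/-! ### Unimodularity of the adjoint action -/

section Determinant

variable {n : ℕ} (E : Module.Basis (Fin n) ℝ (GroupLieAlgebra 𝓘(ℝ, EG) G))

/-- The determinant with respect to a basis as a continuous multilinear map. -/
noncomputable def continuousDet : ContinuousMultilinearMap ℝ (fun _ : Fin n => EG) ℝ :=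
  let E' : Module.Basis (Fin n) ℝ EG := E
  { E'.det.toMultilinearMap with
    cont := by
      change Continuous fun v => E'.det v
      simp only [Module.Basis.det_apply]
      refine Continuous.matrix_det (continuous_matrix fun i j => ?_)
      exact (LinearMap.continuous_of_finiteDimensional (E'.coord i)).comp (continuous_apply j) }

/-- This is Cartan's criterion: the Killing form of a semisimple real Lie algebra is nondegenerate.
-/
theorem killing_det_ne_zero (hss : LieAlgebra.IsSemisimple ℝ (GroupLieAlgebra 𝓘(ℝ, EG) G)) :
    (LinearMap.BilinForm.toMatrix E (killingForm ℝ (GroupLieAlgebra 𝓘(ℝ, EG) G))).det ≠ 0 := by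
  have : Module.Finite ℝ (GroupLieAlgebra 𝓘(ℝ, EG) G) := Module.Finite.of_basis E
  rw [← LinearMap.BilinForm.nondegenerate_iff_det_ne_zero E]
  exact LieAlgebra.IsKilling.killingForm_nondegenerate ℝ _

theorem continuous_det_adjointRep :
    Continuous fun g : G => E.det fun a => adjointRep g (E a) :=
  (continuousDet E).cont.comp
    (continuous_pi fun a => (contMDiff_adjointRep_apply (E a)).continuous)

/-- `Ad_g` is an automorphism and so preserves the Killing form. Take determinants in `Aᵀ K A = K`
and cancel `det K ≠ 0`. -/
theorem det_adjointRep_sq {n : ℕ} (E : Module.Basis (Fin n) ℝ (GroupLieAlgebra 𝓘(ℝ, EG) G))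
    (hss : LieAlgebra.IsSemisimple ℝ (GroupLieAlgebra 𝓘(ℝ, EG) G)) (g : G) :
    LinearMap.det (adjointRep (EG := EG) g) * LinearMap.det (adjointRep (EG := EG) g) = 1 := by
  set K := LinearMap.BilinForm.toMatrix E (killingForm ℝ (GroupLieAlgebra 𝓘(ℝ, EG) G)) with hK
  have h1 := LinearMap.BilinForm.toMatrix_comp E E (killingForm ℝ (GroupLieAlgebra 𝓘(ℝ, EG) G))
    (adjointRep g) (adjointRep g)
  have h2 : (killingForm ℝ (GroupLieAlgebra 𝓘(ℝ, EG) G)).comp (adjointRep g) (adjointRep g) =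
      killingForm ℝ (GroupLieAlgebra 𝓘(ℝ, EG) G) := by
    refine LinearMap.ext fun v => LinearMap.ext fun w => ?_
    have h := LieAlgebra.killingForm_of_equiv_apply (adjointEquiv g) v w
    rw [adjointEquiv_apply, adjointEquiv_apply] at h
    rw [LinearMap.BilinForm.comp_apply]
    exact h
  rw [h2, ← hK] at h1
  have h3 := congrArg Matrix.det h1
  rw [Matrix.det_mul, Matrix.det_mul, Matrix.det_transpose, LinearMap.det_toMatrix] at h3
  have h4 : K.det ≠ 0 := killing_det_ne_zero E hss
  apply mul_right_cancel₀ h4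
  linear_combination -h3

/-- The adjoint action of a connected semisimple group preserves the volume. -/
theorem det_adjointRep [ConnectedSpace G]
    (hss : LieAlgebra.IsSemisimple ℝ (GroupLieAlgebra 𝓘(ℝ, EG) G)) (g : G)
    (v : Fin n → GroupLieAlgebra 𝓘(ℝ, EG) G) :
    E.det (fun a => adjointRep g (v a)) = E.det v := by
  have hd : ∀ g : G, E.det (fun a => adjointRep g (E a)) = LinearMap.det (adjointRep (EG := EG) g) := by
    intro g
    have := E.det_comp (adjointRep g) E
    rw [E.det_self, mul_one] at this
    exact this
  have hc : Continuous fun g : G => LinearMap.det (adjointRep (EG := EG) g) := by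
    simpa only [hd] using continuous_det_adjointRep E
  have hsq : ∀ g : G, LinearMap.det (adjointRep (EG := EG) g) = 1 ∨
      LinearMap.det (adjointRep (EG := EG) g) = -1 :=
    fun g => mul_self_eq_one_iff.1 (det_adjointRep_sq E hss g)
  have h1 : LinearMap.det (adjointRep (EG := EG) (1 : G)) = 1 := by
    have : adjointRep (EG := EG) (1 : G) = LinearMap.id := LinearMap.ext adjointRep_one
    rw [this, LinearMap.det_id]
  have hg : LinearMap.det (adjointRep (EG := EG) g) = 1 := by
    rcases hsq g with h | h
    · exact h
    -- If the determinant were `-1` at `g`, being `1` at the identity it would vanish somewhere on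
    -- the connected group, although its square is `1`.
    · obtain ⟨z, hz⟩ := mem_range_of_exists_le_of_exists_ge hc ⟨g, h.le.trans (by norm_num)⟩
        ⟨1, (zero_le_one.trans h1.ge : (0 : ℝ) ≤ _)⟩
      have hz' : LinearMap.det (adjointRep (EG := EG) z) = 0 := hz
      rcases hsq z with h | h <;> rw [hz'] at h <;> norm_num at h
  have := E.det_comp (adjointRep g) v
  rw [hg, one_mul] at this
  exact this

end Determinant

/-! ### The volume form of the adjoint bundle -/

namespace SmoothPrincipalBundle

variable (B : SmoothPrincipalBundle EM M EG G EP P) {n : ℕ}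
  (E : Module.Basis (Fin n) ℝ (GroupLieAlgebra 𝓘(ℝ, EG) G))

/-- `Ψ` followed by evaluation at a point over `x` is an automorphism of `𝔤`, hence preserves the
Killing form. The matrix therefore depends neither on `x` nor on `Ψ`, which is the first claim and
makes `√|h|` a global constant. -/
theorem localMatrix_killingMetric {x : M}
    (Ψ : GroupLieAlgebra 𝓘(ℝ, EG) G ≃ₗ⁅ℝ⁆ B.adFiber x) : B.killingMetric.localMatrix E Ψ =
      LinearMap.BilinForm.toMatrix E (killingForm ℝ (GroupLieAlgebra 𝓘(ℝ, EG) G)) := by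
  obtain ⟨p, rfl⟩ := B.exists_proj_eq x
  ext a b
  rw [LinearMap.BilinForm.toMatrix_apply,
    ← LieAlgebra.killingForm_of_equiv_apply (Ψ.trans (B.fiberEquiv p))]
  exact B.killingFiber_apply _ _ ⟨p, rfl⟩

variable {E} (hE : ∀ (g : G) v, E.det (fun a => adjointRep g (v a)) = E.det v)

/-- Two points of a fibre differ by some `g`, and the values of the sections by `Ad_{g⁻¹}`, which
preserves the determinant. So the determinant descends to the base. -/
theorem det_point (hE : ∀ (g : G) v, E.det (fun a => adjointRep g (v a)) = E.det v)
    (γ : Fin n → B.adSections) (p : P) :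
    E.det (fun a => (γ a).1 (B.point (B.proj p))) = E.det fun a => (γ a).1 p := by
  obtain ⟨g, hg⟩ := B.exists_act_eq (B.proj_point (B.proj p)).symm
  rw [← hg]
  simp only [(γ _).2.2]
  exact hE _ _

/-- The function `det (γ_1, …, γ_n)` on the base. -/
noncomputable def volumeFun (γ : Fin n → B.adSections) : SmoothFun EM M ℝ :=
  ⟨fun x => E.det fun a => (γ a).1 (B.point x), by
    intro x
    obtain ⟨U, hU, hx, s, hs, hps⟩ := B.exists_section x
    have h1 : ContMDiff 𝓘(ℝ, EP) 𝓘(ℝ, Fin n → EG) ∞ (fun p a => B.adFun (γ a) p) :=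
      contMDiff_pi_space.2 fun a => (B.adFun (γ a)).contMDiff
    have h2 : ContMDiff 𝓘(ℝ, EP) 𝓘(ℝ, ℝ) ∞ (fun p => continuousDet E fun a => B.adFun (γ a) p) :=
      (continuousDet E).contDiff.contMDiff.comp h1
    refine ((h2.comp_contMDiffOn hs).congr fun y hy => ?_).contMDiffAt (hU.mem_nhds hx)
    have := B.det_point hE γ (s y)
    rw [hps y hy] at this
    exact this⟩

theorem volumeFun_apply (γ : Fin n → B.adSections) (p : P) :
    B.volumeFun hE γ (B.proj p) = E.det fun a => (γ a).1 p := B.det_point hE γ p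

theorem update_val_apply {κ : Type*} [DecidableEq κ] (γ : κ → B.adSections) (a : κ)
    (v : B.adSections) (p : P) : (fun b => (Function.update γ a v b).1 p) =
      Function.update (fun b => (γ b).1 p) a (v.1 p) := by
  ext1 b
  by_cases hb : b = a
  · subst hb; simp
  · simp [hb]

theorem volumeFun_update_add (γ : Fin n → B.adSections) (a : Fin n) (v w : B.adSections) :
    B.volumeFun hE (Function.update γ a (v + w)) =
      B.volumeFun hE (Function.update γ a v) + B.volumeFun hE (Function.update γ a w) := by
  refine ContMDiffMap.ext fun x => ?_
  obtain ⟨p, rfl⟩ := B.exists_proj_eq x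
  have h : B.volumeFun hE (Function.update γ a (v + w)) (B.proj p) =
      B.volumeFun hE (Function.update γ a v) (B.proj p) +
        B.volumeFun hE (Function.update γ a w) (B.proj p) := by
    rw [volumeFun_apply, volumeFun_apply, volumeFun_apply, update_val_apply, update_val_apply,
      update_val_apply]
    exact E.det.map_update_add (fun b => (γ b).1 p) a (v.1 p) (w.1 p)
  exact h

theorem volumeFun_update_smul (γ : Fin n → B.adSections) (a : Fin n)
    (f : SmoothFun EM M ℝ) (v : B.adSections) :
    B.volumeFun hE (Function.update γ a (f • v)) = f • B.volumeFun hE (Function.update γ a v) := by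
  refine ContMDiffMap.ext fun x => ?_
  obtain ⟨p, rfl⟩ := B.exists_proj_eq x
  have h : B.volumeFun hE (Function.update γ a (f • v)) (B.proj p) =
      f (B.proj p) * B.volumeFun hE (Function.update γ a v) (B.proj p) := by
    rw [volumeFun_apply, volumeFun_apply, update_val_apply, update_val_apply]
    exact E.det.map_update_smul (fun b => (γ b).1 p) a (f (B.proj p)) (v.1 p)
  exact h

/-- The map `det (γ_1, …, γ_n)` as an alternating form on the sections of the adjoint bundle. -/
noncomputable def volume : B.adSections [⋀^Fin n]→ₗ[SmoothFun EM M ℝ] SmoothFun EM M ℝ where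
  toFun := B.volumeFun hE
  map_update_add' := fun {inst} γ a v w => by
    obtain rfl := Subsingleton.elim inst (instDecidableEqFin n)
    exact B.volumeFun_update_add hE γ a v w
  map_update_smul' := fun {inst} γ a f v => by
    obtain rfl := Subsingleton.elim inst (instDecidableEqFin n)
    exact B.volumeFun_update_smul hE γ a f v
  map_eq_zero_of_eq' γ a b hab hne := by
    ext x
    exact E.det.map_eq_zero_of_eq _ (congrArg (fun v : B.adSections => v.1 (B.point x)) hab) hne

theorem volume_apply (γ : Fin n → B.adSections) (p : P) :
    B.volume hE γ (B.proj p) = E.det fun a => (γ a).1 p := B.volumeFun_apply hE γ p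

/-- Pulled back to `P`, the volume is a multilinear map with constant coefficients applied to
`𝔤`-valued functions, so this is the Leibniz rule. For vertical `X` the left side is zero, and the
identity expresses that `ad` is traceless. -/
theorem lie_volume (X : B.Atiyah) (γ : Fin n → B.adSections) :
    ⁅X, B.volume hE γ⁆ = ∑ a, B.volume hE (Function.update γ a (B.adDeriv X (γ a))) := by
  apply B.pullback_injective
  rw [B.pullback_bracket]
  ext p
  have hγ : ContMDiff 𝓘(ℝ, EP) 𝓘(ℝ, Fin n → EG) ∞ (fun p a => B.adFun (γ a) p) :=
    contMDiff_pi_space.2 fun a => (B.adFun (γ a)).contMDiff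
  have hγd := hγ.mdifferentiable (by simp) p
  have h1 : ∀ q, B.pullback (B.volume hE γ) q = continuousDet E fun a => B.adFun (γ a) q :=
    fun q => B.volume_apply hE γ q
  have h2 : ⁅X.1, B.pullback (B.volume hE γ)⁆ p =
      mvfderiv 𝓘(ℝ, EP) (fun q => continuousDet E fun a => B.adFun (γ a) q) p (X.1 p) :=
    mvfderiv_congr_of_eventuallyEq (Filter.Eventually.of_forall h1) _
  have h3 := mvfderiv_comp_apply' (f := continuousDet E)
    ((continuousDet E).contDiff.contMDiff (n := ∞) |>.mdifferentiableAt (by simp)) hγd (X.1 p)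
  have hF := (continuousDet E).hasFDerivAt (fun a => (B.adFun (γ a) p : EG))
  have h4 : (mfderiv 𝓘(ℝ, EP) 𝓘(ℝ, Fin n → EG) (fun p a => B.adFun (γ a) p) p (X.1 p) : Fin n → EG) =
      fun a => ((B.adDeriv X (γ a)).1 p : EG) := by
    funext a
    exact (mvfderiv_clm_comp (ContinuousLinearMap.proj (R := ℝ) (φ := fun _ : Fin n => EG) a)
      hγd (X.1 p)).symm
  rw [h2, h3]
  refine (DFunLike.congr_fun (mfderiv_eq_fderiv (f := continuousDet E)) _).trans ?_
  rw [hF.fderiv]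
  refine (DFunLike.congr_arg _ h4).trans ?_
  refine (ContinuousMultilinearMap.linearDeriv_apply (continuousDet E)
    (fun a => (B.adFun (γ a) p : EG)) (fun a => ((B.adDeriv X (γ a)).1 p : EG))).trans ?_
  have h5 : ∀ s : Finset (Fin n), (∑ a ∈ s, B.volume hE (Function.update γ a (B.adDeriv X (γ a))))
      (B.proj p) = ∑ a ∈ s, B.volume hE (Function.update γ a (B.adDeriv X (γ a))) (B.proj p) := by
    intro s
    induction s using Finset.induction_on with
    | empty => rfl
    | insert a s ha ih => rw [Finset.sum_insert ha, Finset.sum_insert ha, ← ih]; rfl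
  refine Eq.trans ?_ (h5 _).symm
  refine Finset.sum_congr rfl fun a _ => ?_
  rw [volume_apply, update_val_apply]
  rfl

end SmoothPrincipalBundle

/-- Evaluation of smooth functions at a point. -/
noncomputable def SmoothFun.evalAt {F : Type*} [NormedAddCommGroup F] [NormedSpace ℝ F] (x : M) :
    SmoothFun EM M F →+ F where
  toFun f := f x
  map_zero' := rfl
  map_add' _ _ := rfl

/-! ### Forms on the adjoint bundle are tensorial -/

namespace SmoothPrincipalBundle

variable {B : SmoothPrincipalBundle EM M EG G EP P} {n : ℕ} [T2Space M]
  {F : Type*} [NormedAddCommGroup F] [NormedSpace ℝ F] {κ : Type*} [Finite κ]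

/-- Forms on the adjoint bundle vanish where an argument vanishes. -/
theorem adForm_apply_eq_zero (E : Module.Basis (Fin n) ℝ (GroupLieAlgebra 𝓘(ℝ, EG) G))
    (f : B.adSections [⋀^κ]→ₗ[SmoothFun EM M ℝ] SmoothFun EM M F)
    {p : P} (γ : κ → B.adSections) (i : κ) (h : (γ i).1 p = 0) :
    f γ (B.proj p) = 0 := by
  classical
  obtain ⟨Λ⟩ := B.nonempty_localGauge p
  -- Multiplied by `χ²`, which is `1` at the point, the argument is a combination of the frame with
  -- coefficients vanishing at the point.
  have h1 : f (Function.update γ i (∑ a, Λ.coord E (γ i) a • Λ.frame (E a))) =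
      (Λ.χ * Λ.χ) • f γ := by
    rw [Λ.sum_coord_smul_frame, f.map_update_smul, Function.update_eq_self]
  rw [f.map_update_sum] at h1
  have h2 : (Λ.χ * Λ.χ) (B.proj p) • f γ (B.proj p) = f γ (B.proj p) := by
    have : (Λ.χ * Λ.χ) (B.proj p) = 1 := by
      change Λ.χ (B.proj p) * Λ.χ (B.proj p) = 1
      rw [Λ.χ_self, one_mul]
    rw [this, one_smul]
  have h3 := congrArg (SmoothFun.evalAt (B.proj p)) h1
  rw [map_sum] at h3
  refine h2.symm.trans (h3.symm.trans (Finset.sum_eq_zero fun a _ => ?_))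
  rw [f.map_update_smul]
  change Λ.coord E (γ i) a (B.proj p) • _ = (0 : F)
  rw [Λ.coord_eq_zero E h, zero_smul]

/-- The values of forms on the adjoint bundle only depend on the values of the arguments. -/
theorem adForm_apply_congr (E : Module.Basis (Fin n) ℝ (GroupLieAlgebra 𝓘(ℝ, EG) G))
    (f : B.adSections [⋀^κ]→ₗ[SmoothFun EM M ℝ] SmoothFun EM M F)
    {p : P} {γ γ' : κ → B.adSections} (h : ∀ i, (γ i).1 p = (γ' i).1 p) :
    f γ (B.proj p) = f γ' (B.proj p) := by
  let K : AddSubgroup B.adSections :=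
    { carrier := {v | v.1 p = 0}
      add_mem' := fun {v w} hv hw => by
        change v.1 p + w.1 p = 0
        rw [show v.1 p = 0 from hv, show w.1 p = 0 from hw, add_zero]
      zero_mem' := rfl
      neg_mem' := fun {v} hv => by
        change -(v.1 p) = 0
        rw [show v.1 p = 0 from hv, neg_zero] }
  refine f.toMultilinearMap.apply_congr_of_sub_mem (SmoothFun.evalAt (B.proj p)) K
    (fun m i hm => adForm_apply_eq_zero E f m i hm) fun i => ?_
  change (γ i).1 p - (γ' i).1 p = 0
  rw [h i, sub_self]

/-- The value of a form on the adjoint bundle at a point. -/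
noncomputable def adFormAt (E : Module.Basis (Fin n) ℝ (GroupLieAlgebra 𝓘(ℝ, EG) G))
    (f : B.adSections [⋀^κ]→ₗ[SmoothFun EM M ℝ] SmoothFun EM M F)
    (p : P) : GroupLieAlgebra 𝓘(ℝ, EG) G [⋀^κ]→ₗ[ℝ] F :=
  let Λ := (B.nonempty_localGauge p).some
  { toFun := fun w => f (fun i => Λ.frame (w i)) (B.proj p)
    map_update_add' := fun w i x y => by
      have hc : ∀ z, (fun j => Λ.frame (Function.update w i z j)) =
          Function.update (fun j => Λ.frame (w j)) i (Λ.frame z) :=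
        fun z => Function.comp_update Λ.frame w i z
      rw [hc, hc, hc]
      refine Eq.trans ?_ (congrArg (SmoothFun.evalAt (B.proj p)) (f.map_update_add _ i _ _))
      -- Only the values at `p` matter, so additivity of the frame is needed at that point alone.
      refine adForm_apply_congr E f fun j => ?_
      by_cases hj : j = i
      · subst hj
        simp only [Function.update_self, Λ.frame_self]
        exact ((congrArg₂ (· + ·) (Λ.frame_self x) (Λ.frame_self y))).symm
      · simp only [Function.update_of_ne hj]
    map_update_smul' := fun w i c x => by
      have hc : ∀ z, (fun j => Λ.frame (Function.update w i z j)) =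
          Function.update (fun j => Λ.frame (w j)) i (Λ.frame z) :=
        fun z => Function.comp_update Λ.frame w i z
      rw [hc, hc]
      let c' : SmoothFun EM M ℝ := ⟨fun _ => c, contMDiff_const⟩
      refine Eq.trans ?_ (congrArg (SmoothFun.evalAt (B.proj p)) (f.map_update_smul _ i c' _))
      refine adForm_apply_congr E f fun j => ?_
      by_cases hj : j = i
      · subst hj
        simp only [Function.update_self, Λ.frame_self]
        exact (congrArg (c • ·) (Λ.frame_self x)).symm
      · simp only [Function.update_of_ne hj]
    map_eq_zero_of_eq' := fun w i j h hij =>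
      congrArg (SmoothFun.evalAt (B.proj p)) (f.map_eq_zero_of_eq _ (congrArg Λ.frame h) hij) }

theorem adForm_apply (E : Module.Basis (Fin n) ℝ (GroupLieAlgebra 𝓘(ℝ, EG) G))
    (f : B.adSections [⋀^κ]→ₗ[SmoothFun EM M ℝ] SmoothFun EM M F)
    (γ : κ → B.adSections) (p : P) :
    f γ (B.proj p) = adFormAt E f p fun i => (γ i).1 p :=
  adForm_apply_congr E f fun _ => (LocalGauge.frame_self _ _).symm

/-- Forms on the adjoint bundle of degree greater than its rank vanish. -/
theorem adForm_eq_zero (E : Module.Basis (Fin n) ℝ (GroupLieAlgebra 𝓘(ℝ, EG) G))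
    (f : B.adSections [⋀^κ]→ₗ[SmoothFun EM M ℝ] SmoothFun EM M F)
    [Fintype κ] (h : n < Fintype.card κ) : f = 0 := by
  have := Module.Finite.of_basis E
  ext γ x
  obtain ⟨p, rfl⟩ := B.exists_proj_eq x
  rw [adForm_apply E]
  refine (adFormAt E f p).map_linearDependent _ fun hli => ?_
  have := hli.fintype_card_le_finrank
  rw [Module.finrank_eq_card_basis E, Fintype.card_fin] at this
  omega

/-- At every point a form of top degree on `𝔤` is a multiple of the determinant. The
cross-multiplied version avoids division by volumes, which may vanish. -/
theorem volume_smul_adForm {E : Module.Basis (Fin n) ℝ (GroupLieAlgebra 𝓘(ℝ, EG) G)}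
    (hE : ∀ (g : G) v, E.det (fun a => adjointRep g (v a)) = E.det v)
    (f : B.adSections [⋀^Fin n]→ₗ[SmoothFun EM M ℝ] SmoothFun EM M F)
    (γ γ' : Fin n → B.adSections) : B.volume hE γ' • f γ = B.volume hE γ • f γ' := by
  refine ContMDiffMap.ext fun x => ?_
  obtain ⟨p, rfl⟩ := B.exists_proj_eq x
  have h : ∀ w, adFormAt E f p w = E.det w • adFormAt E f p E := by
    let β : GroupLieAlgebra 𝓘(ℝ, EG) G [⋀^Fin n]→ₗ[ℝ] F :=
      (LinearMap.toSpanSingleton ℝ F (adFormAt E f p E)).compAlternatingMap E.det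
    have : adFormAt E f p = β := by
      refine Module.Basis.ext_alternating E fun v hv => ?_
      obtain ⟨σ, rfl⟩ : ∃ σ : Equiv.Perm (Fin n), v = σ :=
        ⟨Equiv.ofBijective v (Finite.injective_iff_bijective.1 hv), rfl⟩
      change adFormAt E f p (E ∘ σ) = E.det (E ∘ σ) • _
      rw [AlternatingMap.map_perm, AlternatingMap.map_perm, E.det_self, smul_assoc, one_smul]
    exact fun w => DFunLike.congr_fun this w
  have h' : B.volume hE γ' (B.proj p) • f γ (B.proj p) =
      B.volume hE γ (B.proj p) • f γ' (B.proj p) := by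
    rw [volume_apply, volume_apply, adForm_apply E f γ, adForm_apply E f γ', h, h (fun i => (γ' i).1 p),
      smul_comm]
  exact h'

end SmoothPrincipalBundle

/-! ### Splitting the arguments into the first `r` and the last `n` -/

section AppendSlots

variable {R A V : Type*} [CommRing R] [AddCommGroup A] [Module R A] [AddCommGroup V] [Module R V]
  {r n : ℕ}

theorem Fin.extend_castAdd {A : Type*} {r n : ℕ} (X X' : Fin r → A) (Z : Fin n → A) :
    Function.extend (Fin.castAdd n) X (Fin.append X' Z) = Fin.append X Z := by
  funext i
  refine Fin.addCases (fun i => ?_) (fun i => ?_) i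
  · rw [(Fin.castAdd_injective r n).extend_apply, Fin.append_left]
  · rw [Function.extend_apply', Fin.append_right, Fin.append_right]
    rintro ⟨j, hj⟩
    have := congrArg Fin.val hj
    simp at this
    omega

theorem Fin.extend_natAdd {A : Type*} {r n : ℕ} (X : Fin r → A) (Z Z' : Fin n → A) :
    Function.extend (Fin.natAdd r) Z (Fin.append X Z') = Fin.append X Z := by
  funext i
  refine Fin.addCases (fun i => ?_) (fun i => ?_) i
  · rw [Function.extend_apply', Fin.append_left, Fin.append_left]
    rintro ⟨j, hj⟩
    have := congrArg Fin.val hj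
    simp at this
    omega
  · rw [(Fin.natAdd_injective n r).extend_apply, Fin.append_right]

/-- An alternating map as a function of its first arguments. -/
noncomputable def AlternatingMap.leftSlots (ϖ : A [⋀^Fin (r + n)]→ₗ[R] V) (Z : Fin n → A) :
    A [⋀^Fin r]→ₗ[R] V :=
  ϖ.extendSlots (Fin.castAdd_injective r n) (Fin.append 0 Z)

theorem AlternatingMap.leftSlots_apply (ϖ : A [⋀^Fin (r + n)]→ₗ[R] V) (Z : Fin n → A)
    (X : Fin r → A) : ϖ.leftSlots Z X = ϖ (Fin.append X Z) :=
  congrArg ϖ (Fin.extend_castAdd _ _ _)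

/-- An alternating map as a function of its last arguments. -/
noncomputable def AlternatingMap.rightSlots (ϖ : A [⋀^Fin (r + n)]→ₗ[R] V) (X : Fin r → A) :
    A [⋀^Fin n]→ₗ[R] V :=
  ϖ.extendSlots (Fin.natAdd_injective n r) (Fin.append X 0)

theorem AlternatingMap.rightSlots_apply (ϖ : A [⋀^Fin (r + n)]→ₗ[R] V) (X : Fin r → A)
    (Z : Fin n → A) : ϖ.rightSlots X Z = ϖ (Fin.append X Z) :=
  congrArg ϖ (Fin.extend_natAdd _ _ _)

end AppendSlots

/-! ### Forms on the algebroid with many vertical arguments -/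

namespace SmoothPrincipalBundle

variable {B : SmoothPrincipalBundle EM M EG G EP P} {n : ℕ}
  {F : Type*} [NormedAddCommGroup F] [NormedSpace ℝ F]

section Volume

variable {E : Module.Basis (Fin n) ℝ (GroupLieAlgebra 𝓘(ℝ, EG) G)}
  (hE : ∀ (g : G) v, E.det (fun a => adjointRep g (v a)) = E.det v) (c : ℝ)

/-- The constant functions. -/
noncomputable def constFun (EM : Type*) [NormedAddCommGroup EM] [NormedSpace ℝ EM]
    [FiniteDimensional ℝ EM] (M : Type*) [TopologicalSpace M] [ChartedSpace EM M]
    [IsManifold 𝓘(ℝ, EM) ∞ M] (c : F) : SmoothFun EM M F :=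
  ⟨fun _ => c, contMDiff_const⟩

theorem lie_constFun (X : B.Atiyah) : ⁅X, constFun EM M c⁆ = 0 := by
  apply B.pullback_injective
  rw [B.pullback_bracket]
  ext p
  change mvfderiv 𝓘(ℝ, EP) (fun _ : P => c) p (X.1 p) = 0
  exact DFunLike.congr_fun (mfderiv_const (I := 𝓘(ℝ, EP)) (I' := 𝓘(ℝ, ℝ)) (c := c) (x := p)) _

/-- A constant multiple of the volume form. -/
noncomputable def innerVolume : B.adSections [⋀^Fin n]→ₗ[SmoothFun EM M ℝ] SmoothFun EM M ℝ :=
  constFun EM M c • B.volume hE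

theorem innerVolume_eq (γ : Fin n → B.adSections) :
    innerVolume (B := B) hE c γ = constFun EM M c • B.volume hE γ := rfl

theorem innerVolume_apply (γ : Fin n → B.adSections) (p : P) :
    innerVolume hE c γ (B.proj p) = c * E.det fun a => (γ a).1 p :=
  congrArg (c * ·) (B.volume_apply hE γ p)

theorem innerVolume_frame (p : P) (Λ : B.LocalGauge p) :
    innerVolume hE c (fun a => Λ.frame (E a)) (B.proj p) = c := by
  rw [innerVolume_apply]
  simp only [Λ.frame_self]
  rw [E.det_self, mul_one]

theorem lie_innerVolume (X : B.Atiyah) (γ : Fin n → B.adSections) :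
    ⁅X, innerVolume hE c γ⁆ =
      ∑ a, innerVolume hE c (Function.update γ a (B.adDeriv X (γ a))) := by
  simp only [innerVolume_eq]
  rw [LieRinehartModule.lie_smul' (R := SmoothFun EM M ℝ), lie_constFun, zero_smul, add_zero,
    lie_volume, Finset.smul_sum]

theorem innerVolume_smul_adForm [T2Space M]
    (f : B.adSections [⋀^Fin n]→ₗ[SmoothFun EM M ℝ] SmoothFun EM M F)
    (γ γ' : Fin n → B.adSections) : innerVolume hE c γ' • f γ = innerVolume hE c γ • f γ' := by
  rw [innerVolume_eq, innerVolume_eq, smul_assoc, smul_assoc, volume_smul_adForm hE f γ γ']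

end Volume

variable [T2Space M]

/-- Forms on the algebroid vanish on more than `n` vertical arguments. -/
theorem lieForm_eq_zero_of_vertical (E : Module.Basis (Fin n) ℝ (GroupLieAlgebra 𝓘(ℝ, EG) G))
    {I κ : Type*} [Fintype κ] (h : n < Fintype.card κ)
    (α : B.Atiyah [⋀^I]→ₗ[SmoothFun EM M ℝ] SmoothFun EM M F) {s : κ → I}
    (hs : Function.Injective s) (m : I → B.Atiyah) (γ : κ → B.adSections)
    (hm : ∀ k, m (s k) = B.ι (γ k)) : α m = 0 := by
  -- With the other slots fixed, the slots in the range of `s` carry a form on the adjoint bundle of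
  -- degree greater than its rank.
  have h1 := DFunLike.congr_fun
    (adForm_eq_zero E ((α.extendSlots hs m).compLinearMap B.ιₗ) h) γ
  refine Eq.trans (congrArg α ?_) h1
  funext i
  by_cases hi : ∃ k, s k = i
  · obtain ⟨k, rfl⟩ := hi
    rw [hs.extend_apply, hm]
    rfl
  · rw [Function.extend_apply' _ _ _ hi]

variable {r : ℕ}

/-- With `n` vertical arguments, the remaining ones only matter through their anchors. -/
theorem lieForm_append_congr (E : Module.Basis (Fin n) ℝ (GroupLieAlgebra 𝓘(ℝ, EG) G))
    (α : B.Atiyah [⋀^Fin (r + n)]→ₗ[SmoothFun EM M ℝ] SmoothFun EM M F)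
    {X X' : Fin r → B.Atiyah} (γ : Fin n → B.adSections)
    (h : ∀ i, B.anchor (X i) = B.anchor (X' i)) :
    α (Fin.append X fun a => B.ι (γ a)) = α (Fin.append X' fun a => B.ι (γ a)) := by
  refine ContMDiffMap.ext fun x => ?_
  obtain ⟨p, rfl⟩ := B.exists_proj_eq x
  obtain ⟨Λ⟩ := B.nonempty_localGauge p
  set f := α.leftSlots fun a => B.ι (γ a) with hf
  have key : SmoothFun.evalAt (B.proj p) (f X) = SmoothFun.evalAt (B.proj p) (f X') := by
    refine f.toMultilinearMap.apply_congr_of_sub_mem (SmoothFun.evalAt (B.proj p))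
      (LinearMap.ker B.anchorₗ).toAddSubgroup (fun m i hm => ?_) fun i => ?_
    · have hm' : B.anchor (m i) = 0 := hm
      -- Up to the cutoff, an element with zero anchor is vertical, so that `n + 1` arguments become
      -- vertical.
      have h1 : Λ.χ • m i = B.ι (Λ.vert (m i)) := by
        rw [← Λ.lift_anchor_add_ι_vert, hm', map_zero, zero_add]
      have h2 : f (Function.update m i (Λ.χ • m i)) = Λ.χ • f m := by
        rw [f.map_update_smul, Function.update_eq_self]
      have h3 : f (Function.update m i (Λ.χ • m i)) = 0 := by
        rw [h1, hf, AlternatingMap.leftSlots_apply]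
        -- `none` marks the additional vertical slot `i`, `some a` the last `n` slots.
        let s : Option (Fin n) → Fin (r + n) := fun o => o.elim (Fin.castAdd n i) (Fin.natAdd r)
        have hs : Function.Injective s := by
          rintro (_ | a) (_ | b) hab
          · rfl
          · have := congrArg Fin.val hab
            simp [s] at this
            omega
          · have := congrArg Fin.val hab
            simp [s] at this
            omega
          · exact congrArg some (Fin.natAdd_injective n r hab)
        refine lieForm_eq_zero_of_vertical E (by simp) α hs _
          (fun o => o.elim (Λ.vert (m i)) γ) ?_
        rintro (_ | a)
        · simp [s]
        · simp [s]
      have h4 : Λ.χ (B.proj p) • f m (B.proj p) = 0 :=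
        congrArg (SmoothFun.evalAt (B.proj p)) (h2.symm.trans h3)
      rwa [Λ.χ_self, one_smul] at h4
    · change B.anchorₗ (X i - X' i) = 0
      rw [map_sub, B.anchorₗ_apply, B.anchorₗ_apply, h i, sub_self]
  rw [hf, AlternatingMap.leftSlots_apply, AlternatingMap.leftSlots_apply] at key
  exact key

end SmoothPrincipalBundle

/-- By multilinearity a power of `χ` comes out, which is `1` at `x`: cutoffs do not affect the value
at the points where they are `1`. -/
theorem SmoothFun.map_smul_univ_apply {A F : Type*} [NormedAddCommGroup F] [NormedSpace ℝ F]
    [AddCommGroup A] [Module (SmoothFun EM M ℝ) A] {r : ℕ}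
    (f : A [⋀^Fin r]→ₗ[SmoothFun EM M ℝ] SmoothFun EM M F) (χ : SmoothFun EM M ℝ) {x : M}
    (hx : χ x = 1) (m : Fin r → A) : f (fun i => χ • m i) x = f m x := by
  have h1 : f (fun i => χ • m i) = (∏ _i : Fin r, χ) • f m :=
    f.toMultilinearMap.map_smul_univ (fun _ => χ) m
  have h2 : ∀ k : ℕ, (χ ^ k) x = 1 := by
    intro k
    induction k with
    | zero => rw [pow_zero]; rfl
    | succ k ih =>
      rw [pow_succ]
      change (χ ^ k) x * χ x = 1
      rw [ih, hx, one_mul]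
  rw [h1, Finset.prod_const]
  change (χ ^ _) x • f m x = f m x
  rw [h2, one_smul]

/-! ### Existence and uniqueness of the factor of the volume form -/

namespace SmoothPrincipalBundle

variable {B : SmoothPrincipalBundle EM M EG G EP P} {n r : ℕ}
  {F : Type*} [NormedAddCommGroup F] [NormedSpace ℝ F]

/-- The form `η` on the base is the factor of the volume form `ν` of the fibres in `α`. -/
def IsFactor (ν : B.adSections [⋀^Fin n]→ₗ[SmoothFun EM M ℝ] SmoothFun EM M ℝ)
    (α : B.Atiyah [⋀^Fin (r + n)]→ₗ[SmoothFun EM M ℝ] SmoothFun EM M F)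
    (η : VF EM M [⋀^Fin r]→ₗ[SmoothFun EM M ℝ] SmoothFun EM M F) : Prop :=
  ∀ (X : Fin r → B.Atiyah) (γ : Fin n → B.adSections),
    α (Fin.append X fun a => B.ι (γ a)) = ν γ • η fun i => B.anchor (X i)

variable [T2Space M] {E : Module.Basis (Fin n) ℝ (GroupLieAlgebra 𝓘(ℝ, EG) G)}
  (hE : ∀ (g : G) v, E.det (fun a => adjointRep g (v a)) = E.det v) {c : ℝ}

/-- A local expression for the factor of the volume form. -/
noncomputable def LocalGauge.factor {p : P} (Λ : B.LocalGauge p)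
    (E : Module.Basis (Fin n) ℝ (GroupLieAlgebra 𝓘(ℝ, EG) G))
    (α : B.Atiyah [⋀^Fin (r + n)]→ₗ[SmoothFun EM M ℝ] SmoothFun EM M F) :
    VF EM M [⋀^Fin r]→ₗ[SmoothFun EM M ℝ] SmoothFun EM M F :=
  (α.leftSlots fun a => B.ι (Λ.frame (E a))).compLinearMap Λ.lift

theorem LocalGauge.factor_apply {p : P} (Λ : B.LocalGauge p)
    (α : B.Atiyah [⋀^Fin (r + n)]→ₗ[SmoothFun EM M ℝ] SmoothFun EM M F) (Y : Fin r → VF EM M) :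
    Λ.factor E α Y = α (Fin.append (fun i => Λ.lift (Y i)) fun a => B.ι (Λ.frame (E a))) :=
  α.leftSlots_apply _ _

/-- In the vertical slots `α` is compared with its value on the frame, whose volume at `p` is `c`,
by proportionality of top-degree forms. The remaining arguments are then replaced by the lifts of
their anchors. -/
theorem LocalGauge.smul_apply_append {p : P} (Λ : B.LocalGauge p)
    (α : B.Atiyah [⋀^Fin (r + n)]→ₗ[SmoothFun EM M ℝ] SmoothFun EM M F)
    (X : Fin r → B.Atiyah) (γ : Fin n → B.adSections) :
    c • α (Fin.append X fun a => B.ι (γ a)) (B.proj p) = innerVolume hE c γ (B.proj p) •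
      Λ.factor E α (fun i => B.anchor (X i)) (B.proj p) := by
  have h1 := innerVolume_smul_adForm hE c ((α.rightSlots X).compLinearMap B.ιₗ) γ
    fun a => Λ.frame (E a)
  have h2 : ∀ γ : Fin n → B.adSections, ((α.rightSlots X).compLinearMap B.ιₗ) γ =
      α (Fin.append X fun a => B.ι (γ a)) := fun γ => α.rightSlots_apply X _
  rw [h2, h2] at h1
  have h3 : innerVolume hE c (fun a => Λ.frame (E a)) (B.proj p) •
      α (Fin.append X fun a => B.ι (γ a)) (B.proj p) = innerVolume hE c γ (B.proj p) •
      α (Fin.append X fun a => B.ι (Λ.frame (E a))) (B.proj p) :=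
    congrArg (SmoothFun.evalAt (B.proj p)) h1
  rw [innerVolume_frame] at h3
  have h4 := lieForm_append_congr E α (X := fun i => Λ.χ • X i)
    (X' := fun i => Λ.lift (B.anchor (X i))) (fun a => Λ.frame (E a)) fun i =>
      (B.anchorₗ.map_smul _ _).trans (Λ.anchor_lift _).symm
  rw [h3, Λ.factor_apply, ← h4, ← α.leftSlots_apply, ← α.leftSlots_apply,
    SmoothFun.map_smul_univ_apply _ _ Λ.χ_self]

/-- Every form on the algebroid of degree at least `n` has a factor. -/
theorem exists_isFactor (hc : c ≠ 0)
    (α : B.Atiyah [⋀^Fin (r + n)]→ₗ[SmoothFun EM M ℝ] SmoothFun EM M F) :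
    ∃ η, IsFactor (innerVolume hE c) α η := by
  -- A gauge is chosen for every point separately, so that the pointwise formula is evident but its
  -- smoothness is not. Near `x₀` it is compared with a quotient formed in the single gauge at `x₀`.
  let Λ : ∀ x : M, B.LocalGauge (B.point x) := fun x => (B.nonempty_localGauge _).some
  have hsm : ∀ Y : Fin r → VF EM M, ContMDiff 𝓘(ℝ, EM) 𝓘(ℝ, F) ∞
      fun x => c⁻¹ • (Λ x).factor E α Y x := by
    intro Y x₀
    set ν := innerVolume hE c fun a => (Λ x₀).frame (E a) with hν
    have hν0 : ν x₀ = c := by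
      have := innerVolume_frame hE c (B.point x₀) (Λ x₀)
      rwa [B.proj_point] at this
    have hχ : ∀ᶠ x in nhds x₀, (Λ x₀).χ x = 1 := by
      have := (Λ x₀).χ_one
      rwa [B.proj_point] at this
    have hνne : ∀ᶠ x in nhds x₀, ν x ≠ 0 :=
      ν.contMDiff.continuous.continuousAt.eventually_ne (hν0.trans_ne hc)
    have hg : ContMDiffAt 𝓘(ℝ, EM) 𝓘(ℝ, F) ∞
        (fun x => (ν x)⁻¹ • (Λ x₀).factor E α Y x) x₀ := by
      have h1 : ContMDiffAt 𝓘(ℝ, EM) 𝓘(ℝ, ℝ) ∞ (fun x => (ν x)⁻¹) x₀ :=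
        (ν.contMDiff.contMDiffAt (x := x₀)).inv₀ (hν0.trans_ne hc)
      exact h1.smul ((Λ x₀).factor E α Y).contMDiff.contMDiffAt
    refine hg.congr_of_eventuallyEq ?_
    filter_upwards [hχ, hνne] with x hx hνx
    -- The relation in the gauge at `x` is applied to lifts and frame of the gauge at `x₀`, whose
    -- cutoff is still `1` at `x`.
    have h1 := (Λ x).smul_apply_append hE (c := c) α (fun i => (Λ x₀).lift (Y i))
      fun a => (Λ x₀).frame (E a)
    simp only [(Λ x₀).anchor_lift] at h1
    rw [B.proj_point, SmoothFun.map_smul_univ_apply _ _ hx, ← (Λ x₀).factor_apply] at h1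
    rw [eq_inv_smul_iff₀ hνx, smul_comm, inv_smul_eq_iff₀ hc]
    exact h1.symm
  let η : VF EM M [⋀^Fin r]→ₗ[SmoothFun EM M ℝ] SmoothFun EM M F :=
    { toFun := fun Y => ⟨fun x => c⁻¹ • (Λ x).factor E α Y x, hsm Y⟩
      map_update_add' := fun Y i v w => ContMDiffMap.ext fun x =>
        (congrArg (fun f : SmoothFun EM M F => c⁻¹ • f x)
          (((Λ x).factor E α).map_update_add Y i v w)).trans (smul_add _ _ _)
      map_update_smul' := fun Y i f v => ContMDiffMap.ext fun x =>
        (congrArg (fun f : SmoothFun EM M F => c⁻¹ • f x)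
          (((Λ x).factor E α).map_update_smul Y i f v)).trans (smul_comm _ _ _)
      map_eq_zero_of_eq' := fun Y i j h hij => ContMDiffMap.ext fun x =>
        (congrArg (fun f : SmoothFun EM M F => c⁻¹ • f x)
          (((Λ x).factor E α).map_eq_zero_of_eq Y h hij)).trans (smul_zero _) }
  refine ⟨η, fun X γ => ContMDiffMap.ext fun x => ?_⟩
  have h1 := (Λ x).smul_apply_append hE (c := c) α X γ
  rw [B.proj_point] at h1
  change _ = innerVolume hE c γ x • c⁻¹ • (Λ x).factor E α (fun i => B.anchor (X i)) x
  rw [smul_comm, ← h1, inv_smul_smul₀ hc]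

/-- Lifts and frames of a gauge at `p` realize every tuple of base arguments at `π p` together with
the nonzero volume `c`, so the value of the factor there is forced. -/
theorem IsFactor.unique (hc : c ≠ 0)
    {α : B.Atiyah [⋀^Fin (r + n)]→ₗ[SmoothFun EM M ℝ] SmoothFun EM M F}
    {η η' : VF EM M [⋀^Fin r]→ₗ[SmoothFun EM M ℝ] SmoothFun EM M F}
    (h : IsFactor (innerVolume hE c) α η) (h' : IsFactor (innerVolume hE c) α η') : η = η' := by
  ext Y x
  obtain ⟨p, rfl⟩ := B.exists_proj_eq x
  obtain ⟨Λ⟩ := B.nonempty_localGauge p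
  have key : ∀ η, IsFactor (innerVolume hE c) α η → η Y (B.proj p) =
      c⁻¹ • Λ.factor E α Y (B.proj p) := by
    intro η hη
    have h1 := hη (fun i => Λ.lift (Y i)) fun a => Λ.frame (E a)
    rw [← Λ.factor_apply] at h1
    simp only [Λ.anchor_lift] at h1
    have h2 : Λ.factor E α Y (B.proj p) =
        innerVolume hE c (fun a => Λ.frame (E a)) (B.proj p) •
          η (fun i => Λ.χ • Y i) (B.proj p) := congrArg (SmoothFun.evalAt (B.proj p)) h1
    rw [h2, innerVolume_frame, SmoothFun.map_smul_univ_apply _ _ Λ.χ_self, inv_smul_smul₀ hc]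
  rw [key η h, key η' h']

theorem killing_sqrt_ne_zero (hss : LieAlgebra.IsSemisimple ℝ (GroupLieAlgebra 𝓘(ℝ, EG) G))
    (E : Module.Basis (Fin n) ℝ (GroupLieAlgebra 𝓘(ℝ, EG) G)) :
    √|(LinearMap.BilinForm.toMatrix E (killingForm ℝ (GroupLieAlgebra 𝓘(ℝ, EG) G))).det| ≠ 0 :=
  (Real.sqrt_pos.2 (abs_pos.2 (killing_det_ne_zero E hss))).ne'

/-- The metric coefficient is independent of the point, so the pointwise condition on `P` becomes an
identity of functions on `M` with a constant multiple of the volume. In this form it can be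
differentiated. -/
theorem isInnerIntegral_iff_isFactor {α : B.LieForm (r + n)} {η : BaseForm EM M r} :
    IsInnerIntegral B.killingMetric E α η ↔ IsFactor (innerVolume hE
      √|(LinearMap.BilinForm.toMatrix E (killingForm ℝ (GroupLieAlgebra 𝓘(ℝ, EG) G))).det|)
      α η := by
  have key : ∀ X (γ : Fin n → B.adSections) (p : P), (innerVolume hE
      √|(LinearMap.BilinForm.toMatrix E (killingForm ℝ (GroupLieAlgebra 𝓘(ℝ, EG) G))).det| γ •
      η X) (B.proj p) = η X (B.proj p) * ((√|(B.killingMetric.localMatrix E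
        (B.fiberEquiv p).symm).det| * E.det fun a => (γ a).1 p : ℝ) : ℂ) := by
    intro X γ p
    rw [localMatrix_killingMetric]
    refine Eq.trans (b := innerVolume hE _ γ (B.proj p) • η X (B.proj p)) rfl ?_
    rw [innerVolume_apply, Complex.real_smul, mul_comm]
  constructor
  · intro h X γ
    refine ContMDiffMap.ext fun x => ?_
    obtain ⟨p, rfl⟩ := B.exists_proj_eq x
    rw [h X γ p, key]
  · intro h X γ p
    rw [h X γ, key]

end SmoothPrincipalBundle

/-! ### Closedness in the vertical directions, from unimodularity -/

namespace SmoothPrincipalBundle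

variable {B : SmoothPrincipalBundle EM M EG G EP P} {n r : ℕ}
  {F : Type*} [NormedAddCommGroup F] [NormedSpace ℝ F]

theorem ι_lie_fun (v : B.adSections) (f : SmoothFun EM M F) : ⁅B.ι v, f⁆ = 0 := by
  rw [B.bracket_fun, B.anchor_ι, zero_lie]

/-- Vertical fields annihilate the functions on `M`, so only brackets survive and the differential
becomes that of Chevalley and Eilenberg along the fibres. -/
theorem koszul_vertical {q : ℕ}
    (α : B.Atiyah [⋀^Fin q]→ₗ[SmoothFun EM M ℝ] SmoothFun EM M F)
    (γ : Fin (q + 1) → B.adSections) :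
    koszul α (fun i => B.ι (γ i)) = koszulBracketPart α fun i => B.ι (γ i) := by
  rw [koszul, Finset.sum_eq_zero, zero_add]
  intro i _
  rw [ι_lie_fun, smul_zero]

variable [T2Space M] {E : Module.Basis (Fin n) ℝ (GroupLieAlgebra 𝓘(ℝ, EG) G)}
  (hE : ∀ (g : G) v, E.det (fun a => adjointRep g (v a)) = E.det v)

/-- An extension of the volume form of the fibres to the algebroid, with a constant factor. -/
noncomputable def LocalGauge.volumeExt {p : P} (Λ : B.LocalGauge p) (c : F) :
    B.Atiyah [⋀^Fin n]→ₗ[SmoothFun EM M ℝ] SmoothFun EM M F :=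
  (LinearMap.toSpanSingleton (SmoothFun EM M ℝ) (SmoothFun EM M F)
    (constFun EM M c)).compAlternatingMap ((B.volume hE).compLinearMap Λ.vert)

theorem LocalGauge.volumeExt_ι {p : P} (Λ : B.LocalGauge p) (c : F) (γ : Fin n → B.adSections) :
    Λ.volumeExt hE c (fun i => B.ι (γ i)) =
      ((∏ _i : Fin n, Λ.χ) • B.volume hE γ) • constFun EM M c := by
  have h : (fun i => Λ.vert (B.ι (γ i))) = fun i => Λ.χ • γ i := funext fun i => Λ.vert_ι (γ i)
  have h2 : B.volume hE (fun i => Λ.χ • γ i) = (∏ _i : Fin n, Λ.χ) • B.volume hE γ :=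
    (B.volume hE).toMultilinearMap.map_smul_univ (fun _ => Λ.χ) γ
  rw [← h2, ← h]
  rfl

theorem LocalGauge.volumeExt_ι_apply {p : P} (Λ : B.LocalGauge p) (c : F)
    (γ : Fin n → B.adSections) :
    Λ.volumeExt hE c (fun i => B.ι (γ i)) (B.proj p) = (E.det fun i => (γ i).1 p) • c := by
  have h : (fun i => Λ.vert (B.ι (γ i))) = fun i => Λ.χ • γ i := funext fun i => Λ.vert_ι (γ i)
  have h2 : B.volume hE (fun i => Λ.χ • γ i) (B.proj p) = B.volume hE γ (B.proj p) :=
    SmoothFun.map_smul_univ_apply _ _ Λ.χ_self γ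
  rw [← B.volume_apply hE, ← h2, ← h]
  rfl

/-- Cartan's formula for the extended volume has three other terms. Its full differential has more
vertical arguments than the rank and vanishes; the derivative of a function along a vertical field
vanishes; and the sum of the brackets is, by `lie_volume`, again such a derivative. -/
theorem LocalGauge.koszul_curryLeft_volumeExt {m : ℕ}
    {E : Module.Basis (Fin (m + 1)) ℝ (GroupLieAlgebra 𝓘(ℝ, EG) G)}
    (hE : ∀ (g : G) v, E.det (fun a => adjointRep g (v a)) = E.det v)
    {p : P} (Λ : B.LocalGauge p) (c : F) (v : B.adSections) (γ : Fin (m + 1) → B.adSections) :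
    koszul ((Λ.volumeExt hE c).curryLeft (B.ι v)) (fun i => B.ι (γ i)) = 0 := by
  have h1 := koszul_vecCons (Λ.volumeExt hE c) (B.ι v) fun i => B.ι (γ i)
  have h2 : koszul (Λ.volumeExt hE c) (Matrix.vecCons (B.ι v) fun i => B.ι (γ i)) = 0 := by
    refine lieForm_eq_zero_of_vertical E (κ := Fin (m + 2)) (by simp)
      (lieDifferential (Λ.volumeExt hE c)) Function.injective_id _ (Matrix.vecCons v γ) fun k => ?_
    refine Fin.cases ?_ (fun k => ?_) k <;> rfl
  have h3 : ∀ j, Function.update (fun i => B.ι (γ i)) j ⁅B.ι v, B.ι (γ j)⁆ =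
      fun i => B.ι (Function.update γ j (B.adDeriv (B.ι v) (γ j)) i) := fun j => by
    rw [lie_ι]
    exact (Function.comp_update B.ι γ j _).symm
  simp only [h3, Λ.volumeExt_ι] at h1
  rw [← Finset.sum_smul, ← Finset.smul_sum, ← lie_volume, h2, ι_lie_fun, ι_lie_fun, smul_zero,
    zero_smul, sub_zero, zero_sub] at h1
  exact neg_eq_zero.1 h1.symm

/-- The differential of a form of degree one less than the rank of the adjoint bundle vanishes on
vertical arguments. -/
theorem koszul_vertical_eq_zero {q : ℕ} (hq : q + 1 = n)
    (hE : ∀ (g : G) v, E.det (fun a => adjointRep g (v a)) = E.det v)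
    (α : B.Atiyah [⋀^Fin q]→ₗ[SmoothFun EM M ℝ] SmoothFun EM M F)
    (γ : Fin (q + 1) → B.adSections) : koszul α (fun i => B.ι (γ i)) = 0 := by
  subst hq
  refine ContMDiffMap.ext fun x => ?_
  obtain ⟨p, rfl⟩ := B.exists_proj_eq x
  obtain ⟨Λ⟩ := B.nonempty_localGauge p
  let β := adFormAt E (α.compLinearMap B.ιₗ) p
  -- At the point `p`, and on vertical arguments, `α` is the sum of these contractions of the
  -- volume; the coefficients are those of `AlternatingMap.eq_sum_smul_det`, frozen at `p`.
  let Ω : Fin (q + 1) → B.Atiyah [⋀^Fin q]→ₗ[SmoothFun EM M ℝ] SmoothFun EM M F := fun i =>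
    (Λ.volumeExt hE ((-1 : ℤ) ^ (i : ℕ) • β (i.removeNth E))).curryLeft (B.ι (Λ.frame (E i)))
  rw [koszul_vertical]
  -- Equality at `p` suffices since only brackets are left, and the vertical fields are closed under
  -- them.
  refine (koszulBracketPart_eq_sum (SmoothFun.evalAt (B.proj p)) Finset.univ
    (S := Set.range B.ι) ?_ α Ω ?_ _ fun j => ⟨γ j, rfl⟩).trans
      (Finset.sum_eq_zero fun i _ => ?_)
  · rintro x - _ ⟨v, rfl⟩
    exact ⟨_, (B.lie_ι x v).symm⟩
  · intro m hm
    choose δ hδ using hm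
    obtain rfl : (fun j => B.ι (δ j)) = m := funext hδ
    have h1 : α (fun j => B.ι (δ j)) (B.proj p) = β fun j => (δ j).1 p :=
      adForm_apply E (α.compLinearMap B.ιₗ) δ p
    have h2 := AlternatingMap.eq_sum_smul_det E β fun j => (δ j).1 p
    refine h1.trans (h2.trans (Finset.sum_congr rfl fun i _ => ?_))
    have h3 := Λ.volumeExt_ι_apply hE ((-1 : ℤ) ^ (i : ℕ) • β (i.removeNth E))
      (Matrix.vecCons (Λ.frame (E i)) δ)
    have h4 : (fun j => (Matrix.vecCons (Λ.frame (E i)) δ j).1 p) =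
        Matrix.vecCons (E i) fun j => (δ j).1 p := by
      funext j
      refine Fin.cases ?_ (fun j => ?_) j
      · exact Λ.frame_self _
      · rfl
    have h5 : (fun j => B.ι (Matrix.vecCons (Λ.frame (E i)) δ j)) =
        Matrix.vecCons (B.ι (Λ.frame (E i))) fun j => B.ι (δ j) := by
      funext j
      refine Fin.cases ?_ (fun j => ?_) j <;> rfl
    rw [h4, h5] at h3
    exact h3.symm
  · rw [← koszul_vertical, Λ.koszul_curryLeft_volumeExt]
    rfl

end SmoothPrincipalBundle

/-- The degrees `k + 1 + n` and `(k + n) + 1` agree only propositionally. The cast mediates between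
appending vertical arguments and putting a base argument in front. -/
theorem Fin.append_vecCons_comp_cast {A : Type*} {k n q : ℕ} (h : q + 1 = k + 1 + n)
    (h' : q = k + n) (a : A) (X : Fin k → A) (Z : Fin n → A) :
    Fin.append (Matrix.vecCons a X) Z ∘ Fin.cast h =
      Matrix.vecCons a (Fin.append X Z ∘ Fin.cast h') := by
  subst h'
  funext i
  refine Fin.cases ?_ (fun i => Fin.addCases (fun i => ?_) (fun i => ?_) i) i
  · have : Fin.cast h 0 = Fin.castAdd n (0 : Fin (k + 1)) := rfl
    simp only [Function.comp_apply, this, Fin.append_left, Matrix.cons_val_zero]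
  · have : Fin.cast h (Fin.castAdd n i).succ = Fin.castAdd n i.succ := rfl
    simp only [Function.comp_apply, this, Fin.append_left, Matrix.cons_val_succ]
    exact (Fin.append_left X Z i).symm
  · have : Fin.cast h (Fin.natAdd k i).succ = Fin.natAdd (k + 1) i := by
      ext; simp; omega
    simp only [Function.comp_apply, this, Fin.append_right, Matrix.cons_val_succ]
    exact (Fin.append_right X Z i).symm

theorem Fin.append_update_left {A : Type*} {k n : ℕ} (X : Fin k → A) (Z : Fin n → A) (i : Fin k)
    (a : A) : Function.update (Fin.append X Z) (Fin.castAdd n i) a =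
      Fin.append (Function.update X i a) Z := by
  rw [← Fin.extend_castAdd _ X, ← Function.extend_update (Fin.castAdd_injective k n),
    Fin.extend_castAdd]

theorem Fin.append_update_right {A : Type*} {k n : ℕ} (X : Fin k → A) (Z : Fin n → A) (i : Fin n)
    (a : A) : Function.update (Fin.append X Z) (Fin.natAdd k i) a =
      Fin.append X (Function.update Z i a) := by
  rw [← Fin.extend_natAdd X _ Z, ← Function.extend_update (Fin.natAdd_injective n k),
    Fin.extend_natAdd]

/-! ### Induction by Cartan's formula -/

namespace SmoothPrincipalBundle

variable {B : SmoothPrincipalBundle EM M EG G EP P} {n : ℕ}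
  {F : Type*} [NormedAddCommGroup F] [NormedSpace ℝ F]
  [T2Space M] {E : Module.Basis (Fin n) ℝ (GroupLieAlgebra 𝓘(ℝ, EG) G)}
  (hE : ∀ (g : G) v, E.det (fun a => adjointRep g (v a)) = E.det v) (c : ℝ)

/-- The part of Cartan's formula not involving the contracted form. -/
theorem lie_sub_sum_update_append {k q : ℕ} (h : q = k + n)
    (α : B.Atiyah [⋀^Fin q]→ₗ[SmoothFun EM M ℝ] SmoothFun EM M F)
    (η : VF EM M [⋀^Fin k]→ₗ[SmoothFun EM M ℝ] SmoothFun EM M F)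
    (hη : ∀ (X : Fin k → B.Atiyah) (γ : Fin n → B.adSections),
      α (Fin.append X (fun a => B.ι (γ a)) ∘ Fin.cast h) =
        innerVolume hE c γ • η fun i => B.anchor (X i))
    (X₀ : B.Atiyah) (X : Fin k → B.Atiyah) (γ : Fin n → B.adSections) :
    ⁅X₀, α (Fin.append X (fun a => B.ι (γ a)) ∘ Fin.cast h)⁆ -
      ∑ j, α (Function.update (Fin.append X (fun a => B.ι (γ a)) ∘ Fin.cast h) j
        ⁅X₀, (Fin.append X (fun a => B.ι (γ a)) ∘ Fin.cast h) j⁆) =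
      innerVolume hE c γ • (⁅B.anchor X₀, η fun i => B.anchor (X i)⁆ -
        ∑ i, η (Function.update (fun i => B.anchor (X i)) i ⁅B.anchor X₀, B.anchor (X i)⁆)) := by
  subst h
  have hη' : ∀ (X : Fin k → B.Atiyah) (γ : Fin n → B.adSections),
      α (Fin.append X fun a => B.ι (γ a)) = innerVolume hE c γ • η fun i => B.anchor (X i) := hη
  -- In the first slots the bracket projects to the base, since the anchor preserves brackets.
  have h1 : ∀ i, α (Function.update (Fin.append X fun a => B.ι (γ a)) (Fin.castAdd n i)
      ⁅X₀, Fin.append X (fun a => B.ι (γ a)) (Fin.castAdd n i)⁆) = innerVolume hE c γ •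
        η (Function.update (fun i => B.anchor (X i)) i ⁅B.anchor X₀, B.anchor (X i)⁆) := by
    intro i
    rw [Fin.append_left, Fin.append_update_left, hη', ← anchor_lie]
    congr 2
    exact Function.comp_update B.anchor X i _
  -- In the last slots the bracket stays vertical and differentiates `γ a`, changing the volume
  -- factor only.
  have h2 : ∀ a, α (Function.update (Fin.append X fun a => B.ι (γ a)) (Fin.natAdd k a)
      ⁅X₀, Fin.append X (fun a => B.ι (γ a)) (Fin.natAdd k a)⁆) =
        innerVolume hE c (Function.update γ a (B.adDeriv X₀ (γ a))) •
          η fun i => B.anchor (X i) := by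
    intro a
    rw [Fin.append_right, Fin.append_update_right, lie_ι, ← hη']
    congr 2
    exact (Function.comp_update B.ι γ a _).symm
  change ⁅X₀, α (Fin.append X fun a => B.ι (γ a))⁆ -
      ∑ j, α (Function.update (Fin.append X fun a => B.ι (γ a)) j
        ⁅X₀, Fin.append X (fun a => B.ι (γ a)) j⁆) = _
  rw [Fin.sum_univ_add]
  simp only [h1, h2]
  -- The derivative of the volume factor is exactly the sum of the contributions of the vertical
  -- slots, and the two cancel.
  rw [hη', LieRinehartModule.lie_smul' (R := SmoothFun EM M ℝ), lie_innerVolume, ← Finset.sum_smul,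
    ← Finset.smul_sum, smul_sub, B.bracket_fun]
  abel

/-- If `η` is the factor of `α`, then the differential of `η` is the factor of that of `α`. -/
theorem koszul_append {k q : ℕ} (h : q = k + n)
    (α : B.Atiyah [⋀^Fin q]→ₗ[SmoothFun EM M ℝ] SmoothFun EM M F)
    (η : VF EM M [⋀^Fin k]→ₗ[SmoothFun EM M ℝ] SmoothFun EM M F)
    (hη : ∀ (X : Fin k → B.Atiyah) (γ : Fin n → B.adSections),
      α (Fin.append X (fun a => B.ι (γ a)) ∘ Fin.cast h) =
        innerVolume hE c γ • η fun i => B.anchor (X i))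
    (X₀ : B.Atiyah) (X : Fin k → B.Atiyah) (γ : Fin n → B.adSections) :
    koszul α (Matrix.vecCons X₀ (Fin.append X (fun a => B.ι (γ a)) ∘ Fin.cast h)) =
      innerVolume hE c γ • koszul η (Matrix.vecCons (B.anchor X₀) fun i => B.anchor (X i)) := by
  have key := lie_sub_sum_update_append hE c h α η hη X₀ X γ
  induction k generalizing q X₀ with
  | zero =>
    rw [koszul_vecCons_zero]
    rw [Finset.univ_eq_empty (α := Fin 0), Finset.sum_empty, sub_zero] at key
    -- With `q = 0` there is nothing to contract. Otherwise the contraction by `X₀` has degree `n -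
    -- 1` and all its `n` remaining arguments are vertical, so its differential contributes nothing.
    cases q with
    | zero =>
      rw [koszul_vecCons_zero]
      rw [Finset.univ_eq_empty, Finset.sum_empty, sub_zero] at key
      exact key
    | succ q =>
      obtain rfl : q + 1 = n := by omega
      have h1 : (Fin.append X (fun a => B.ι (γ a)) ∘ Fin.cast h) = fun a => B.ι (γ a) := by
        rw [Fin.append_left_nil _ _ rfl]
        rfl
      rw [koszul_vecCons, key, h1, koszul_vertical_eq_zero rfl hE, sub_zero]
  | succ k ih =>
    obtain ⟨q, rfl⟩ : ∃ q', q = q' + 1 := ⟨k + n, by omega⟩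
    have h' : q = k + n := by omega
    have hX : X = Matrix.vecCons (X 0) fun i => X i.succ := by
      funext i
      refine Fin.cases ?_ (fun i => ?_) i <;> rfl
    have haX : (fun i => B.anchor (X i)) =
        Matrix.vecCons (B.anchor (X 0)) fun i => B.anchor (X i.succ) := by
      funext i
      refine Fin.cases ?_ (fun i => ?_) i <;> rfl
    -- Contraction is compatible with factors: contracting `α` by `X₀` contracts `η` by the anchor
    -- of `X₀`, so the induction applies.
    have hη' : ∀ (X : Fin k → B.Atiyah) (γ : Fin n → B.adSections),
        α.curryLeft X₀ (Fin.append X (fun a => B.ι (γ a)) ∘ Fin.cast h') =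
          innerVolume hE c γ • η.curryLeft (B.anchor X₀) fun i => B.anchor (X i) := by
      intro X γ
      have := hη (Matrix.vecCons X₀ X) γ
      rw [Fin.append_vecCons_comp_cast h h'] at this
      refine this.trans ?_
      congr 1
      refine congrArg η (funext fun i => ?_)
      refine Fin.cases ?_ (fun i => ?_) i <;> rfl
    have h1 := ih h' (α.curryLeft X₀) (η.curryLeft (B.anchor X₀)) hη' (X 0) (fun i => X i.succ)
      (lie_sub_sum_update_append hE c h' _ _ hη' (X 0) _ γ)
    rw [← Fin.append_vecCons_comp_cast h h', ← hX, ← haX] at h1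
    rw [koszul_vecCons, koszul_vecCons, key, h1, ← smul_sub]

end SmoothPrincipalBundle

/-! ### The inner integral and the differentials -/

namespace SmoothPrincipalBundle

variable {B : SmoothPrincipalBundle EM M EG G EP P} {n : ℕ}
  [T2Space M] {E : Module.Basis (Fin n) ℝ (GroupLieAlgebra 𝓘(ℝ, EG) G)}

theorem existsUnique_isInnerIntegral
    (hE : ∀ (g : G) v, E.det (fun a => adjointRep g (v a)) = E.det v)
    (hss : LieAlgebra.IsSemisimple ℝ (GroupLieAlgebra 𝓘(ℝ, EG) G)) {r : ℕ}
    (α : B.LieForm (r + n)) : ∃! η, IsInnerIntegral B.killingMetric E α η := by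
  obtain ⟨η, hη⟩ := exists_isFactor hE (killing_sqrt_ne_zero hss E) α
  refine ⟨η, (isInnerIntegral_iff_isFactor hE).2 hη, fun η' hη' => ?_⟩
  exact IsFactor.unique hE (killing_sqrt_ne_zero hss E)
    ((isInnerIntegral_iff_isFactor hE).1 hη') hη

theorem innerIntegralDegree_eq
    (hE : ∀ (g : G) v, E.det (fun a => adjointRep g (v a)) = E.det v)
    (hss : LieAlgebra.IsSemisimple ℝ (GroupLieAlgebra 𝓘(ℝ, EG) G)) {r : ℕ}
    {α : B.LieForm (r + n)} {η : BaseForm EM M r} (h : IsInnerIntegral B.killingMetric E α η) :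
    innerIntegralDegree B.killingMetric E α = η := by
  have hex : ∃ η, IsInnerIntegral B.killingMetric E α η := ⟨η, h⟩
  rw [innerIntegralDegree, dif_pos hex]
  exact (existsUnique_isInnerIntegral hE hss α).unique hex.choose_spec h

theorem isInnerIntegral_innerIntegralDegree
    (hE : ∀ (g : G) v, E.det (fun a => adjointRep g (v a)) = E.det v)
    (hss : LieAlgebra.IsSemisimple ℝ (GroupLieAlgebra 𝓘(ℝ, EG) G)) {r : ℕ}
    (α : B.LieForm (r + n)) :
    IsInnerIntegral B.killingMetric E α (innerIntegralDegree B.killingMetric E α) := by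
  obtain ⟨η, h, -⟩ := existsUnique_isInnerIntegral hE hss α
  rwa [innerIntegralDegree_eq hE hss h]

/-- The de Rham differential has no component of degree `0`. Accordingly the component of degree `n`
of the differential on `A`, evaluated on `n` vertical arguments, vanishes by unimodularity. -/
theorem isFactor_dLie_zero (hE : ∀ (g : G) v, E.det (fun a => adjointRep g (v a)) = E.det v)
    (c : ℝ) (α : ∀ q, B.LieForm q) :
    IsFactor (innerVolume hE c) (dLie α (0 + n)) (0 : BaseForm EM M 0) := by
  intro X γ
  rw [AlternatingMap.zero_apply, smul_zero]
  -- The degree is made a variable in order to distinguish whether it is a successor; for `n = 0`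
  -- the differential is zero by definition.
  have key : ∀ N (h : N = 0 + n),
      dLie α N (Fin.append X (fun a => B.ι (γ a)) ∘ Fin.cast h) = 0 := by
    intro N h
    cases N with
    | zero => rfl
    | succ q =>
      have h1 : (Fin.append X (fun a => B.ι (γ a)) ∘ Fin.cast h) =
          fun a => B.ι (γ (Fin.cast (h.trans (zero_add n)) a)) := by
        rw [Fin.append_left_nil _ _ rfl]
        rfl
      rw [h1]
      exact koszul_vertical_eq_zero (h.trans (zero_add n)) hE (α q) _
  exact key _ rfl

/-- This is `koszul_append` with the first base argument split off. -/
theorem isFactor_dLie_succ (hE : ∀ (g : G) v, E.det (fun a => adjointRep g (v a)) = E.det v)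
    (c : ℝ) (α : ∀ q, B.LieForm q) {r : ℕ} {η : BaseForm EM M r}
    (hη : IsFactor (innerVolume hE c) (α (r + n)) η) :
    IsFactor (innerVolume hE c) (dLie α (r + 1 + n)) (lieDifferential η) := by
  intro X γ
  have key : ∀ N (h : N = r + 1 + n),
      dLie α N (Fin.append X (fun a => B.ι (γ a)) ∘ Fin.cast h) =
        innerVolume hE c γ • lieDifferential η fun i => B.anchor (X i) := by
    intro N h
    obtain ⟨q, rfl⟩ : ∃ q, N = q + 1 := ⟨r + n, by omega⟩
    have h' : q = r + n := by omega
    have hX : X = Matrix.vecCons (X 0) fun i => X i.succ := by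
      funext i
      refine Fin.cases ?_ (fun i => ?_) i <;> rfl
    have haX : (fun i => B.anchor (X i)) =
        Matrix.vecCons (B.anchor (X 0)) fun i => B.anchor (X i.succ) := by
      funext i
      refine Fin.cases ?_ (fun i => ?_) i <;> rfl
    have hη' : ∀ (X : Fin r → B.Atiyah) (γ : Fin n → B.adSections),
        α q (Fin.append X (fun a => B.ι (γ a)) ∘ Fin.cast h') =
          innerVolume hE c γ • η fun i => B.anchor (X i) := by
      subst h'
      exact hη
    have h1 := koszul_append hE c h' (α q) η hη' (X 0) (fun i => X i.succ) γ
    rw [← Fin.append_vecCons_comp_cast h h', ← hX, ← haX] at h1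
    exact h1
  exact key _ rfl

/-- The inner integral is the unique factor, so it is enough that the differential of the factor is
a factor of the differential. -/
theorem innerIntegral_dLie (hE : ∀ (g : G) v, E.det (fun a => adjointRep g (v a)) = E.det v)
    (hss : LieAlgebra.IsSemisimple ℝ (GroupLieAlgebra 𝓘(ℝ, EG) G)) (α : ∀ q, B.LieForm q) :
    innerIntegral B.killingMetric E (dLie α) = deRham (innerIntegral B.killingMetric E α) := by
  funext r
  cases r with
  | zero =>
    exact innerIntegralDegree_eq hE hss
      ((isInnerIntegral_iff_isFactor hE).2 (isFactor_dLie_zero hE _ α))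
  | succ r =>
    exact innerIntegralDegree_eq hE hss ((isInnerIntegral_iff_isFactor hE).2
      (isFactor_dLie_succ hE _ α ((isInnerIntegral_iff_isFactor hE).1
        (isInnerIntegral_innerIntegralDegree hE hss (α (r + n))))))

end SmoothPrincipalBundle

end InnerIntegralTheory

theorem mainTheorem8
    {EM : Type*} [NormedAddCommGroup EM] [NormedSpace ℝ EM] [FiniteDimensional ℝ EM]
    {M : Type*} [TopologicalSpace M] [ChartedSpace EM M] [IsManifold 𝓘(ℝ, EM) ∞ M]
    [T2Space M] [SecondCountableTopology M]
    {EG : Type*} [NormedAddCommGroup EG] [NormedSpace ℝ EG] [FiniteDimensional ℝ EG]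
    {G : Type*} [TopologicalSpace G] [ChartedSpace EG G] [Group G] [LieGroup 𝓘(ℝ, EG) ∞ G]
    [ConnectedSpace G]
    {EP : Type*} [NormedAddCommGroup EP] [NormedSpace ℝ EP] [FiniteDimensional ℝ EP]
    {P : Type*} [TopologicalSpace P] [ChartedSpace EP P] [IsManifold 𝓘(ℝ, EP) ∞ P]
    (B : SmoothPrincipalBundle EM M EG G EP P)
    (hss : LieAlgebra.IsSemisimple ℝ (GroupLieAlgebra 𝓘(ℝ, EG) G))
    {n : ℕ} (E : Module.Basis (Fin n) ℝ (GroupLieAlgebra 𝓘(ℝ, EG) G)) :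
    -- in every local trivialization, the matrix of the metric is constant and `√|h|` is locally
    -- constant
    (∀ (U : Set M), IsOpen U → ∀ Ψ : B.AdTrivialization U,
      (∀ x ∈ U, ∀ y ∈ U, B.killingMetric.localMatrix E (Ψ.toEquiv x) =
        B.killingMetric.localMatrix E (Ψ.toEquiv y)) ∧
      IsLocallyConstant fun x : U => √|(B.killingMetric.localMatrix E (Ψ.toEquiv x)).det|) ∧
    -- the inner integral of every form is well-defined
    (∀ (r : ℕ) (α : B.LieForm (r + n)),
      ∃! η, SmoothPrincipalBundle.IsInnerIntegral B.killingMetric E α η) ∧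
    -- inner integration commutes with the differentials
    ((∀ x : GroupLieAlgebra 𝓘(ℝ, EG) G,
        LinearMap.trace ℝ _ (LieAlgebra.ad ℝ (GroupLieAlgebra 𝓘(ℝ, EG) G) x) = 0) →
      ∀ α : ∀ q, B.LieForm q,
        SmoothPrincipalBundle.innerIntegral B.killingMetric E (SmoothPrincipalBundle.dLie α) =
          SmoothPrincipalBundle.deRham
            (SmoothPrincipalBundle.innerIntegral B.killingMetric E α)) := by
  -- Unimodularity at the level of the group: it makes the fibre volume a function on `M` and,
  -- infinitesimally, closed in the vertical directions.
  have hE := det_adjointRep E hss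
  refine ⟨fun U _ Ψ => ⟨fun x _ y _ => ?_, ?_⟩, fun r α => ?_, fun _ α => ?_⟩
  · rw [SmoothPrincipalBundle.localMatrix_killingMetric,
      SmoothPrincipalBundle.localMatrix_killingMetric]
  · simp only [SmoothPrincipalBundle.localMatrix_killingMetric]
    exact IsLocallyConstant.const _
  · exact SmoothPrincipalBundle.existsUnique_isInnerIntegral hE hss α
  · exact SmoothPrincipalBundle.innerIntegral_dLie hE hss α
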